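/- Let $\Theta$ be the category of finite sets and injections, with the symmetric monoidal structure given by disjoint union, whose unit $\varnothing$ is an initial object. Let $\widetilde{\Theta}$ be the symmetric monoidal category with the same objects and with $$\widetilde{\Theta}(a,b)=\operatorname*{colim}_{t\in\Theta}\Theta(a,b\sqcup t),$$ where the composite of the classes of $f:a\to b\sqcup t$ and $g:b\to c\sqcup u$ is the class of $(g\sqcup t)\circ f:a\to c\sqcup u\sqcup t$, and where the monoidal structure is again given by disjoint union; its unit is a zero object. Let $\mathcal{A}$ be a Grothendieck category. For a small symmetric monoidal category $(\mathcal{M},\oplus,0)$ whose unit $0$ is an initial object, let $\mathbf{Fct}(\mathcal{M},\mathcal{A})$ be the category of functors $\mathcal{M}\to\mathcal{A}$. For $x\in\mathcal{M}$ and $F\in\mathbf{Fct}(\mathcal{M},\mathcal{A})$, put $\tau_x(F)=F(x\oplus-)$, let $i_x:F\to\tau_x(F)$ be the map induced by $0\to x$, and let $\kappa_x(F)$ and $\delta_x(F)$ be the kernel and the cokernel of $i_x$. The functor $F$ is called stably null if $F=\sum_{x\in\mathcal{M}}\kappa_x(F)$. The stably null functors form a thick subcategory; let $\mathbf{St}(\mathcal{M},\mathcal{A})$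 be the quotient of $\mathbf{Fct}(\mathcal{M},\mathcal{A})$ by it. The functors $\delta_x$ induce endofunctors, still denoted by $\delta_x$, of $\mathbf{St}(\mathcal{M},\mathcal{A})$. Define full subcategories of $\mathbf{St}(\mathcal{M},\mathcal{A})$ recursively as follows: $\mathcal{P}ol_n(\mathcal{M},\mathcal{A})=\{0\}$ for $n<0$ and, for $n\ge 0$, an object $X$ is in $\mathcal{P}ol_n(\mathcal{M},\mathcal{A})$ if and only if $\delta_x(X)$ is in $\mathcal{P}ol_{n-1}(\mathcal{M},\mathcal{A})$ for all $x\in\mathcal{M}$. Let $\mathcal{P}ol_n(\mathcal{M},\mathcal{A})/\mathcal{P}ol_{n-1}(\mathcal{M},\mathcal{A})$ be the quotient abelian category, that is, the localization of $\mathcal{P}ol_n(\mathcal{M},\mathcal{A})$ at the morphisms whose kernel and cokernel are in the thick subcategory $\mathcal{P}ol_{n-1}(\mathcal{M},\mathcal{A})$. Then, for every $n\in\mathbb{N}$, there are equivalences of categories $$\mathcal{P}ol_n(\Theta,\mathcal{A})/\mathcal{P}ol_{n-1}(\Theta,\mathcal{A})\;\simeq\;\mathcal{P}ol_n(\widetilde{\Theta},\mathcal{A})/\mathcal{P}ol_{n-1}(\widetilde{\Theta},\mathcal{A})\;\simeq\;\mathbf{Fct}(\Sigma_n,\mathcal{A}),$$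 where $\Sigma_n$ is the symmetric group on $n$ letters, seen as a category with one object. -/

import Mathlib

open CategoryTheory MonoidalCategory Limits

universe w v u

/-- The category `Θ` of finite sets and injections, in its skeletal form: the object `n` stands for
the finite set `Fin n`. -/
structure Theta : Type where
  card : ℕ

namespace Theta

instance : SmallCategory Theta where
  Hom a b := Fin a.card ↪ Fin b.card
  id a := Function.Embedding.refl _
  comp f g := Function.Embedding.trans f g

/-- The injection underlying a morphism of `Θ`. -/
def fn {a b : Theta} (f : a ⟶ b) : Fin a.card → Fin b.card :=
  (show Fin a.card ↪ Fin b.card from f)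

/-- The morphism of `Θ` given by an injective map. -/
def ofEmb {a b : Theta} (f : Fin a.card ↪ Fin b.card) : a ⟶ b := f

@[simp] theorem fn_ofEmb {a b : Theta} (f : Fin a.card ↪ Fin b.card) : fn (ofEmb f) = f := rfl
@[simp] theorem fn_id (a : Theta) (i : Fin a.card) : fn (𝟙 a) i = i := rfl
@[simp] theorem fn_comp {a b c : Theta} (f : a ⟶ b) (g : b ⟶ c) (i : Fin a.card) :
    fn (f ≫ g) i = fn g (fn f i) := rfl

theorem hom_ext {a b : Theta} {f g : a ⟶ b} (h : ∀ i, fn f i = fn g i) : f = g :=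
  Function.Embedding.ext h

/-- The isomorphism of `Θ` given by a bijection. -/
def isoOfEquiv {a b : Theta} (e : Fin a.card ≃ Fin b.card) : a ≅ b where
  hom := ofEmb e.toEmbedding
  inv := ofEmb e.symm.toEmbedding
  hom_inv_id := hom_ext fun i => e.symm_apply_apply i
  inv_hom_id := hom_ext fun i => e.apply_symm_apply i

/-- The disjoint union of two injections. -/
def sumEmb {a b c d : ℕ} (f : Fin a ↪ Fin b) (g : Fin c ↪ Fin d) : Fin (a + c) ↪ Fin (b + d) :=
  finSumFinEquiv.symm.toEmbedding.trans ((f.sumMap g).trans finSumFinEquiv.toEmbedding)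

@[simp] theorem sumEmb_castAdd {a b c d : ℕ} (f : Fin a ↪ Fin b) (g : Fin c ↪ Fin d) (i : Fin a) :
    sumEmb f g (Fin.castAdd c i) = Fin.castAdd d (f i) := by
  simp [sumEmb]

@[simp] theorem sumEmb_natAdd {a b c d : ℕ} (f : Fin a ↪ Fin b) (g : Fin c ↪ Fin d) (i : Fin c) :
    sumEmb f g (Fin.natAdd a i) = Fin.natAdd b (g i) := by
  simp [sumEmb]

/-- Disjoint union, with unit the empty set. -/
instance : MonoidalCategoryStruct Theta where
  tensorObj a b := ⟨a.card + b.card⟩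
  tensorHom f g := ofEmb (sumEmb f g)
  whiskerLeft a _ _ g := ofEmb (sumEmb (Function.Embedding.refl (Fin a.card)) g)
  whiskerRight f c := ofEmb (sumEmb f (Function.Embedding.refl (Fin c.card)))
  tensorUnit := ⟨0⟩
  associator a b c := isoOfEquiv (finCongr (Nat.add_assoc a.card b.card c.card))
  leftUnitor a := isoOfEquiv (finCongr (Nat.zero_add a.card))
  rightUnitor a := isoOfEquiv (finCongr (Nat.add_zero a.card))

@[simp] theorem card_tensor (a b : Theta) : (a ⊗ b).card = a.card + b.card := rfl
@[simp] theorem card_unit : (𝟙_ Theta).card = 0 := rfl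

/-- The canonical maps into a disjoint union. -/
def inl (a b : Theta) (i : Fin a.card) : Fin (a ⊗ b).card := Fin.castAdd b.card i
def inr (a b : Theta) (i : Fin b.card) : Fin (a ⊗ b).card := Fin.natAdd a.card i

theorem sum_cases {a b : Theta} {P : Fin (a ⊗ b).card → Prop}
    (h₁ : ∀ i, P (inl a b i)) (h₂ : ∀ i, P (inr a b i)) (i : Fin (a ⊗ b).card) : P i :=
  Fin.addCases (m := a.card) (n := b.card) (motive := P) h₁ h₂ i

section
variable {a b c d : Theta}
@[simp] theorem fn_tensor_inl (f : a ⟶ b) (g : c ⟶ d) (i : Fin a.card) :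
    fn (f ⊗ₘ g) (inl a c i) = inl b d (fn f i) := sumEmb_castAdd _ _ _
@[simp] theorem fn_tensor_inr (f : a ⟶ b) (g : c ⟶ d) (i : Fin c.card) :
    fn (f ⊗ₘ g) (inr a c i) = inr b d (fn g i) := sumEmb_natAdd _ _ _
@[simp] theorem fn_whiskerLeft_inl (f : c ⟶ d) (i : Fin a.card) :
    fn (a ◁ f) (inl a c i) = inl a d i := sumEmb_castAdd _ _ _
@[simp] theorem fn_whiskerLeft_inr (f : c ⟶ d) (i : Fin c.card) :
    fn (a ◁ f) (inr a c i) = inr a d (fn f i) := sumEmb_natAdd _ _ _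
@[simp] theorem fn_whiskerRight_inl (f : a ⟶ b) (i : Fin a.card) :
    fn (f ▷ c) (inl a c i) = inl b c (fn f i) := sumEmb_castAdd _ _ _
@[simp] theorem fn_whiskerRight_inr (f : a ⟶ b) (i : Fin c.card) :
    fn (f ▷ c) (inr a c i) = inr b c i := sumEmb_natAdd _ _ _
@[simp] theorem fn_assoc_inl_inl (i : Fin a.card) :
    fn (α_ a b c).hom (inl (a ⊗ b) c (inl a b i)) = inl a (b ⊗ c) i := rfl
@[simp] theorem fn_assoc_inl_inr (i : Fin b.card) :
    fn (α_ a b c).hom (inl (a ⊗ b) c (inr a b i)) = inr a (b ⊗ c) (inl b c i) := rfl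
@[simp] theorem fn_assoc_inr (i : Fin c.card) :
    fn (α_ a b c).hom (inr (a ⊗ b) c i) = inr a (b ⊗ c) (inr b c i) :=
  Fin.ext (Nat.add_assoc a.card b.card i)
@[simp] theorem fn_assocInv_inl (i : Fin a.card) :
    fn (α_ a b c).inv (inl a (b ⊗ c) i) = inl (a ⊗ b) c (inl a b i) := rfl
@[simp] theorem fn_assocInv_inr_inl (i : Fin b.card) :
    fn (α_ a b c).inv (inr a (b ⊗ c) (inl b c i)) = inl (a ⊗ b) c (inr a b i) := rfl
@[simp] theorem fn_assocInv_inr_inr (i : Fin c.card) :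
    fn (α_ a b c).inv (inr a (b ⊗ c) (inr b c i)) = inr (a ⊗ b) c i :=
  Fin.ext (Nat.add_assoc a.card b.card i).symm
@[simp] theorem fn_leftUnitor (i : Fin a.card) : fn (λ_ a).hom (inr (𝟙_ Theta) a i) = i :=
  Fin.ext (Nat.zero_add _)
@[simp] theorem fn_rightUnitor (i : Fin a.card) : fn (ρ_ a).hom (inl a (𝟙_ Theta) i) = i := rfl
end

instance : MonoidalCategory Theta := MonoidalCategory.ofTensorHom
  (id_tensorHom_id := fun a b => hom_ext <| sum_cases (by simp) (by simp))
  (id_tensorHom := fun _ _ _ _ => hom_ext <| sum_cases (by simp) (by simp))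
  (tensorHom_id := fun _ _ => hom_ext <| sum_cases (by simp) (by simp))
  (tensorHom_comp_tensorHom := fun _ _ _ _ => hom_ext <| sum_cases (by simp) (by simp))
  (associator_naturality := fun _ _ _ =>
    hom_ext <| sum_cases (sum_cases (by simp) (by simp)) (by simp))
  (leftUnitor_naturality := fun _ => hom_ext <| sum_cases (fun i => i.elim0) (by simp))
  (rightUnitor_naturality := fun _ => hom_ext <| sum_cases (by simp) (fun i => i.elim0))
  (pentagon := fun _ _ _ _ =>
    hom_ext <| sum_cases (sum_cases (sum_cases (by simp) (by simp)) (by simp)) (by simp))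
  (triangle := fun _ _ => hom_ext <|
    sum_cases (sum_cases (by simp) (fun i => i.elim0)) (by simp))

/-- The symmetry exchanging the two summands of a disjoint union. -/
def swap (a b : Theta) : a ⊗ b ≅ b ⊗ a := isoOfEquiv (a := a ⊗ b) (b := b ⊗ a) finAddFlip

@[simp] theorem fn_swap_inl (a b : Theta) (i : Fin a.card) :
    fn (swap a b).hom (inl a b i) = inr b a i := finAddFlip_apply_castAdd _ _
@[simp] theorem fn_swap_inr (a b : Theta) (i : Fin b.card) :
    fn (swap a b).hom (inr a b i) = inl b a i := finAddFlip_apply_natAdd _ _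

instance : SymmetricCategory Theta where
  braiding := swap
  braiding_naturality_right _ _ _ _ := hom_ext <| sum_cases (by simp) (by simp)
  braiding_naturality_left _ _ := hom_ext <| sum_cases (by simp) (by simp)
  hexagon_forward _ _ _ := hom_ext <| sum_cases (sum_cases (by simp) (by simp)) (by simp)
  hexagon_reverse _ _ _ := hom_ext <| sum_cases (by simp) (sum_cases (by simp) (by simp))
  symmetry _ _ := hom_ext <| sum_cases (by simp) (by simp)

/-- The empty set is initial in `Θ`. -/
def unitIsInitial : IsInitial (𝟙_ Theta) :=
  IsInitial.ofUniqueHom (fun _ => ofEmb ⟨fun i => i.elim0, fun i => i.elim0⟩)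
    fun _ _ => hom_ext fun i => i.elim0

end Theta

/-- The class of monoidal categories whose unit object is initial. -/
class UnitInitial (M : Type u) [Category.{v} M] [MonoidalCategory M] : Prop where
  nonempty_isInitial : Nonempty (IsInitial (𝟙_ M))

instance : UnitInitial Theta := ⟨⟨Theta.unitIsInitial⟩⟩

/-- The unique morphism from the unit `0` to an object `x`. -/
noncomputable def fromUnit {M : Type u} [Category.{v} M] [MonoidalCategory M] [UnitInitial M]
    (x : M) : 𝟙_ M ⟶ x :=
  (UnitInitial.nonempty_isInitial (M := M)).some.to x

theorem fromUnit_unique {M : Type u} [Category.{v} M] [MonoidalCategory M] [UnitInitial M]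
    {x : M} (f g : 𝟙_ M ⟶ x) : f = g :=
  (UnitInitial.nonempty_isInitial (M := M)).some.hom_ext f g

/-- The category `M̃` attached to a symmetric monoidal category `M`: same objects as `M`. -/
structure Tilde (M : Type u) : Type u where
  ofObj ::
  of : M

namespace Tilde

section
variable {M : Type u} [Category.{v} M] [MonoidalCategory M]

/-- An element of the disjoint union over `t : M` of the sets `M(a, b ⊕ t)`. -/
structure Rep (a b : M) : Type (max u v) where
  t : M
  hom : a ⟶ b ⊗ t

/-- `f : a ⟶ b ⊕ t` is related to its image `a ⟶ b ⊕ t'` under each morphism `t ⟶ t'`. -/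
def Rel (a b : M) (p q : Rep a b) : Prop := ∃ g : p.t ⟶ q.t, p.hom ≫ b ◁ g = q.hom

/-- The morphisms `a ⟶ b` of `M̃`: the colimit of the functor `t ↦ M(a, b ⊕ t)` from `M` to sets, that
is, the quotient of the disjoint union by the equivalence relation generated by `Rel`. -/
def THom (a b : M) : Type (max u v) := Quot (Rel a b)

/-- The class in `M̃(a, b)` of a morphism `a ⟶ b ⊕ t` of `M`. -/
def cls {a b : M} (t : M) (f : a ⟶ b ⊗ t) : THom a b := Quot.mk _ ⟨t, f⟩

theorem cls_eq {a b t t' : M} (f : a ⟶ b ⊗ t) (g : t ⟶ t') (f' : a ⟶ b ⊗ t')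
    (h : f ≫ b ◁ g = f') : cls t f = cls t' f' :=
  Quot.sound ⟨g, h⟩

theorem cls_surj {a b : M} (x : THom a b) : ∃ (t : M) (f : a ⟶ b ⊗ t), x = cls t f := by
  obtain ⟨⟨t, f⟩, rfl⟩ := Quot.exists_rep x
  exact ⟨t, f, rfl⟩

/-- The composition of `M̃`: the composite of the classes of `f : a ⟶ b ⊕ t` and `g : b ⟶ c ⊕ u` is
the class of `a ⟶ b ⊕ t ⟶ (c ⊕ u) ⊕ t ≅ c ⊕ (u ⊕ t)`. -/
def comp {a b c : M} : THom a b → THom b c → THom a c :=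
  Quot.map₂ (fun p q => ⟨q.t ⊗ p.t, p.hom ≫ q.hom ▷ p.t ≫ (α_ c q.t p.t).hom⟩)
    (by
      rintro ⟨t, f⟩ ⟨u, g⟩ ⟨u', g'⟩ ⟨(k : u ⟶ u'), (h : g ≫ c ◁ k = g')⟩
      subst h
      exact ⟨k ▷ t, by simp⟩)
    (by
      rintro ⟨t, f⟩ ⟨t', f'⟩ ⟨u, g⟩ ⟨(k : t ⟶ t'), (h : f ≫ b ◁ k = f')⟩
      subst h
      exact ⟨u ◁ k, by simp [whisker_exchange_assoc]⟩)

theorem comp_cls {a b c t u : M} (f : a ⟶ b ⊗ t) (g : b ⟶ c ⊗ u) :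
    comp (cls t f) (cls u g) = cls (u ⊗ t) (f ≫ g ▷ t ≫ (α_ c u t).hom) := rfl

instance : Category.{max u v} (Tilde M) where
  Hom a b := THom a.of b.of
  id a := cls (𝟙_ M) (ρ_ a.of).inv
  comp f g := comp f g
  id_comp := by
    rintro ⟨a⟩ ⟨b⟩ f
    obtain ⟨t, f, rfl⟩ := cls_surj f
    exact cls_eq _ (ρ_ t).hom _ (by simp)
  comp_id := by
    rintro ⟨a⟩ ⟨b⟩ f
    obtain ⟨t, f, rfl⟩ := cls_surj f
    exact cls_eq _ (λ_ t).hom _ (by simp)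
  assoc := by
    rintro ⟨a⟩ ⟨b⟩ ⟨c⟩ ⟨d⟩ f g h
    obtain ⟨t, f, rfl⟩ := cls_surj f
    obtain ⟨u, g, rfl⟩ := cls_surj g
    obtain ⟨v, h, rfl⟩ := cls_surj h
    refine cls_eq _ (α_ v u t).inv _ ?_
    simp

/-- The class of `f : a ⟶ b ⊕ t`, as a morphism of `M̃`. -/
def mk {a b : Tilde M} (t : M) (f : a.of ⟶ b.of ⊗ t) : a ⟶ b := cls t f

theorem mk_eq {a b : Tilde M} {t t' : M} (f : a.of ⟶ b.of ⊗ t) (g : t ⟶ t') (f' : a.of ⟶ b.of ⊗ t')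
    (h : f ≫ b.of ◁ g = f') : (mk t f : a ⟶ b) = mk t' f' :=
  cls_eq f g f' h

theorem mk_surj {a b : Tilde M} (x : a ⟶ b) : ∃ (t : M) (f : a.of ⟶ b.of ⊗ t), x = mk t f :=
  cls_surj x

theorem mk_comp {a b c : Tilde M} {t u : M} (f : a.of ⟶ b.of ⊗ t) (g : b.of ⟶ c.of ⊗ u) :
    (mk t f : a ⟶ b) ≫ (mk u g : b ⟶ c) = mk (u ⊗ t) (f ≫ g ▷ t ≫ (α_ c.of u t).hom) := rfl

theorem id_eq (a : Tilde M) : 𝟙 a = mk (𝟙_ M) (ρ_ a.of).inv := rfl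

variable (M) in
/-- The canonical functor `M ⥤ M̃`. -/
def eta : M ⥤ Tilde M where
  obj a := ⟨a⟩
  map {_ b} f := mk (𝟙_ M) (f ≫ (ρ_ b).inv)
  map_id a := by simp [id_eq]
  map_comp {a b c} f g := by
    rw [mk_comp]
    exact (mk_eq _ (λ_ _).hom _ (by simp)).symm

theorem eta_map {a b : M} (f : a ⟶ b) :
    ((eta M).map f : (⟨a⟩ : Tilde M) ⟶ ⟨b⟩) = mk (𝟙_ M) (f ≫ (ρ_ b).inv) := rfl

theorem mk_comp_eta {a : Tilde M} {b c : M} {t : M} (f : a.of ⟶ b ⊗ t) (g : b ⟶ c) :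
    (mk t f : a ⟶ ⟨b⟩) ≫ (eta M).map g = mk t (f ≫ g ▷ t) := by
  exact mk_eq (a := a) (b := ⟨c⟩) (f ≫ (g ≫ (ρ_ c).inv) ▷ t ≫ (α_ c (𝟙_ M) t).hom) (λ_ t).hom _
    (by simp)

theorem eta_comp_mk {a b : M} {c : Tilde M} {t : M} (f : a ⟶ b) (g : b ⟶ c.of ⊗ t) :
    (eta M).map f ≫ (mk t g : (⟨b⟩ : Tilde M) ⟶ c) = mk t (f ≫ g) := by
  exact mk_eq (a := ⟨a⟩) (b := c)
    ((f ≫ (ρ_ b).inv) ≫ g ▷ (𝟙_ M) ≫ (α_ c.of t (𝟙_ M)).hom) (ρ_ t).hom _ (by simp)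

end

variable {M : Type u} [Category.{v} M] [MonoidalCategory M] [SymmetricCategory M]

theorem tensorμ_nat {a b c d t t' u u' : M} (f : a ⟶ b ⊗ t) (g : c ⟶ d ⊗ u) (k : t ⟶ t')
    (l : u ⟶ u') :
    ((f ⊗ₘ g) ≫ tensorμ b t d u) ≫ (b ⊗ d) ◁ (k ⊗ₘ l) =
      ((f ≫ b ◁ k) ⊗ₘ (g ≫ d ◁ l)) ≫ tensorμ b t' d u' := by
  rw [← id_tensorHom b k, ← id_tensorHom d l, ← tensorHom_comp_tensorHom, Category.assoc,
    Category.assoc, tensorμ_natural, id_tensorHom_id, id_tensorHom]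

/-- The tensor product of morphisms of `M̃`: the product of the classes of `f : a ⟶ b ⊕ t` and
`g : c ⟶ d ⊕ u` is the class of `a ⊕ c ⟶ (b ⊕ t) ⊕ (d ⊕ u) ≅ (b ⊕ d) ⊕ (t ⊕ u)`. -/
def tensor {a b c d : M} : THom a b → THom c d → THom (a ⊗ c) (b ⊗ d) :=
  Quot.map₂ (fun p q => ⟨p.t ⊗ q.t, (p.hom ⊗ₘ q.hom) ≫ tensorμ b p.t d q.t⟩)
    (by
      rintro ⟨t, f⟩ ⟨u, g⟩ ⟨u', g'⟩ ⟨(k : u ⟶ u'), (h : g ≫ d ◁ k = g')⟩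
      subst h
      exact ⟨𝟙 t ⊗ₘ k, (tensorμ_nat f g (𝟙 t) k).trans (by simp)⟩)
    (by
      rintro ⟨t, f⟩ ⟨t', f'⟩ ⟨u, g⟩ ⟨(k : t ⟶ t'), (h : f ≫ b ◁ k = f')⟩
      subst h
      exact ⟨k ⊗ₘ 𝟙 u, (tensorμ_nat f g k (𝟙 u)).trans (by simp)⟩)

/-- The tensor product of `M̃` is that of `M` on objects; the structural isomorphisms are the images
of those of `M`. -/
instance : MonoidalCategoryStruct (Tilde M) where
  tensorObj a b := ⟨a.of ⊗ b.of⟩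
  tensorHom f g := tensor f g
  whiskerLeft a _ _ g := tensor (𝟙 a : a ⟶ a) g
  whiskerRight f c := tensor f (𝟙 c : c ⟶ c)
  tensorUnit := ⟨𝟙_ M⟩
  associator a b c := (eta M).mapIso (α_ a.of b.of c.of)
  leftUnitor a := (eta M).mapIso (λ_ a.of)
  rightUnitor a := (eta M).mapIso (ρ_ a.of)

theorem mk_tensor {a b c d : Tilde M} {t u : M} (f : a.of ⟶ b.of ⊗ t) (g : c.of ⟶ d.of ⊗ u) :
    (mk t f : a ⟶ b) ⊗ₘ (mk u g : c ⟶ d) = mk (t ⊗ u) ((f ⊗ₘ g) ≫ tensorμ b.of t d.of u) := rfl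

theorem eta_tensor {a b c d : M} (f : a ⟶ b) (g : c ⟶ d) :
    tensorHom (C := Tilde M) ((eta M).map f) ((eta M).map g) = (eta M).map (f ⊗ₘ g) := by
  refine cls_eq (a := a ⊗ c) (b := b ⊗ d)
    (((f ≫ (ρ_ b).inv) ⊗ₘ (g ≫ (ρ_ d).inv)) ≫ tensorμ b (𝟙_ M) d (𝟙_ M)) (λ_ (𝟙_ M)).hom
    ((f ⊗ₘ g) ≫ (ρ_ (b ⊗ d)).inv) ?_
  rw [← cancel_mono (ρ_ (b ⊗ d)).hom]
  simp only [Category.assoc, Iso.inv_hom_id, Category.comp_id]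
  rw [← rightUnitor_monoidal, tensorHom_comp_tensorHom]
  simp

theorem eta_whiskerRight {a b : M} (f : a ⟶ b) (c : Tilde M) :
    whiskerRight (C := Tilde M) ((eta M).map f) c = (eta M).map (f ▷ c.of) := by
  have h := eta_tensor f (𝟙 c.of)
  rw [tensorHom_id, (eta M).map_id] at h
  exact h

theorem eta_whiskerLeft {a b : M} (c : Tilde M) (f : a ⟶ b) :
    whiskerLeft (C := Tilde M) c ((eta M).map f) = (eta M).map (c.of ◁ f) := by
  have h := eta_tensor (𝟙 c.of) f
  rw [id_tensorHom, (eta M).map_id] at h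
  exact h

theorem tensor_comp_tensor {a₁ b₁ c₁ a₂ b₂ c₂ t u t' u' : M} (f₁ : a₁ ⟶ b₁ ⊗ t)
    (f₂ : a₂ ⟶ b₂ ⊗ u) (g₁ : b₁ ⟶ c₁ ⊗ t') (g₂ : b₂ ⟶ c₂ ⊗ u') :
    comp (tensor (cls t f₁) (cls u f₂)) (tensor (cls t' g₁) (cls u' g₂)) =
      tensor (comp (cls t f₁) (cls t' g₁)) (comp (cls u f₂) (cls u' g₂)) := by
  refine (cls_eq _ (tensorμ t' t u' u) _ ?_).symm
  have h₁ := associator_monoidal c₁ t' t c₂ u' u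
  have h₂ := tensorμ_natural g₁ (𝟙 t) g₂ (𝟙 u)
  rw [id_tensorHom_id, tensorHom_id, tensorHom_id, tensorHom_id] at h₂
  rw [← tensorHom_comp_tensorHom, ← tensorHom_comp_tensorHom]
  simp only [Category.assoc, comp_whiskerRight]
  rw [← h₁, reassoc_of% h₂]

theorem associator_nat {a₁ a₂ a₃ b₁ b₂ b₃ t u v : M} (f₁ : a₁ ⟶ b₁ ⊗ t) (f₂ : a₂ ⟶ b₂ ⊗ u)
    (f₃ : a₃ ⟶ b₃ ⊗ v) :
    cls _ ((((f₁ ⊗ₘ f₂) ≫ tensorμ b₁ t b₂ u) ⊗ₘ f₃) ≫ tensorμ (b₁ ⊗ b₂) (t ⊗ u) b₃ v ≫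
        (α_ b₁ b₂ b₃).hom ▷ ((t ⊗ u) ⊗ v)) =
      cls _ ((α_ a₁ a₂ a₃).hom ≫ (f₁ ⊗ₘ ((f₂ ⊗ₘ f₃) ≫ tensorμ b₂ u b₃ v)) ≫
        tensorμ b₁ t (b₂ ⊗ b₃) (u ⊗ v)) := by
  refine cls_eq _ (α_ t u v).hom _ ?_
  have h := tensor_associativity b₁ t b₂ u b₃ v
  have h₁ : ((f₁ ⊗ₘ f₂) ≫ tensorμ b₁ t b₂ u) ⊗ₘ f₃ =
      ((f₁ ⊗ₘ f₂) ⊗ₘ f₃) ≫ tensorμ b₁ t b₂ u ▷ (b₃ ⊗ v) := by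
    rw [← tensorHom_id, tensorHom_comp_tensorHom, Category.comp_id]
  have h₂ : f₁ ⊗ₘ ((f₂ ⊗ₘ f₃) ≫ tensorμ b₂ u b₃ v) =
      (f₁ ⊗ₘ (f₂ ⊗ₘ f₃)) ≫ (b₁ ⊗ t) ◁ tensorμ b₂ u b₃ v := by
    rw [← id_tensorHom, tensorHom_comp_tensorHom, Category.comp_id]
  rw [MonoidalCategory.tensorHom_def] at h
  rw [h₁, h₂]
  simp only [Category.assoc]
  rw [h, ← associator_naturality_assoc]

theorem leftUnitor_nat {a b t : M} (f : a ⟶ b ⊗ t) :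
    cls _ (((ρ_ (𝟙_ M)).inv ⊗ₘ f) ≫ tensorμ (𝟙_ M) (𝟙_ M) b t ≫ (λ_ b).hom ▷ (𝟙_ M ⊗ t)) =
      cls _ ((λ_ a).hom ≫ f) := by
  refine cls_eq _ (λ_ t).hom _ ?_
  have h := tensor_left_unitality b t
  rw [MonoidalCategory.tensorHom_def] at h
  rw [MonoidalCategory.tensorHom_def' _ f, ← leftUnitor_naturality, h, ← unitors_inv_equal]
  simp only [Category.assoc]

theorem rightUnitor_nat {a b t : M} (f : a ⟶ b ⊗ t) :
    cls _ ((f ⊗ₘ (ρ_ (𝟙_ M)).inv) ≫ tensorμ b t (𝟙_ M) (𝟙_ M) ≫ (ρ_ b).hom ▷ (t ⊗ 𝟙_ M)) =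
      cls _ ((ρ_ a).hom ≫ f) := by
  refine cls_eq _ (ρ_ t).hom _ ?_
  have h := tensor_right_unitality b t
  rw [MonoidalCategory.tensorHom_def] at h
  rw [MonoidalCategory.tensorHom_def f, ← rightUnitor_naturality, h, ← unitors_inv_equal]
  simp only [Category.assoc]

instance : MonoidalCategory (Tilde M) := MonoidalCategory.ofTensorHom
  (id_tensorHom_id := fun a b => by
    have h := eta_tensor (𝟙 a.of) (𝟙 b.of)
    rw [id_tensorHom_id, (eta M).map_id, (eta M).map_id, (eta M).map_id] at h
    exact h)
  (id_tensorHom := fun _ _ _ _ => rfl)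
  (tensorHom_id := fun _ _ => rfl)
  (tensorHom_comp_tensorHom := fun f₁ f₂ g₁ g₂ => by
    obtain ⟨t, f₁, rfl⟩ := mk_surj f₁
    obtain ⟨u, f₂, rfl⟩ := mk_surj f₂
    obtain ⟨t', g₁, rfl⟩ := mk_surj g₁
    obtain ⟨u', g₂, rfl⟩ := mk_surj g₂
    exact tensor_comp_tensor f₁ f₂ g₁ g₂)
  (associator_naturality := fun {X₁ X₂ X₃ Y₁ Y₂ Y₃} f₁ f₂ f₃ => by
    obtain ⟨t, f₁, rfl⟩ := mk_surj f₁
    obtain ⟨u, f₂, rfl⟩ := mk_surj f₂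
    obtain ⟨v, f₃, rfl⟩ := mk_surj f₃
    refine (mk_comp_eta (a := ⟨(X₁.of ⊗ X₂.of) ⊗ X₃.of⟩) _ _).trans
      (Eq.trans ?_ (eta_comp_mk (c := ⟨Y₁.of ⊗ Y₂.of ⊗ Y₃.of⟩) _ _).symm)
    refine Eq.trans ?_ (associator_nat f₁ f₂ f₃)
    exact congrArg (cls _) (Category.assoc _ _ _))
  (leftUnitor_naturality := fun {X Y} f => by
    obtain ⟨t, f, rfl⟩ := mk_surj f
    refine (mk_comp_eta (a := ⟨𝟙_ M ⊗ X.of⟩) _ _).trans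
      (Eq.trans ?_ (eta_comp_mk (c := Y) _ _).symm)
    refine Eq.trans ?_ (leftUnitor_nat f)
    exact congrArg (cls _) (Category.assoc _ _ _))
  (rightUnitor_naturality := fun {X Y} f => by
    obtain ⟨t, f, rfl⟩ := mk_surj f
    refine (mk_comp_eta (a := ⟨X.of ⊗ 𝟙_ M⟩) _ _).trans
      (Eq.trans ?_ (eta_comp_mk (c := Y) _ _).symm)
    refine Eq.trans ?_ (rightUnitor_nat f)
    exact congrArg (cls _) (Category.assoc _ _ _))
  (pentagon := fun a b c d => by
    change whiskerRight (C := Tilde M) ((eta M).map (α_ a.of b.of c.of).hom) d ≫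
        (eta M).map (α_ a.of (b.of ⊗ c.of) d.of).hom ≫
        whiskerLeft (C := Tilde M) a ((eta M).map (α_ b.of c.of d.of).hom) =
      (eta M).map (α_ (a.of ⊗ b.of) c.of d.of).hom ≫ (eta M).map (α_ a.of b.of (c.of ⊗ d.of)).hom
    refine (congrArg₂ (fun (x : THom _ _) (y : THom _ _) =>
      comp x (comp ((eta M).map (α_ a.of (b.of ⊗ c.of) d.of).hom) y))
      (eta_whiskerRight _ d) (eta_whiskerLeft a _)).trans ?_
    exact (((eta M).map_comp _ _).trans (congrArg (_ ≫ ·) ((eta M).map_comp _ _))).symm.trans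
      ((congrArg (eta M).map (pentagon a.of b.of c.of d.of)).trans ((eta M).map_comp _ _)))
  (triangle := fun a b => by
    change (eta M).map (α_ a.of (𝟙_ M) b.of).hom ≫
        whiskerLeft (C := Tilde M) a ((eta M).map (λ_ b.of).hom) =
      whiskerRight (C := Tilde M) ((eta M).map (ρ_ a.of).hom) b
    refine (congrArg (fun (y : THom _ _) =>
      comp ((eta M).map (α_ a.of (𝟙_ M) b.of).hom) y) (eta_whiskerLeft a _)).trans ?_
    exact (((eta M).map_comp _ _).symm.trans (congrArg (eta M).map (triangle a.of b.of))).trans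
      (eta_whiskerRight _ b).symm)

theorem tensorμ_braiding (b t d u : M) :
    (tensorμ b t d u ≫ (β_ b d).hom ▷ (t ⊗ u)) ≫ (d ⊗ b) ◁ (β_ t u).hom =
      (β_ (b ⊗ t) (d ⊗ u)).hom ≫ tensorμ d u b t := by
  simp [tensorμ, SymmetricCategory.braiding_swap_eq_inv_braiding b u]

theorem braiding_nat {a b c d t u : M} (f : a ⟶ b ⊗ t) (g : c ⟶ d ⊗ u) :
    cls _ (((f ⊗ₘ g) ≫ tensorμ b t d u) ≫ (β_ b d).hom ▷ (t ⊗ u)) =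
      cls _ ((β_ a c).hom ≫ (g ⊗ₘ f) ≫ tensorμ d u b t) := by
  refine cls_eq _ (β_ t u).hom _ ?_
  rw [Category.assoc, Category.assoc, ← Category.assoc (tensorμ b t d u), tensorμ_braiding,
    BraidedCategory.braiding_naturality_assoc]

theorem tensor_comp_braiding {a b c d : Tilde M} (f : a ⟶ b) (g : c ⟶ d) :
    tensorHom f g ≫ (eta M).map (β_ b.of d.of).hom =
      (eta M).map (β_ a.of c.of).hom ≫ tensorHom g f := by
  obtain ⟨t, f, rfl⟩ := mk_surj f
  obtain ⟨u, g, rfl⟩ := mk_surj g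
  refine (mk_comp_eta (a := ⟨a.of ⊗ c.of⟩) _ _).trans
    (Eq.trans ?_ (eta_comp_mk (c := ⟨d.of ⊗ b.of⟩) _ _).symm)
  exact braiding_nat f g

instance : SymmetricCategory (Tilde M) where
  braiding a b := (eta M).mapIso (β_ a.of b.of)
  braiding_naturality_right a _ _ f := tensor_comp_braiding (𝟙 a) f
  braiding_naturality_left f c := tensor_comp_braiding f (𝟙 c)
  hexagon_forward a b c := by
    change (eta M).map (α_ a.of b.of c.of).hom ≫ (eta M).map (β_ a.of (b.of ⊗ c.of)).hom ≫
        (eta M).map (α_ b.of c.of a.of).hom =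
      whiskerRight (C := Tilde M) ((eta M).map (β_ a.of b.of).hom) c ≫
        (eta M).map (α_ b.of a.of c.of).hom ≫
        whiskerLeft (C := Tilde M) b ((eta M).map (β_ a.of c.of).hom)
    refine Eq.trans ?_ (congrArg₂ (fun (x : THom _ _) (y : THom _ _) =>
      comp x (comp ((eta M).map (α_ b.of a.of c.of).hom) y))
      (eta_whiskerRight _ c) (eta_whiskerLeft b _)).symm
    have h := congrArg (eta M).map (BraidedCategory.hexagon_forward a.of b.of c.of)
    simp only [Functor.map_comp] at h
    exact h
  hexagon_reverse a b c := by
    change (eta M).map (α_ a.of b.of c.of).inv ≫ (eta M).map (β_ (a.of ⊗ b.of) c.of).hom ≫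
        (eta M).map (α_ c.of a.of b.of).inv =
      whiskerLeft (C := Tilde M) a ((eta M).map (β_ b.of c.of).hom) ≫
        (eta M).map (α_ a.of c.of b.of).inv ≫
        whiskerRight (C := Tilde M) ((eta M).map (β_ a.of c.of).hom) b
    refine Eq.trans ?_ (congrArg₂ (fun (x : THom _ _) (y : THom _ _) =>
      comp x (comp ((eta M).map (α_ a.of c.of b.of).inv) y))
      (eta_whiskerLeft a _) (eta_whiskerRight _ b)).symm
    have h := congrArg (eta M).map (BraidedCategory.hexagon_reverse a.of b.of c.of)
    simp only [Functor.map_comp] at h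
    exact h
  symmetry a b := ((eta M).map_comp _ _).symm.trans
    ((congrArg (eta M).map (SymmetricCategory.symmetry a.of b.of)).trans ((eta M).map_id _))

instance [UnitInitial M] : UnitInitial (Tilde M) := ⟨⟨by
  refine IsInitial.ofUniqueHom (X := (⟨𝟙_ M⟩ : Tilde M)) (fun a => (eta M).map (fromUnit a.of)) ?_
  rintro a f
  obtain ⟨t, f, rfl⟩ := mk_surj f
  exact (cls_eq (a := 𝟙_ M) (b := a.of) _ (fromUnit t) _ (fromUnit_unique (M := M) _ _)).symm⟩⟩

end Tilde

section FilteredUnions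

variable {C : Type u} [Category.{v} C] [Abelian C] {J : Type} [Preorder J] [IsDirectedOrder J]
  [Nonempty J]

/-- The diagram of a monotone family of subobjects. -/
noncomputable abbrev subobjectDiagram {Z : C} {K : J → Subobject Z} (hK : Monotone K) : J ⥤ C :=
  hK.functor ⋙ Subobject.underlying

/-- The cocone given by the inclusions of a monotone family of subobjects. -/
noncomputable abbrev subobjectCocone {Z : C} {K : J → Subobject Z} (hK : Monotone K) :
    Cocone (subobjectDiagram hK) where
  pt := Z
  ι :=
    { app := fun j => (K j).arrow
      naturality := fun _ _ f =>
        (Subobject.underlying_arrow (hK.functor.map f)).trans (Category.comp_id _).symm }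

variable [HasColimitsOfShape J C] [HasExactColimitsOfShape J C]

theorem isColimit_of_isLUB {Z : C} {K : J → Subobject Z} (hK : Monotone K)
    (h : IsLUB (Set.range K) ⊤) : Nonempty (IsColimit (subobjectCocone hK)) := by
  have : IsConnected J := IsFiltered.isConnected J
  let c := subobjectCocone hK
  let d := colimit.desc _ c
  let φ : subobjectDiagram hK ⟶ (Functor.const J).obj Z := c.ι
  have : ∀ j, Mono (φ.app j) := fun j => inferInstanceAs (Mono (K j).arrow)
  have : Mono φ := NatTrans.mono_of_mono_app φ
  have hd : Mono d := colim.map_mono' φ (colimit.isColimit _) (isColimitConstCocone J Z) d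
    (fun j => by
      have : colimit.ι (subobjectDiagram hK) j ≫ d = c.ι.app j := colimit.ι_desc _ _
      exact this.trans (Category.comp_id _).symm)
  have htop : Subobject.mk d = ⊤ := by
    refine top_le_iff.1 (h.2 ?_)
    rintro _ ⟨j, rfl⟩
    exact Subobject.le_mk_of_comm (colimit.ι (subobjectDiagram hK) j) (colimit.ι_desc _ _)
  have : IsIso d := Subobject.isIso_iff_mk_eq_top d |>.2 htop
  have : IsIso ((colimit.isColimit (subobjectDiagram hK)).desc c) := this
  exact ⟨IsColimit.ofPointIso (colimit.isColimit _) (t := c)⟩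

/-- A morphism out of `Y` vanishes if it vanishes on the pullbacks along some `Y ⟶ Z` of the terms
of a filtered colimit presentation of `Z`. -/
theorem eq_zero_of_pullback {F : J ⥤ C} {c : Cocone F} (hc : IsColimit c) {Y W : C}
    (f : Y ⟶ c.pt) (g : Y ⟶ W) (h : ∀ j, pullback.snd (c.ι.app j) f ≫ g = 0) : g = 0 := by
  have : IsConnected J := IsFiltered.isConnected J
  refine (hc.pullbackOfHasExactColimitsOfShape f).hom_ext (fun j => ?_)
  rw [← cancel_epi (pullbackObjIso _ _ _).inv]
  simpa using! h j

end FilteredUnions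

section Stable

variable {M : Type} [SmallCategory M] [MonoidalCategory M]
variable (A : Type u) [Category.{v} A] [Abelian A]

/-- The translation functor `τ_x`: precomposition with `x ⊕ -`. -/
abbrev translation (x : M) : (M ⥤ A) ⥤ (M ⥤ A) :=
  (Functor.whiskeringLeft M M A).obj (tensorLeft x)

variable [UnitInitial M]

/-- The morphism `m ≅ 0 ⊕ m ⟶ x ⊕ m` induced by `0 ⟶ x`, natural in `m`. -/
noncomputable def unitTo (x : M) : 𝟭 M ⟶ tensorLeft x where
  app m := (λ_ m).inv ≫ fromUnit x ▷ m
  naturality m n f := by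
    change f ≫ (λ_ n).inv ≫ fromUnit x ▷ n = ((λ_ m).inv ≫ fromUnit x ▷ m) ≫ x ◁ f
    rw [leftUnitor_inv_naturality_assoc, whisker_exchange, Category.assoc]

/-- The natural transformation `i_x : F ⟶ τ_x F` induced by `0 ⟶ x`. -/
noncomputable def iota (x : M) : 𝟭 (M ⥤ A) ⟶ translation A x where
  app F :=
    { app := fun m => F.map ((unitTo x).app m)
      naturality := fun m n f => by
        have h := (unitTo x).naturality f
        simp only [Functor.id_map] at h
        simp only [Functor.id_obj, Functor.whiskeringLeft_obj_obj, Functor.comp_map,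
          ← F.map_comp, h] }
  naturality F G f := by
    ext m
    exact (f.naturality _).symm

/-- The difference functor `δ_x`: the cokernel of `i_x`. -/
noncomputable def difference (x : M) : (M ⥤ A) ⥤ (M ⥤ A) where
  obj F := cokernel ((iota A x).app F)
  map {F G} f := cokernel.map _ _ f ((translation A x).map f) ((iota A x).naturality f).symm
  map_id F := by
    rw [← cancel_epi (cokernel.π _)]
    simp
  map_comp f g := by
    rw [← cancel_epi (cokernel.π _)]
    simp

variable {A} in
/-- The subfunctor `κ_x(F)` of `F`: the kernel of `i_x : F ⟶ τ_x F`. -/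
noncomputable def kappa (F : M ⥤ A) (x : M) : Subobject F := kernelSubobject ((iota A x).app F)

variable (M) in
/-- A functor `F` is stably null if the sum `κ(F)` of the subfunctors `κ_x(F)`, `x : M`, is `F`; the
sum of a family of subobjects is their least upper bound. -/
def stablyNull : ObjectProperty (M ⥤ A) := fun F => IsLUB (Set.range (kappa F)) ⊤

variable {A}

theorem stablyNull_iff (F : M ⥤ A) : stablyNull M A F ↔
    ∀ ⦃W : M ⥤ A⦄ (h : F ⟶ W), (∀ x, kernel.ι ((iota A x).app F) ≫ h = 0) → h = 0 := by
  constructor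
  · intro hF W h hx
    have : (⊤ : Subobject F) ≤ kernelSubobject h := hF.2 (by
      rintro _ ⟨x, rfl⟩
      exact Subobject.mk_le_mk_of_comm (kernel.lift h _ (hx x)) (by simp))
    rw [top_le_iff] at this
    have e : (⊤ : Subobject F).arrow ≫ h = 0 := by
      rw [← this]
      exact kernelSubobject_arrow_comp h
    exact (cancel_epi (⊤ : Subobject F).arrow).1 (e.trans comp_zero.symm)
  · intro hF
    refine ⟨fun _ _ => le_top, fun S hS => ?_⟩
    have : cokernel.π S.arrow = 0 := hF _ fun x => by
      have hx := hS ⟨x, rfl⟩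
      have : kernel.ι ((iota A x).app F) = Subobject.ofMkLE _ S hx ≫ S.arrow :=
        (Subobject.ofMkLE_arrow _).symm
      rw [this, Category.assoc, cokernel.condition, comp_zero]
    have : Epi S.arrow := Abelian.epi_of_cokernel_π_eq_zero _ this
    have : IsIso S.arrow := isIso_of_mono_of_epi _
    exact (Subobject.eq_top_of_isIso_arrow S).ge

theorem unitTo_tensor (x y m : M) :
    (unitTo (y ⊗ x)).app m ≫ (α_ y x m).hom = (unitTo x).app m ≫ (unitTo y).app (x ⊗ m) := by
  have h : fromUnit (y ⊗ x) = fromUnit x ≫ (λ_ x).inv ≫ fromUnit y ▷ x := fromUnit_unique _ _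
  simp [unitTo, h]

theorem comp_iota_of_hom {F T : M ⥤ A} (t : T ⟶ F) {x z : M} (g : x ⟶ z)
    (h : t ≫ (iota A x).app F = 0) : t ≫ (iota A z).app F = 0 := by
  ext m
  have e : (unitTo z).app m = (unitTo x).app m ≫ g ▷ m := by
    have : fromUnit z = fromUnit x ≫ g := fromUnit_unique _ _
    simp [unitTo, this]
  have h' : t.app m ≫ F.map ((unitTo x).app m) = 0 := NatTrans.congr_app h m
  change t.app m ≫ F.map ((unitTo z).app m) = 0
  rw [e, F.map_comp, ← Category.assoc, h', zero_comp]

theorem comp_iota_tensor {F T : M ⥤ A} (t : T ⟶ F) {x y : M}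
    (h : t ≫ (iota A x).app F ≫ (translation A x).map ((iota A y).app F) = 0) :
    t ≫ (iota A (y ⊗ x)).app F = 0 := by
  ext m
  have h' : t.app m ≫ F.map ((unitTo x).app m) ≫ F.map ((unitTo y).app (x ⊗ m)) = 0 :=
    NatTrans.congr_app h m
  have e : (unitTo (y ⊗ x)).app m =
      ((unitTo x).app m ≫ (unitTo y).app (x ⊗ m)) ≫ (α_ y x m).inv := by
    rw [← unitTo_tensor]
    exact (Category.comp_id _).symm.trans (by rw [Category.assoc]; simp)
  change t.app m ≫ F.map ((unitTo (y ⊗ x)).app m) = 0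
  rw [e, F.map_comp, F.map_comp, ← Category.assoc, h', zero_comp]

theorem kappa_mono (F : M ⥤ A) {x z : M} (g : x ⟶ z) : kappa F x ≤ kappa F z :=
  Subobject.mk_le_mk_of_comm
    (kernel.lift _ (kernel.ι _) (comp_iota_of_hom _ g (kernel.condition _))) (by simp)

/-- The objects of `M`, preordered by the inclusions of the subfunctors `κ_x(F)` of `F`. -/
def KappaIndex (_F : M ⥤ A) : Type := M

/-- The index of `κ_x(F)`. -/
def KappaIndex.of (F : M ⥤ A) (x : M) : KappaIndex F := x

noncomputable instance (F : M ⥤ A) : Preorder (KappaIndex F) := Preorder.lift (fun x : M => kappa F x)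

instance (F : M ⥤ A) : IsDirectedOrder (KappaIndex F) :=
  ⟨fun (x y : M) => ⟨KappaIndex.of F (x ⊗ y), kappa_mono F ((ρ_ x).inv ≫ x ◁ fromUnit y),
    kappa_mono F ((λ_ y).inv ≫ fromUnit x ▷ y)⟩⟩

instance (F : M ⥤ A) : Nonempty (KappaIndex F) := ⟨KappaIndex.of F (𝟙_ M)⟩

theorem exactColimits_kappaIndex [IsGrothendieckAbelian.{w} A] (F : M ⥤ A) :
    ∃ _ : HasColimitsOfShape (KappaIndex F) A, HasExactColimitsOfShape (KappaIndex F) A := by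
  have : HasFilteredColimitsOfSize.{0, 0} A := hasFilteredColimitsOfSize_of_univLE.{0, 0, w, w}
  have : AB5OfSize.{0, 0} A := AB5OfSize_of_univLE.{0, 0, w, w} A
  exact ⟨HasFilteredColimitsOfSize.HasColimitsOfShape _, AB5OfSize.ofShape _⟩

theorem eq_zero_of_locally [IsGrothendieckAbelian.{w} A] {B : M ⥤ A} (hB : stablyNull M A B)
    (Φ : (M ⥤ A) ⥤ (M ⥤ A)) [PreservesColimitsOfShape (KappaIndex B) Φ]
    [Φ.PreservesZeroMorphisms] {Y W : M ⥤ A} (f : Y ⟶ Φ.obj B) (g : Y ⟶ W)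
    (h : ∀ (x : M) (T : M ⥤ A) (t : T ⟶ Y), t ≫ f ≫ Φ.map ((iota A x).app B) = 0 → t ≫ g = 0) :
    g = 0 := by
  obtain ⟨_, _⟩ := exactColimits_kappaIndex.{w} B
  let K : KappaIndex B → Subobject B := fun x : M => kappa B x
  have hK : Monotone K := fun _ _ h => h
  obtain ⟨hc⟩ := isColimit_of_isLUB hK hB
  refine eq_zero_of_pullback (isColimitOfPreserves Φ hc) f g fun (x : M) => h x _ _ ?_
  have e : (kappa B x).arrow ≫ (iota A x).app B = 0 := kernelSubobject_arrow_comp _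
  have e' : Φ.map (kappa B x).arrow ≫ Φ.map ((iota A x).app B) = 0 := by
    rw [← Φ.map_comp, e, Φ.map_zero]
  refine (pullback.condition_assoc _).symm.trans ?_
  exact (congrArg (_ ≫ ·) e').trans comp_zero

instance [IsGrothendieckAbelian.{w} A] : (stablyNull M A).IsSerreClass where
  exists_zero :=
    have ⟨Z, hZ⟩ := HasZeroObject.zero (C := M ⥤ A)
    ⟨Z, hZ, (stablyNull_iff _).2 fun _ _ _ => hZ.eq_of_src _ _⟩
  prop_of_mono {G F} f _ hF := (stablyNull_iff _).2 fun W g hg => by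
    refine eq_zero_of_locally.{w} hF (𝟭 _) f g fun x T t ht => ?_
    have h₁ : (t ≫ (iota A x).app G) ≫ (translation A x).map f = 0 := by
      rw [Category.assoc, ← (iota A x).naturality f]
      exact ht
    have : Mono ((translation A x).map f) := inferInstance
    have h₂ : t ≫ (iota A x).app G = 0 := zero_of_comp_mono _ h₁
    rw [← kernel.lift_ι _ t h₂, Category.assoc, hg x, comp_zero]
  prop_of_epi {F G} f _ hF := (stablyNull_iff _).2 fun W g hg => by
    rw [← cancel_epi f, comp_zero]
    refine (stablyNull_iff _).1 hF _ fun x => ?_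
    have h₁ : (kernel.ι ((iota A x).app F) ≫ f) ≫ (iota A x).app G = 0 := by
      have := (iota A x).naturality f
      rw [Functor.id_map] at this
      rw [Category.assoc, this, kernel.condition_assoc, zero_comp]
    rw [← Category.assoc, ← kernel.lift_ι _ _ h₁, Category.assoc, hg x, comp_zero]
  prop_X₂_of_shortExact {S} hS hB hA := (stablyNull_iff _).2 fun W g hg => by
    obtain ⟨_, _⟩ := exactColimits_kappaIndex.{w} S.X₁
    refine eq_zero_of_locally.{w} hA (𝟭 _) S.g g fun x T t ht => ?_
    have : PreservesFiniteLimits (translation A x) := inferInstance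
    have := hS.mono_f
    have h₁ : (t ≫ (iota A x).app S.X₂) ≫ (translation A x).map S.g = 0 := by
      rw [Category.assoc, ← (iota A x).naturality S.g]
      exact ht
    have : Mono (S.map (translation A x)).f :=
      inferInstanceAs (Mono ((translation A x).map S.f))
    have hex : (S.map (translation A x)).Exact := hS.exact.map (translation A x)
    obtain ⟨φ, hφ⟩ : ∃ φ : T ⟶ (translation A x).obj S.X₁,
        φ ≫ (translation A x).map S.f = t ≫ (iota A x).app S.X₂ :=
      ⟨hex.lift _ h₁, hex.lift_f _ h₁⟩
    refine eq_zero_of_locally.{w} hB (translation A x) φ (t ≫ g) fun y T' t' ht' => ?_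
    have h₂ : (t' ≫ t) ≫ (iota A (y ⊗ x)).app S.X₂ = 0 := by
      refine comp_iota_tensor (t' ≫ t) ?_
      have h₃ : S.f ≫ (iota A y).app S.X₂ = (iota A y).app S.X₁ ≫ (translation A y).map S.f :=
        (iota A y).naturality S.f
      rw [Category.assoc, ← Category.assoc t, ← hφ, Category.assoc, ← Functor.map_comp, h₃,
        Functor.map_comp]
      exact (by simp only [Category.assoc] : _ = (t' ≫ φ ≫ (translation A x).map
        ((iota A y).app S.X₁)) ≫ (translation A x).map ((translation A y).map S.f)).trans (by rw [ht', zero_comp])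
    rw [← Category.assoc, ← kernel.lift_ι _ _ h₂, Category.assoc, hg, comp_zero]

section

variable [SymmetricCategory M]

theorem whiskerLeft_unitTo (x z m : M) : z ◁ (unitTo x).app m =
    (unitTo x).app (z ⊗ m) ≫ (α_ x z m).inv ≫ (β_ x z).hom ▷ m ≫ (α_ z x m).hom := by
  have h : fromUnit x ▷ z ≫ (β_ x z).hom = (β_ (𝟙_ M) z).hom ≫ z ◁ fromUnit x :=
    BraidedCategory.braiding_naturality_left _ _
  have h' : (fromUnit x ▷ z) ▷ m ≫ (β_ x z).hom ▷ m =
      (β_ (𝟙_ M) z).hom ▷ m ≫ (z ◁ fromUnit x) ▷ m := by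
    rw [← comp_whiskerRight, ← comp_whiskerRight, h]
  change z ◁ ((λ_ m).inv ≫ fromUnit x ▷ m) = ((λ_ (z ⊗ m)).inv ≫ fromUnit x ▷ (z ⊗ m)) ≫ _
  rw [Category.assoc, associator_inv_naturality_left_assoc, reassoc_of% h',
    braiding_tensorUnit_left]
  simp

theorem stablyNull_translation [IsGrothendieckAbelian.{w} A] (z : M) {F : M ⥤ A}
    (hF : stablyNull M A F) : stablyNull M A ((translation A z).obj F) :=
  (stablyNull_iff _).2 fun W h hh => by
    obtain ⟨_, _⟩ := exactColimits_kappaIndex.{w} F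
    refine eq_zero_of_locally.{w} hF (translation A z) (𝟙 _) h fun x T t ht => ?_
    have ht' : t ≫ (iota A x).app ((translation A z).obj F) = 0 := by
      ext m
      have hm : t.app m ≫ F.map ((unitTo x).app (z ⊗ m)) = 0 := by
        have := NatTrans.congr_app ht m
        rw [Category.id_comp] at this
        exact this
      change t.app m ≫ F.map (z ◁ (unitTo x).app m) = 0
      rw [whiskerLeft_unitTo, F.map_comp, ← Category.assoc, hm, zero_comp]
    rw [← kernel.lift_ι _ _ ht', Category.assoc, hh, comp_zero]

end

variable (M A)

/-- The stable category `St(M, A)`: the quotient of the category of functors from `M` to `A` by the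
thick subcategory of stably null functors, that is, the localization at the morphisms whose kernel
and cokernel are stably null. -/
abbrev St [IsGrothendieckAbelian.{w} A] := (stablyNull M A).isoModSerre.Localization

namespace St

variable [IsGrothendieckAbelian.{w} A]

/-- The canonical functor `π` to the stable category. -/
abbrev proj : (M ⥤ A) ⥤ St.{w} M A := (stablyNull M A).isoModSerre.Q

noncomputable instance : Abelian (St.{w} M A) :=
  ObjectProperty.SerreClassLocalization.abelian (proj.{w} M A) (stablyNull M A)

instance : PreservesFiniteLimits (proj.{w} M A) :=
  ObjectProperty.SerreClassLocalization.preservesFiniteLimits _ (stablyNull M A)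

instance : PreservesFiniteColimits (proj.{w} M A) :=
  ObjectProperty.SerreClassLocalization.preservesFiniteColimits _ (stablyNull M A)

variable {M A}

theorem isIso_proj_map {F G : M ⥤ A} (f : F ⟶ G) :
    IsIso ((proj.{w} M A).map f) ↔ (stablyNull M A).isoModSerre f :=
  ObjectProperty.SerreClassLocalization.isIso_map_iff _ _ f

variable [SymmetricCategory M]

theorem isIso_proj_translation (x : M) {F G : M ⥤ A} (f : F ⟶ G)
    (hf : (stablyNull M A).isoModSerre f) :
    IsIso ((proj.{w} M A).map ((translation A x).map f)) := by
  rw [isIso_proj_map]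
  have : PreservesFiniteLimits (translation A x) := inferInstance
  have : PreservesFiniteColimits (translation A x) := inferInstance
  exact ⟨(stablyNull M A).prop_of_iso (PreservesKernel.iso (translation A x) f)
      (stablyNull_translation.{w} x hf.1),
    (stablyNull M A).prop_of_iso (PreservesCokernel.iso (translation A x) f)
      (stablyNull_translation.{w} x hf.2)⟩

theorem isIso_proj_difference (x : M) {F G : M ⥤ A} (f : F ⟶ G)
    (hf : (stablyNull M A).isoModSerre f) :
    IsIso ((proj.{w} M A).map ((difference A x).map f)) := by
  have := isIso_proj_translation.{w} x f hf
  have := (isIso_proj_map.{w} f).2 hf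
  let P := proj.{w} M A
  let cF := isColimitOfHasCokernelOfPreservesColimit P ((iota A x).app F)
  let cG := isColimitOfHasCokernelOfPreservesColimit P ((iota A x).app G)
  have e : P.map (cokernel.π ((iota A x).app F)) ≫ P.map ((_root_.difference A x).map f) =
      P.map ((translation A x).map f) ≫ P.map (cokernel.π ((iota A x).app G)) :=
    (P.map_comp _ _).symm.trans
      ((congrArg P.map (cokernel.π_desc _ _ _)).trans (P.map_comp _ _))
  have n : P.map f ≫ P.map ((iota A x).app G) =
      P.map ((iota A x).app F) ≫ P.map ((translation A x).map f) :=
    (P.map_comp _ _).symm.trans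
      ((congrArg P.map ((iota A x).naturality f)).trans (P.map_comp _ _))
  have n' : P.map ((iota A x).app G) ≫ inv (P.map ((translation A x).map f)) =
      inv (P.map f) ≫ P.map ((iota A x).app F) := by
    rw [IsIso.comp_inv_eq, Category.assoc, ← n, IsIso.inv_hom_id_assoc]
  obtain ⟨k, hk⟩ : ∃ k, P.map (cokernel.π ((iota A x).app G)) ≫ k =
      inv (P.map ((translation A x).map f)) ≫ P.map (cokernel.π ((iota A x).app F)) := by
    refine ⟨cG.desc (CokernelCofork.ofπ _ ?_), cG.fac _ WalkingParallelPair.one⟩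
    have z : P.map ((iota A x).app F) ≫ P.map (cokernel.π ((iota A x).app F)) = 0 :=
      (P.map_comp _ _).symm.trans ((congrArg P.map (cokernel.condition _)).trans (P.map_zero _ _))
    exact (Category.assoc _ _ _).symm.trans
      ((congrArg (· ≫ P.map (cokernel.π ((iota A x).app F))) n').trans
        ((Category.assoc _ _ _).trans ((congrArg (_ ≫ ·) z).trans comp_zero)))
  refine ⟨k, ?_, ?_⟩
  · refine Cofork.IsColimit.hom_ext cF ?_
    change P.map (cokernel.π ((iota A x).app F)) ≫ P.map ((_root_.difference A x).map f) ≫ k =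
      P.map (cokernel.π ((iota A x).app F)) ≫ 𝟙 _
    refine (Category.assoc _ _ _).symm.trans ((congrArg (· ≫ k) e).trans ?_)
    refine (Category.assoc _ _ _).trans ((congrArg (_ ≫ ·) hk).trans ?_)
    exact (IsIso.hom_inv_id_assoc _ _).trans (Category.comp_id _).symm
  · refine Cofork.IsColimit.hom_ext cG ?_
    change P.map (cokernel.π ((iota A x).app G)) ≫ k ≫ P.map ((_root_.difference A x).map f) =
      P.map (cokernel.π ((iota A x).app G)) ≫ 𝟙 _
    refine (Category.assoc _ _ _).symm.trans
      ((congrArg (· ≫ P.map ((_root_.difference A x).map f)) hk).trans ?_)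
    refine (Category.assoc _ _ _).trans ((congrArg (_ ≫ ·) e).trans ?_)
    exact (IsIso.inv_hom_id_assoc _ _).trans (Category.comp_id _).symm

/-- The endofunctor `δ_x` of the stable category induced by the difference functor `δ_x`. -/
noncomputable def difference (x : M) : St.{w} M A ⥤ St.{w} M A :=
  Localization.lift (_root_.difference A x ⋙ proj.{w} M A)
    (fun _ _ f hf => isIso_proj_difference.{w} x f hf) (proj.{w} M A)

variable (M A) in
/-- `polynomial d` consists of the polynomial objects of degree at most `d - 1`: the zero objects for
`d = 0`, and for `d + 1` the objects `X` such that each `δ_x(X)` is in `polynomial d`. -/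
def polynomial : ℕ → ObjectProperty (St.{w} M A)
  | 0 => fun X => IsZero X
  | d + 1 => fun X => ∀ x : M, polynomial d ((difference.{w} x).obj X)

end St

/-- The full subcategory `Pol_n(M, A)` of the polynomial objects of degree at most `n` of the stable
category, where `n` is an integer: the zero objects if `n < 0`, and, if `n ≥ 0`, the objects `X` such
that `δ_x(X)` is in `Pol_{n-1}(M, A)` for all `x : M`. -/
def Pol [SymmetricCategory M] [IsGrothendieckAbelian.{w} A] (n : ℤ) :
    ObjectProperty (St.{w} M A) :=
  St.polynomial.{w} M A (n + 1).toNat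

theorem pol_of_neg [SymmetricCategory M] [IsGrothendieckAbelian.{w} A] {n : ℤ} (hn : n < 0)
    (X : St.{w} M A) : Pol.{w} M A n X ↔ IsZero X := by
  have : (n + 1).toNat = 0 := by lia
  rw [Pol, this]
  exact Iff.rfl

theorem pol_of_nonneg [SymmetricCategory M] [IsGrothendieckAbelian.{w} A] {n : ℤ} (hn : 0 ≤ n)
    (X : St.{w} M A) :
    Pol.{w} M A n X ↔ ∀ x : M, Pol.{w} M A (n - 1) ((St.difference.{w} x).obj X) := by
  have : (n + 1).toNat = (n - 1 + 1).toNat + 1 := by lia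
  rw [Pol, this]
  exact Iff.rfl

/-- The morphisms of `Pol_n(M, A)` whose kernel and cokernel are in `Pol_{n-1}(M, A)`. The kernel and
the cokernel are taken in the stable category, of which `Pol_n(M, A)` is a thick subcategory. -/
def isoModPol [SymmetricCategory M] [IsGrothendieckAbelian.{w} A] (n : ℤ) :
    MorphismProperty (Pol.{w} M A n).FullSubcategory :=
  fun _ _ f => Pol.{w} M A (n - 1) (kernel ((Pol.{w} M A n).ι.map f)) ∧
    Pol.{w} M A (n - 1) (cokernel ((Pol.{w} M A n).ι.map f))

/-- The quotient category `Pol_n(M, A) / Pol_{n-1}(M, A)`: the localization of `Pol_n(M, A)` at the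
morphisms whose kernel and cokernel are in the thick subcategory `Pol_{n-1}(M, A)`. -/
abbrev PolQuotient [SymmetricCategory M] [IsGrothendieckAbelian.{w} A] (n : ℤ) :=
  (isoModPol.{w} M A n).Localization

end Stable

/-! The idea is to recover the top-degree part of a polynomial functor as a representation of `Σ_n`,
by an exact functor whose kernel consists exactly of the functors of lower degree.

For `F` on `Θ`, let `L(F)` be the colimit of the values of `F` along the standard inclusions. Since
filtered colimits are exact, `L` is exact, and `L(F) = 0` if and only if every part of `F(a)` dies
after points are added, that is, if and only if `F` is stably null (`isZero_stableValue_iff`). The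
`n`-th cross-effect `cr_n(F)(b)`, the quotient of `F(n ⊔ b)` by the contributions of the proper
subsets of `n`, is the `n`-fold iterate of `δ_1` (`crossEffectIso`), and it carries an action of
`Σ_n`. Although `δ_x` is not left exact, it becomes exact modulo stably null functors, because the
kernel of `i_x` is stably null (`IsStablyExact.comp_difference`). Moreover `δ_1` alone controls the
degree (`St.polynomial_proj_iff`). Hence `Φ(F) = L(cr_n(F))` is an exact functor to representations
of `Σ_n` which vanishes exactly in degree at most `n - 1` (`isZero_stableCrossEffect_iff`).

In the other direction, a representation `N` gives the functor `Ψ(N)` whose value at `a` is a sum of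
copies of `N` indexed by the `n`-element subsets of `a`. It is defined on all of `Θ̃`: a partial
injection kills the subsets on which it is not fully defined. It has degree at most `n`, and
`Φ(Ψ(N)) ≅ N` (`stableCrossEffectInd`). If `F` has degree at most `n`, the differences of `cr_n(F)`
are stably null, so its maps to the stable value are compatible with all injections
(`map_toStable`). This yields a natural map `F ⟶ Ψ(Φ(F))` (`coeffs`) which `Φ` inverts. A formal
argument (`nonempty_subquotient_equivalence`) then gives the equivalence with representations for
`Θ`.

For `Θ̃`, restriction to `Θ` is exact, commutes with differences, and preserves and reflects stable
nullity and degree (`polynomial_restrict_iff`). The same `Φ` and `Ψ` work once the comparison map is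
seen to be natural for the retractions of `Θ̃` as well (`coeffsTilde`). -/

/-! ### Localizing a full subcategory of a Serre quotient by means of an exact functor -/

section SubquotientEquivalence

universe v₁ v₂ v₃ u₁ u₂ u₃

variable {C : Type u₁} [Category.{v₁} C] {D : Type u₂} [Category.{v₂} D]
  {B : Type u₃} [Category.{v₃} B]

/-- A functor inverting `W` which has a right inverse up to isomorphism, and whose composite with
this right inverse is related to the identity by morphisms in `W`, induces an equivalence from the
localization at `W`. -/
theorem nonempty_localization_equivalence (W : MorphismProperty C) (Φ : C ⥤ B) (Ψ : B ⥤ C)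
    (hΦ : W.IsInvertedBy Φ) (ε : Ψ ⋙ Φ ≅ 𝟭 B) (θ : 𝟭 C ⟶ Φ ⋙ Ψ) (hθ : ∀ X, W (θ.app X)) :
    Nonempty (W.Localization ≌ B) := by
  have : ∀ X, IsIso (W.Q.map (θ.app X)) := fun X => Localization.inverts W.Q W _ (hθ X)
  let α : W.Q ≅ (Φ ⋙ Ψ) ⋙ W.Q := NatIso.ofComponents (fun X => asIso (W.Q.map (θ.app X)))
    (fun {X Y} f => ((W.Q.map_comp _ _).symm.trans
      (congrArg W.Q.map (θ.naturality f))).trans (W.Q.map_comp _ _))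
  let Φ' := Localization.lift Φ hΦ W.Q
  let φ : W.Q ⋙ Φ' ≅ Φ := Localization.fac Φ hΦ W.Q
  let β : Φ' ⋙ Ψ ⋙ W.Q ≅ 𝟭 _ := Localization.liftNatIso W.Q W
    (W.Q ⋙ Φ' ⋙ Ψ ⋙ W.Q) W.Q _ _
    ((Functor.associator _ _ _).symm ≪≫ Functor.isoWhiskerRight φ (Ψ ⋙ W.Q) ≪≫
      (Functor.associator _ _ _).symm ≪≫ α.symm)
  exact ⟨CategoryTheory.Equivalence.mk Φ' (Ψ ⋙ W.Q) β.symm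
    (Functor.associator _ _ _ ≪≫ Functor.isoWhiskerLeft Ψ φ ≪≫ ε)⟩

variable [Abelian C] [Abelian D] [Abelian B]

/-- An exact functor inverts a morphism if and only if it kills its kernel and its cokernel. -/
theorem isIso_map_iff_isZero (Φ : C ⥤ B) [PreservesFiniteLimits Φ] [PreservesFiniteColimits Φ]
    {X Y : C} (f : X ⟶ Y) :
    IsIso (Φ.map f) ↔ IsZero (Φ.obj (kernel f)) ∧ IsZero (Φ.obj (cokernel f)) := by
  constructor
  · intro h
    exact ⟨(isZero_kernel_of_mono (Φ.map f)).of_iso (PreservesKernel.iso Φ f),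
      (isZero_cokernel_of_epi (Φ.map f)).of_iso (PreservesCokernel.iso Φ f)⟩
  · rintro ⟨h₁, h₂⟩
    have : Mono (Φ.map f) := Preadditive.mono_of_isZero_kernel _
      (h₁.of_iso (PreservesKernel.iso Φ f).symm)
    have : Epi (Φ.map f) := Preadditive.epi_of_isZero_cokernel _
      (h₂.of_iso (PreservesCokernel.iso Φ f).symm)
    exact isIso_of_mono_of_epi _

/-- The morphisms of a full subcategory `R` of an abelian category whose kernel and cokernel
satisfy `R'`. -/
def isoModIn (R R' : ObjectProperty D) : MorphismProperty R.FullSubcategory :=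
  fun _ _ f => R' (kernel (R.ι.map f)) ∧ R' (cokernel (R.ι.map f))

/-- `Φ` kills `P`, hence descends to an exact functor `Φ'` on `D` with kernel `R'`, and the
morphisms to be inverted in `R` are exactly those inverted by `Φ'`. The comparison `θ` is available
only on objects of `C` lying over `R`; the work is to carry it, with its naturality, from `C` to
`R`. -/
theorem nonempty_subquotient_equivalence (P : ObjectProperty C) [P.IsSerreClass] (L : C ⥤ D)
    [L.IsLocalization P.isoModSerre] [L.Additive] {R R' : ObjectProperty D}
    [R'.IsClosedUnderIsomorphisms] [R.IsClosedUnderIsomorphisms]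
    (hR' : ∀ X, IsZero X → R' X) (Φ : C ⥤ B) [PreservesFiniteLimits Φ]
    [PreservesFiniteColimits Φ] (hΦ : ∀ F, IsZero (Φ.obj F) ↔ R' (L.obj F)) (Ψ : B ⥤ C)
    (hΨ : ∀ N, R (L.obj (Ψ.obj N))) (ε : Ψ ⋙ Φ ≅ 𝟭 B)
    (θ : ∀ F, R (L.obj F) → (F ⟶ Ψ.obj (Φ.obj F)))
    (hθ : ∀ {F G} (f : F ⟶ G) (hF : R (L.obj F)) (hG : R (L.obj G)),
      f ≫ θ G hG = θ F hF ≫ Ψ.map (Φ.map f))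
    (hε : ∀ F (hF : R (L.obj F)), Φ.map (θ F hF) ≫ ε.hom.app (Φ.obj F) = 𝟙 _) :
    Nonempty ((isoModIn R R').Localization ≌ B) := by
  have hinv : P.isoModSerre.IsInvertedBy Φ :=
    (P.isoModSerre_isInvertedBy_iff Φ).2 fun F hF => (hΦ F).2
      (hR' _ ((ObjectProperty.SerreClassLocalization.isZero_obj_iff L P F).2 hF))
  let Φ' : D ⥤ B := Localization.lift Φ hinv L
  let φ : L ⋙ Φ' ≅ Φ := Localization.fac Φ hinv L
  have : PreservesFiniteLimits Φ' :=
    (ObjectProperty.SerreClassLocalization.preservesFiniteLimits_comp_iff L P Φ').1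
      (preservesFiniteLimits_of_natIso φ.symm)
  have : PreservesFiniteColimits Φ' :=
    (ObjectProperty.SerreClassLocalization.preservesFiniteColimits_comp_iff L P Φ').1
      (preservesFiniteColimits_of_natIso φ.symm)
  have : L.EssSurj := Localization.essSurj L P.isoModSerre
  have hΦ' : ∀ X, IsZero (Φ'.obj X) ↔ R' X := fun X => by
    let e := L.objObjPreimageIso X
    rw [← (Φ'.mapIso e).isZero_iff, ← R'.prop_iff_of_iso e, ← hΦ]
    exact (φ.app _).isZero_iff
  have hiso : ∀ {X Y} (f : X ⟶ Y), IsIso (Φ'.map f) ↔ R' (kernel f) ∧ R' (cokernel f) :=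
    fun f => by rw [isIso_map_iff_isZero, hΦ', hΦ']
  let T : D ⥤ D := Φ' ⋙ Ψ ⋙ L
  let t : ∀ F, R (L.obj F) → (L.obj F ⟶ T.obj (L.obj F)) :=
    fun F hF => L.map (θ F hF) ≫ L.map (Ψ.map (φ.inv.app F))
  have ht : ∀ {F G} (f : F ⟶ G) (hF : R (L.obj F)) (hG : R (L.obj G)),
      L.map f ≫ t G hG = t F hF ≫ T.map (L.map f) := fun {F G} f hF hG => by
    have h : Φ.map f ≫ φ.inv.app G = φ.inv.app F ≫ Φ'.map (L.map f) := φ.inv.naturality f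
    simp only [t, T, Functor.comp_map, Category.assoc, ← L.map_comp, ← Ψ.map_comp, ← h]
    rw [Ψ.map_comp, reassoc_of% hθ f hF hG]
  -- A morphism of `D` need not come from `C`, but it is a right fraction. The middle object of the
  -- fraction still lies over `R`, because its denominator becomes an isomorphism in `D`.
  have ht' : ∀ {F G} (g : L.obj F ⟶ L.obj G) (hF : R (L.obj F)) (hG : R (L.obj G)),
      g ≫ t G hG = t F hF ≫ T.map g := fun {F G} g hF hG => by
    obtain ⟨ψ, rfl⟩ := Localization.exists_rightFraction L P.isoModSerre g
    have : IsIso (L.map ψ.s) := Localization.inverts L P.isoModSerre _ ψ.hs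
    have hX : R (L.obj ψ.X') := R.prop_of_iso (asIso (L.map ψ.s)).symm hF
    rw [← cancel_epi (L.map ψ.s), reassoc_of% (ht ψ.s hX hF), ← T.map_comp,
      MorphismProperty.RightFraction.map_s_comp_map, ← ht ψ.f hX hG,
      MorphismProperty.RightFraction.map_s_comp_map_assoc]
  let e := fun X : D => L.objObjPreimageIso X
  have he : ∀ X, R X → R (L.obj (L.objPreimage X)) := fun X hX => R.prop_of_iso (e X).symm hX
  -- The comparison is transported to arbitrary objects of `R` along chosen preimages under `L`;
  -- naturality for all morphisms between images makes the result natural despite the choices.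
  let s : ∀ X, R X → (X ⟶ T.obj X) := fun X hX => (e X).inv ≫ t _ (he X hX) ≫ T.map (e X).hom
  have hs : ∀ {X Y} (f : X ⟶ Y) (hX : R X) (hY : R Y), f ≫ s Y hY = s X hX ≫ T.map f :=
    fun {X Y} f hX hY => by
      have h := ht' ((e X).hom ≫ f ≫ (e Y).inv) (he X hX) (he Y hY)
      simp only [s, Category.assoc]
      rw [← cancel_epi (e X).hom, Iso.hom_inv_id_assoc]
      simp only [Category.assoc] at h
      rw [reassoc_of% h, ← T.map_comp, ← T.map_comp]
      simp
  have hsi : ∀ X (hX : R X), IsIso (Φ'.map (s X hX)) := fun X hX => by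
    -- By `hε`, the map `Φ(θ)` is the inverse of a component of the isomorphism `ε`.
    have h₁ : IsIso (Φ.map (θ _ (he X hX))) := by
      rw [(Iso.eq_comp_inv (ε.app _)).2 (hε _ (he X hX))]
      infer_instance
    have h₂ : IsIso (Φ'.map (L.map (θ _ (he X hX)))) := (NatIso.isIso_map_iff φ _).2 h₁
    simp only [s, t, Functor.map_comp]
    infer_instance
  let Φ₀ : R.FullSubcategory ⥤ B := R.ι ⋙ Φ'
  let Ψ₀ : B ⥤ R.FullSubcategory := R.lift (Ψ ⋙ L) hΨ
  refine nonempty_localization_equivalence (isoModIn R R') Φ₀ Ψ₀ (fun X Y f hf => (hiso _).2 hf)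
    (Functor.isoWhiskerLeft Ψ φ ≪≫ ε)
    { app := fun X => ObjectProperty.homMk (s X.obj X.property)
      naturality := fun X Y f => ObjectProperty.hom_ext _ (hs _ X.property Y.property) }
    (fun X => (hiso (s X.obj X.property)).1 (hsi X.obj X.property))

end SubquotientEquivalence


/-! ### Exactness of a cokernel of exact functors -/

section CokernelFunctor

universe v₁ v₂ u₁ u₂

variable {C : Type u₁} [Category.{v₁} C] {D : Type u₂} [Category.{v₂} D] [Abelian C] [Abelian D]

/-- The pointwise cokernel of a pointwise monomorphic natural transformation between exact functors
is exact. -/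
theorem exact_of_shortExact_natTrans {K T E : C ⥤ D} [PreservesFiniteLimits K]
    [PreservesFiniteColimits K] [PreservesFiniteLimits T] [PreservesFiniteColimits T]
    (α : K ⟶ T) (β : T ⟶ E) (w : ∀ X, α.app X ≫ β.app X = 0)
    (h : ∀ X, (ShortComplex.mk _ _ (w X)).ShortExact) :
    PreservesFiniteLimits E ∧ PreservesFiniteColimits E := by
  have hβ : ∀ X, Epi (β.app X) := fun X => (h X).epi_g
  have hα : ∀ X, Mono (α.app X) := fun X => (h X).mono_f
  have : K.Additive := K.additive_of_preserves_binary_products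
  have : T.Additive := T.additive_of_preserves_binary_products
  have : E.Additive := ⟨fun {X Y f g} => by
    rw [← cancel_epi (β.app X), Preadditive.comp_add, ← β.naturality, ← β.naturality,
      ← β.naturality, T.map_add, Preadditive.add_comp]⟩
  refine (E.exact_tfae.out 0 3).1 fun S hS => ?_
  have := hS.mono_f
  have := hS.epi_g
  obtain ⟨Z, hz⟩ := HasZeroObject.zero (C := D)
  have hK : (S.map K).ShortExact := hS.map_of_exact K
  have hT : (S.map T).ShortExact := hS.map_of_exact T
  -- In the snake diagram with columns `K`, `T`, `E`, the row of kernels is zero because `α` is a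
  -- monomorphism.
  let I : ShortComplex.SnakeInput D :=
    { L₀ := ShortComplex.mk (0 : Z ⟶ Z) (0 : Z ⟶ Z) comp_zero
      L₁ := S.map K
      L₂ := S.map T
      L₃ := S.map E
      v₀₁ :=
        { τ₁ := 0, τ₂ := 0, τ₃ := 0, comm₁₂ := hz.eq_of_src _ _, comm₂₃ := hz.eq_of_src _ _ }
      v₁₂ := S.mapNatTrans α
      v₂₃ := S.mapNatTrans β
      w₀₂ := by ext <;> exact hz.eq_of_src _ _
      w₁₃ := by ext <;> exact w _
      h₀ := by
        apply ShortComplex.isLimitOfIsLimitπ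
        all_goals
          refine (KernelFork.isLimitMapConeEquiv _ _).symm ?_
          exact (KernelFork.IsLimit.ofMonoOfIsZero _ (hα _) hz)
      h₃ := by
        apply ShortComplex.isColimitOfIsColimitπ
        all_goals
          exact (CokernelCofork.isColimitMapCoconeEquiv _ _).symm (h _).gIsCokernel
      L₁_exact := hK.exact
      epi_L₁_g := hK.epi_g
      L₂_exact := hT.exact
      mono_L₂_f := hT.mono_f }
  -- The connecting morphism starts from a zero object.
  have h₁ : Mono I.L₃.f := I.L₂'_exact.mono_g (hz.eq_of_src _ _)
  have h₂ : Epi I.L₃.g := @ShortComplex.SnakeInput.epi_L₃_g _ _ _ I hT.epi_g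
  exact { exact := I.L₃_exact, mono_f := h₁, epi_g := h₂ }

end CokernelFunctor

/-! ### Difference functors modulo stably null functors, and the role of a generator -/

section DifferenceFunctors

variable {M : Type} [SmallCategory M] [MonoidalCategory M] [UnitInitial M]
variable {A : Type u} [Category.{v} A] [Abelian A]

omit [UnitInitial M] in
theorem translation_map_mono (x : M) {F G : M ⥤ A} (f : F ⟶ G) [Mono f] :
    Mono ((translation A x).map f) := inferInstance

/-- On `κ_x(F)` the map `i_x` is itself zero, by naturality and since `τ_x` preserves monomorphisms;
so one index already exhausts the sum of kernels. -/
theorem stablyNull_kernel_iota (x : M) (F : M ⥤ A) :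
    stablyNull M A (kernel ((iota A x).app F)) :=
  (stablyNull_iff _).2 fun W h hh => by
    have e : (iota A x).app (kernel ((iota A x).app F)) = 0 := by
      have := translation_map_mono x (kernel.ι ((iota A x).app F))
      rw [← cancel_mono ((translation A x).map (kernel.ι ((iota A x).app F))), zero_comp]
      exact ((iota A x).naturality _).symm.trans (kernel.condition _)
    have : IsIso (kernel.ι ((iota A x).app (kernel ((iota A x).app F)))) := by
      rw [e]; infer_instance
    exact (cancel_epi _).1 ((hh x).trans comp_zero.symm)

theorem stablyNull_of_isZero {F : M ⥤ A} (hF : IsZero F) : stablyNull M A F :=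
  (stablyNull_iff _).2 fun _ _ _ => hF.eq_of_src _ _

/-- A functor all of whose maps `i_x` are monomorphisms is stably null only if it is zero. -/
theorem isZero_of_stablyNull {F : M ⥤ A} (h : ∀ x, Mono ((iota A x).app F))
    (hF : stablyNull M A F) : IsZero F :=
  (IsZero.iff_id_eq_zero F).2 ((stablyNull_iff _).1 hF (𝟙 F) fun x => by
    have := h x
    rw [kernel.ι_of_mono, zero_comp])

variable [SymmetricCategory M] [IsGrothendieckAbelian.{w} A]

theorem stablyNull_difference (x : M) {F : M ⥤ A} (hF : stablyNull M A F) :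
    stablyNull M A ((difference A x).obj F) := by
  let p : (translation A x).obj F ⟶ (difference A x).obj F := cokernel.π ((iota A x).app F)
  have : Epi p := inferInstanceAs (Epi (cokernel.π ((iota A x).app F)))
  exact (stablyNull M A).prop_of_epi p (stablyNull_translation.{w} x hF)

universe v₂ u₂

variable {D : Type u₂} [Category.{v₂} D] [Abelian D]

/-- The natural transformation from the translation to the difference functor. -/
noncomputable def translationToDifference (x : M) : translation A x ⟶ difference A x where
  app F := cokernel.π ((iota A x).app F)
  naturality _ _ _ := (cokernel.π_desc _ _ _).symm

/-- An exact functor which kills the stably null functors. -/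
structure IsStablyExact (H : (M ⥤ A) ⥤ D) : Prop where
  preservesFiniteLimits : PreservesFiniteLimits H
  preservesFiniteColimits : PreservesFiniteColimits H
  isZero_obj : ∀ F, stablyNull M A F → IsZero (H.obj F)

namespace IsStablyExact

variable {H : (M ⥤ A) ⥤ D} (hH : IsStablyExact H)

omit [SymmetricCategory M] [IsGrothendieckAbelian.{w} A] in
include hH in
theorem shortExact_map_iota (x : M) (F : M ⥤ A) :
    ∃ w : H.map ((iota A x).app F) ≫ H.map ((translationToDifference x).app F) = 0,
      (ShortComplex.mk _ _ w).ShortExact := by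
  have := hH.preservesFiniteLimits
  have := hH.preservesFiniteColimits
  have : Mono (H.map ((iota A x).app F)) := Preadditive.mono_of_isZero_kernel _
    ((hH.isZero_obj _ (stablyNull_kernel_iota x F)).of_iso (PreservesKernel.iso H _).symm)
  let S := ShortComplex.mk _ _ (cokernel.condition ((iota A x).app F))
  have hS : S.Exact := S.exact_of_g_is_cokernel (cokernelIsCokernel _)
  exact ⟨(S.map H).zero, { exact := hS.map H, mono_f := this,
                           epi_g := inferInstanceAs (Epi (H.map (cokernel.π ((iota A x).app F)))) }⟩

-- The defect of left exactness of `δ_x` comes from the kernels of the maps `i_x`. These are stably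
-- null, so after `H` the sequence `F ⟶ τ_x F ⟶ δ_x F` becomes short exact, and a quotient of exact
-- functors by a subfunctor is exact.
include hH in
theorem comp_difference (x : M) : IsStablyExact (difference A x ⋙ H) := by
  have := hH.preservesFiniteLimits
  have := hH.preservesFiniteColimits
  have h := exact_of_shortExact_natTrans (K := 𝟭 _ ⋙ H) (T := translation A x ⋙ H)
    (E := difference A x ⋙ H) (Functor.whiskerRight (iota A x) H)
    (Functor.whiskerRight (translationToDifference x) H)
    (fun F => (hH.shortExact_map_iota x F).choose)
    (fun F => (hH.shortExact_map_iota x F).choose_spec)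
  exact ⟨h.1, h.2, fun F hF => hH.isZero_obj _ (stablyNull_difference.{w} x hF)⟩

-- Vanishing of a difference becomes an epimorphism condition, which can be composed when points are
-- added one at a time.
omit [SymmetricCategory M] [IsGrothendieckAbelian.{w} A] in
include hH in
theorem isZero_difference_iff (x : M) (F : M ⥤ A) :
    IsZero (H.obj ((difference A x).obj F)) ↔ Epi (H.map ((iota A x).app F)) := by
  obtain ⟨w, hw⟩ := hH.shortExact_map_iota x F
  have := hw.epi_g
  rw [hw.exact.epi_f_iff]
  exact ⟨fun h => h.eq_of_tgt _ _, fun h => by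
    rw [IsZero.iff_id_eq_zero, ← cancel_epi (H.map ((translationToDifference x).app F))]
    simpa using h⟩

end IsStablyExact

omit [Abelian A] [IsGrothendieckAbelian.{w} A] [UnitInitial M] in
/-- Translations commute. -/
def translationComm (x z : M) (F : M ⥤ A) :
    (translation A z).obj ((translation A x).obj F) ≅
      (translation A x).obj ((translation A z).obj F) :=
  NatIso.ofComponents (fun m => F.mapIso ((α_ x z m).symm ≪≫
    MonoidalCategory.whiskerRightIso (β_ x z) m ≪≫ α_ z x m)) (fun f => by
    change F.map _ ≫ F.map _ = F.map _ ≫ F.map _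
    rw [← F.map_comp, ← F.map_comp]
    congr 1
    change x ◁ z ◁ f ≫ (α_ x z _).inv ≫ (β_ x z).hom ▷ _ ≫ (α_ z x _).hom =
      ((α_ x z _).inv ≫ (β_ x z).hom ▷ _ ≫ (α_ z x _).hom) ≫ z ◁ x ◁ f
    simp only [Category.assoc]
    rw [associator_inv_naturality_right_assoc, whisker_exchange_assoc,
      associator_naturality_right])

omit [Abelian A] [IsGrothendieckAbelian.{w} A] in
theorem iota_translation (x z : M) (F : M ⥤ A) :
    (iota A x).app ((translation A z).obj F) ≫ (translationComm z x F).hom =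
      (translation A z).map ((iota A x).app F) := by
  ext m
  change F.map (z ◁ (unitTo x).app m) ≫ F.map ((α_ z x m).inv ≫ (β_ z x).hom ▷ m ≫
    (α_ x z m).hom) = F.map ((unitTo x).app (z ⊗ m))
  rw [← F.map_comp, whiskerLeft_unitTo]
  congr 1
  simp only [Category.assoc, Iso.hom_inv_id_assoc]
  rw [← comp_whiskerRight_assoc, SymmetricCategory.symmetry]
  simp

/-- Difference functors commute with translations. -/
noncomputable def differenceTranslation (x z : M) (F : M ⥤ A) :
    (difference A x).obj ((translation A z).obj F) ≅
      (translation A z).obj ((difference A x).obj F) :=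
  cokernel.mapIso ((iota A x).app ((translation A z).obj F))
    ((translation A z).map ((iota A x).app F)) (Iso.refl _) (translationComm z x F)
    ((iota_translation x z F).trans (Category.id_comp _).symm) ≪≫
    (PreservesCokernel.iso (translation A z) ((iota A x).app F)).symm

variable (A) in
/-- The iterates of the difference functor `δ_g`. -/
noncomputable def iterDifference (g : M) : ℕ → (M ⥤ A) ⥤ (M ⥤ A)
  | 0 => 𝟭 _
  | d + 1 => difference A g ⋙ iterDifference g d

theorem isStablyExact_iterDifference {H : (M ⥤ A) ⥤ D} (hH : IsStablyExact H) (g : M) (d : ℕ) :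
    IsStablyExact (iterDifference A g d ⋙ H) := by
  induction d with
  | zero => exact hH
  | succ d ih => exact ih.comp_difference.{w} g

theorem stablyNull_iterDifference_translation (g z : M) (d : ℕ) {F : M ⥤ A}
    (hF : stablyNull M A ((iterDifference A g d).obj F)) :
    stablyNull M A ((iterDifference A g d).obj ((translation A z).obj F)) := by
  induction d generalizing F with
  | zero => exact stablyNull_translation.{w} z hF
  | succ d ih =>
    exact (stablyNull M A).prop_of_iso
      ((iterDifference A g d).mapIso (differenceTranslation g z F)).symm (ih hF)

omit [SymmetricCategory M] in
theorem isStablyExact_proj : IsStablyExact (St.proj.{w} M A) :=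
  ⟨inferInstance, inferInstance, fun F hF =>
    (ObjectProperty.SerreClassLocalization.isZero_obj_iff _ (stablyNull M A) F).2 hF⟩

omit [SymmetricCategory M] in
theorem isZero_proj_iff (F : M ⥤ A) : IsZero ((St.proj.{w} M A).obj F) ↔ stablyNull M A F :=
  ObjectProperty.SerreClassLocalization.isZero_obj_iff _ (stablyNull M A) F

omit [Abelian A] [IsGrothendieckAbelian.{w} A] [SymmetricCategory M] in
theorem iota_tensor (x g : M) (F : M ⥤ A) : ∃ e : (translation A (x ⊗ g)).obj F ≅
    (translation A g).obj ((translation A x).obj F), (iota A (x ⊗ g)).app F ≫ e.hom =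
      (iota A g).app F ≫ (translation A g).map ((iota A x).app F) := by
  refine ⟨NatIso.ofComponents (fun m => F.mapIso (α_ x g m)) fun f => ?_, ?_⟩
  · change F.map _ ≫ F.map _ = F.map _ ≫ F.map _
    rw [← F.map_comp, ← F.map_comp]
    congr 1
    exact associator_naturality_right x g f
  · ext m
    change F.map _ ≫ F.map _ = F.map _ ≫ F.map _
    rw [← F.map_comp, ← F.map_comp, unitTo_tensor]
    rfl

/-- The objects obtained from the unit by adding copies of `g` are all the objects. -/
def IsGenerator (g : M) : Prop :=
  ∀ P : M → Prop, P (𝟙_ M) → (∀ x, P x → P (x ⊗ g)) → ∀ x, P x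

/-- One generator suffices: up to the associator, `i_{x ⊗ g}` is `i_g` followed by `τ_g(i_x)`, so
being an epimorphism after `H` passes from `g` and `x` to `x ⊗ g`. The case of the unit holds
because `i_0` is an isomorphism. -/
theorem stablyNull_iterDifference_difference {g : M} (hg : IsGenerator g) (d : ℕ) {F : M ⥤ A}
    (hF : stablyNull M A ((iterDifference A g d).obj ((difference A g).obj F))) (x : M) :
    stablyNull M A ((iterDifference A g d).obj ((difference A x).obj F)) := by
  let H := iterDifference A g d ⋙ St.proj.{w} M A
  have hH : IsStablyExact H := isStablyExact_iterDifference isStablyExact_proj.{w} g d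
  have := hH.preservesFiniteLimits
  have := hH.preservesFiniteColimits
  have key : ∀ y, stablyNull M A ((iterDifference A g d).obj ((difference A y).obj F)) ↔
      Epi (H.map ((iota A y).app F)) := fun y => by
    rw [← isZero_proj_iff.{w}]
    exact hH.isZero_difference_iff y F
  revert x
  refine hg _ ?_ fun x hx => ?_
  · rw [key]
    have h : ∀ m, IsIso (((iota A (𝟙_ M)).app F).app m) := fun m => by
      have : fromUnit (𝟙_ M) = 𝟙 _ := fromUnit_unique _ _
      change IsIso (F.map ((λ_ m).inv ≫ fromUnit (𝟙_ M) ▷ m))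
      rw [this]
      infer_instance
    have : IsIso ((iota A (𝟙_ M)).app F) := NatIso.isIso_of_isIso_app _
    infer_instance
  · rw [key]
    obtain ⟨e, he⟩ := iota_tensor x g F
    have h₁ : Epi (H.map ((iota A g).app F)) := (key g).1 hF
    -- The cokernel here is `τ_g(δ_x F)`, and translation preserves the stable nullity of iterated
    -- differences.
    have h₂ : Epi (H.map ((translation A g).map ((iota A x).app F))) := by
      refine Preadditive.epi_of_isZero_cokernel _ (IsZero.of_iso ?_ (PreservesCokernel.iso H _).symm)
      refine IsZero.of_iso ?_ (H.mapIso (PreservesCokernel.iso (translation A g) _).symm)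
      exact (isZero_proj_iff.{w} _).2 (stablyNull_iterDifference_translation.{w} g g d hx)
    have h₃ : Epi (H.map ((iota A (x ⊗ g)).app F) ≫ H.map e.hom) := by
      rw [← H.map_comp, he, H.map_comp]
      infer_instance
    exact (epi_comp_iff_of_isIso _ _).1 h₃

namespace St

instance (d : ℕ) : (polynomial.{w} M A d).IsClosedUnderIsomorphisms where
  of_iso {X Y} e hX := by
    induction d generalizing X Y with
    | zero => exact (IsZero.of_iso hX e.symm : IsZero Y)
    | succ d ih => exact fun x => ih ((difference.{w} x).mapIso e) (hX x)

/-- This trades the recursion over all `x` in the stable category for a single condition on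
functors. The index is shifted: `polynomial d` means degree at most `d - 1`, whence `d` differences.
-/
theorem polynomial_proj_iff {g : M} (hg : IsGenerator g) (d : ℕ) (F : M ⥤ A) :
    polynomial.{w} M A d ((proj.{w} M A).obj F) ↔
      stablyNull M A ((iterDifference A g d).obj F) := by
  induction d generalizing F with
  | zero => exact isZero_proj_iff.{w} F
  | succ d ih =>
    have : ∀ x, polynomial.{w} M A d ((difference.{w} x).obj ((proj.{w} M A).obj F)) ↔
        stablyNull M A ((iterDifference A g d).obj ((_root_.difference A x).obj F)) := fun x => by
      rw [← ih]
      exact (polynomial.{w} M A d).prop_iff_of_iso ((Localization.fac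
        (_root_.difference A x ⋙ proj.{w} M A)
        (fun _ _ f hf => isIso_proj_difference.{w} x f hf) (proj.{w} M A)).app F)
    exact ⟨fun h => (this g).1 (h g), fun h x => (this x).2
      (stablyNull_iterDifference_difference.{w} hg d h x)⟩

theorem polynomial_of_isZero {g : M} (hg : IsGenerator g) (d : ℕ) {X : St.{w} M A}
    (hX : IsZero X) : polynomial.{w} M A d X := by
  have : (proj.{w} M A).EssSurj := Localization.essSurj _ (stablyNull M A).isoModSerre
  let e := (proj.{w} M A).objObjPreimageIso X
  refine (polynomial.{w} M A d).prop_of_iso e ((polynomial_proj_iff.{w} hg d _).2 ?_)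
  rw [← isZero_proj_iff.{w}]
  exact (isStablyExact_iterDifference isStablyExact_proj.{w} g d).isZero_obj _
    ((isZero_proj_iff.{w} _).1 (hX.of_iso e))

end St

end DifferenceFunctors


/-! ### Standard inclusions in `Θ` -/

namespace Theta

theorem fn_injective {a b : Theta} (f : a ⟶ b) : Function.Injective (fn f) :=
  (show Fin a.card ↪ Fin b.card from f).injective

theorem card_le {a b : Theta} (f : a ⟶ b) : a.card ≤ b.card := by
  simpa using Fintype.card_le_of_injective _ (fn_injective f)

@[simp] theorem fn_unitTo (x a : Theta) (i : Fin a.card) :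
    fn ((unitTo x).app a) i = inr x a i := by
  have h : fn (λ_ a).inv i = inr (𝟙_ Theta) a i := by
    apply fn_injective (λ_ a).hom
    rw [fn_leftUnitor, ← fn_comp, Iso.inv_hom_id, fn_id]
  change fn (fromUnit x ▷ a) (fn (λ_ a).inv i) = _
  rw [h, fn_whiskerRight_inr]

@[simp] theorem fn_braiding_inl (a b : Theta) (i : Fin a.card) :
    fn (β_ a b).hom (inl a b i) = inr b a i := fn_swap_inl a b i
@[simp] theorem fn_braiding_inr (a b : Theta) (i : Fin b.card) :
    fn (β_ a b).hom (inr a b i) = inl b a i := fn_swap_inr a b i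

/-- The standard inclusion. -/
def std {a b : Theta} (h : a.card ≤ b.card) : a ⟶ b := ofEmb (Fin.castLEEmb h)

@[simp] theorem fn_std {a b : Theta} (h : a.card ≤ b.card) (i : Fin a.card) :
    fn (std h) i = Fin.castLE h i := rfl

/-- The inclusion of the left summand of a disjoint union. -/
def inlHom (a b : Theta) : a ⟶ a ⊗ b := std (Nat.le_add_right a.card b.card)

@[simp] theorem fn_inlHom (a b : Theta) (i : Fin a.card) : fn (inlHom a b) i = inl a b i := rfl

/-- The inclusion of the right summand of a disjoint union. -/
noncomputable def inrHom (a b : Theta) : b ⟶ a ⊗ b := (unitTo a).app b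

@[simp] theorem fn_inrHom (a b : Theta) (i : Fin b.card) : fn (inrHom a b) i = inr a b i :=
  fn_unitTo a b i

/-- The maps `i_x` add the new points on the left, whereas the standard inclusions add them on the
right; the braiding passes between the two conventions. -/
theorem inrHom_braiding (a b : Theta) : inrHom a b ≫ (β_ a b).hom = inlHom b a :=
  hom_ext fun i => by simp

theorem inlHom_braiding (a b : Theta) : inlHom a b ≫ (β_ a b).hom = inrHom b a :=
  hom_ext fun i => by simp

theorem whiskerLeft_std (a : Theta) {b c : Theta} (h : b.card ≤ c.card) :
    a ◁ std h = std (a := a ⊗ b) (b := a ⊗ c) (Nat.add_le_add_left h a.card) :=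
  hom_ext <| sum_cases (fun i => by rw [fn_whiskerLeft_inl]; rfl)
    (fun i => by rw [fn_whiskerLeft_inr]; rfl)

theorem std_comp_whiskerLeft_std {a b c d : Theta} (h : a.card ≤ (b ⊗ c).card) (h' : c.card ≤ d.card) :
    std h ≫ b ◁ std h' = std (h.trans (Nat.add_le_add_left h' b.card)) := by
  rw [whiskerLeft_std]; rfl

/-- The sequence of the standard inclusions of the sets `Fin k`. -/
def standard : ℕ ⥤ Theta where
  obj k := ⟨k⟩
  map f := std (leOfHom f)

end Theta

/-! ### The stable value: an exact functor detecting stable nullity -/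

section StableValue

open Theta

variable {A : Type u} [Category.{v} A] [HasColimitsOfShape ℕ A]

variable (A) in
/-- The colimit of the values of a functor `Θ ⥤ A` along the standard inclusions. -/
noncomputable def stableValue : (Theta ⥤ A) ⥤ A :=
  (Functor.whiskeringLeft ℕ Theta A).obj standard ⋙ colim

/-- The canonical map from a value of a functor to its stable value. -/
noncomputable def toStable (F : Theta ⥤ A) (a : Theta) : F.obj a ⟶ (stableValue A).obj F :=
  colimit.ι (standard ⋙ F) a.card

theorem toStable_naturality {F G : Theta ⥤ A} (f : F ⟶ G) (a : Theta) :
    f.app a ≫ toStable G a = toStable F a ≫ (stableValue A).map f :=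
  (ι_colimMap (Functor.whiskerLeft standard f) a.card).symm

@[simp]
theorem map_std_toStable (F : Theta ⥤ A) {a b : Theta} (h : a.card ≤ b.card) :
    F.map (std h) ≫ toStable F b = toStable F a :=
  colimit.w (standard ⋙ F) (homOfLE h)

theorem stableValue_hom_ext {F : Theta ⥤ A} {X : A} {f g : (stableValue A).obj F ⟶ X}
    (h : ∀ a, toStable F a ≫ f = toStable F a ≫ g) : f = g :=
  colimit.hom_ext fun k => h ⟨k⟩

/-- The map out of a stable value given by a compatible family. -/
noncomputable def stableValueDesc (F : Theta ⥤ A) {X : A} (f : ∀ a, F.obj a ⟶ X)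
    (h : ∀ {a b : Theta} (h : a.card ≤ b.card), F.map (std h) ≫ f b = f a) :
    (stableValue A).obj F ⟶ X :=
  colimit.desc (standard ⋙ F)
    { pt := X
      ι := { app := fun k => f ⟨k⟩
             naturality := fun _ _ g => (h (leOfHom g)).trans (Category.comp_id _).symm } }

@[simp]
theorem toStable_desc (F : Theta ⥤ A) {X : A} (f : ∀ a, F.obj a ⟶ X)
    (h : ∀ {a b : Theta} (h : a.card ≤ b.card), F.map (std h) ≫ f b = f a) (a : Theta) :
    toStable F a ≫ stableValueDesc F f h = f a :=
  colimit.ι_desc _ _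

variable [Abelian A]

/-- A morphism to a value of `F` vanishes in the stable value if it is killed by some `i_x`. -/
theorem comp_toStable_eq_zero {F : Theta ⥤ A} {a : Theta} {T : A} (t : T ⟶ F.obj a) (x : Theta)
    (h : t ≫ ((iota A x).app F).app a = 0) : t ≫ toStable F a = 0 := by
  have h' : t ≫ F.map (inrHom x a) = 0 := h
  have e : F.map (inlHom a x) ≫ toStable F (a ⊗ x) = toStable F a := map_std_toStable F _
  rw [← e, ← inrHom_braiding, F.map_comp, Category.assoc, reassoc_of% h', zero_comp]

/-- `F` is the directed union of the `κ_x(F)`, and each of them dies after finitely many points have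
been added. -/
theorem toStable_eq_zero [IsGrothendieckAbelian.{w} A] {F : Theta ⥤ A}
    (hF : stablyNull Theta A F) (a : Theta) : toStable F a = 0 := by
  obtain ⟨_, _⟩ := exactColimits_kappaIndex.{w} F
  let K : KappaIndex F → Subobject F := fun x : Theta => kappa F x
  have hK : Monotone K := fun _ _ h => h
  obtain ⟨hc⟩ := isColimit_of_isLUB hK hF
  refine (isColimitOfPreserves ((evaluation Theta A).obj a) hc).hom_ext fun (x : Theta) => ?_
  refine (comp_toStable_eq_zero _ x ?_).trans comp_zero.symm
  exact NatTrans.congr_app (kernelSubobject_arrow_comp ((iota A x).app F)) a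

omit [Abelian A] in
theorem map_whiskerLeft_std_toStable (G : Theta ⥤ A) (b : Theta) {k l : Theta}
    (h : k.card ≤ l.card) :
    ((translation A b).obj G).map (std h) ≫ toStable G (b ⊗ l) = toStable G (b ⊗ k) := by
  change G.map (b ◁ std h) ≫ _ = _
  rw [whiskerLeft_std]
  exact map_std_toStable G _

omit [Abelian A] in
/-- The canonical map `L(τ_b G) ⟶ L(G)` of stable values. -/
noncomputable def stableValueTranslation (G : Theta ⥤ A) (b : Theta) :
    (stableValue A).obj ((translation A b).obj G) ⟶ (stableValue A).obj G :=
  stableValueDesc _ (fun k => toStable G (b ⊗ k)) (map_whiskerLeft_std_toStable G b)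

omit [Abelian A] in
theorem toStable_comp_translation (G : Theta ⥤ A) (b k : Theta) :
    toStable ((translation A b).obj G) k ≫ stableValueTranslation G b = toStable G (b ⊗ k) :=
  toStable_desc _ _ (map_whiskerLeft_std_toStable G b) _

theorem whiskerRight_inlHom {a b : Theta} (f : a ⟶ b) (c : Theta) :
    inlHom a c ≫ f ▷ c = f ≫ inlHom b c :=
  hom_ext fun i => by simp

theorem inrHom_whiskerRight {a b : Theta} (f : a ⟶ b) (c : Theta) :
    inrHom a c ≫ f ▷ c = inrHom b c :=
  hom_ext fun i => by simp

/-- If the difference functors of `G` are stably null, then the maps from the values of `G` to its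
stable value are compatible with all the morphisms of `Θ`. -/
theorem map_toStable [IsGrothendieckAbelian.{w} A] {G : Theta ⥤ A}
    (hG : ∀ x, stablyNull Theta A ((difference A x).obj G)) {a b : Theta} (f : a ⟶ b) :
    G.map f ≫ toStable G b = toStable G a := by
  let u : ∀ f : a ⟶ b, (translation A a).obj G ⟶ (translation A b).obj G :=
    fun f => Functor.whiskerRight ((tensoringLeft Theta).map f) G
  have hu : ∀ f : a ⟶ b, (iota A a).app G ≫ u f = (iota A b).app G := fun f => by
    ext m
    change G.map (inrHom a m) ≫ G.map (f ▷ m) = G.map (inrHom b m)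
    rw [← G.map_comp, inrHom_whiskerRight]
  let g : a ⟶ b := std (card_le f)
  -- Both `f` and the standard inclusion `g` carry `i_a` to `i_b`, so the difference of the maps
  -- they induce factors through `δ_a(G)`, which contributes nothing to stable values.
  let D : (difference A a).obj G ⟶ (translation A b).obj G :=
    cokernel.desc _ (u f - u g) (by rw [Preadditive.comp_sub, hu, hu, sub_self])
  have hD : (translationToDifference a).app G ≫ D = u f - u g := cokernel.π_desc _ _ _
  -- Evaluation at the empty set turns a statement about `τ_b(G)` into one about `G(b)`.
  let z : Theta := ⟨0⟩
  have h₀ : (u f - u g).app z ≫ toStable ((translation A b).obj G) z = 0 := by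
    rw [← hD, NatTrans.comp_app, Category.assoc, toStable_naturality,
      toStable_eq_zero.{w} (hG a), zero_comp, comp_zero]
  have h₁ : G.map (f ▷ z) ≫ toStable G (b ⊗ z) = G.map (g ▷ z) ≫ toStable G (b ⊗ z) := by
    have e : toStable ((translation A b).obj G) z ≫ stableValueTranslation G b =
        toStable G (b ⊗ z) := toStable_comp_translation G b z
    have h₂ := congrArg (· ≫ stableValueTranslation G b) h₀
    simp only [Category.assoc, zero_comp, e] at h₂
    rw [← sub_eq_zero, ← Preadditive.sub_comp]
    exact h₂
  have h₃ : ∀ f : a ⟶ b, G.map f ≫ toStable G b =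
      G.map (inlHom a z) ≫ G.map (f ▷ z) ≫ toStable G (b ⊗ z) := fun f => by
    rw [← map_std_toStable G (Nat.le_add_right b.card z.card : b.card ≤ (b ⊗ z).card),
      ← G.map_comp_assoc, ← G.map_comp_assoc, whiskerRight_inlHom]
    rfl
  rw [h₃ f, h₁, ← h₃ g]
  exact map_std_toStable G _

variable [HasExactColimitsOfShape ℕ A]

instance : PreservesFiniteLimits (stableValue A) :=
  have : PreservesFiniteLimits (colim (J := ℕ) (C := A)) :=
    HasExactColimitsOfShape.preservesFiniteLimits
  comp_preservesFiniteLimits _ _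

instance : PreservesFiniteColimits (stableValue A) :=
  comp_preservesFiniteColimits _ _

/-- The hypothesis makes the sequential colimit over `k` of the maps `F(a) ⟶ F(a ⊔ k)` zero. By
exactness of this colimit, `F(a)` is covered by their kernels, which are the values of the `κ_k(F)`
at `a`. -/
theorem stablyNull_of_toStable {F : Theta ⥤ A} (hF : ∀ a, toStable F a = 0) :
    stablyNull Theta A F := by
  rw [stablyNull_iff]
  intro W h hh
  ext a
  let G : ℕ ⥤ A := standard ⋙ tensorLeft a ⋙ F
  let φ : (Functor.const ℕ).obj (F.obj a) ⟶ G :=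
    { app := fun k => F.map (inlHom a ⟨k⟩)
      naturality := fun k l f => by
        change 𝟙 _ ≫ F.map _ = F.map (inlHom a ⟨k⟩) ≫ F.map (a ◁ std (leOfHom f))
        rw [Category.id_comp, ← F.map_comp]
        exact congrArg F.map (std_comp_whiskerLeft_std _ _).symm }
  let ι : ∀ b, F.obj (a ⊗ b) ⟶ colimit G := fun b => toStable ((translation A a).obj F) b
  have hι : ∀ {b c : Theta} (h : b.card ≤ c.card), F.map (a ◁ std h) ≫ ι c = ι b :=
    fun h => map_std_toStable ((translation A a).obj F) h
  -- Standard inclusions compose to standard inclusions, so `ψ` factors the map from `F(a)` to the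
  -- colimit of the `F(a ⊔ k)` through the stable value, where it vanishes.
  let ψ : (stableValue A).obj F ⟶ colimit G := stableValueDesc F
    (fun b => F.map (std (b := a ⊗ b) (Nat.le_add_left _ _)) ≫ ι b)
    (fun {b c} h => by
      rw [← hι h, ← F.map_comp_assoc, ← F.map_comp_assoc, std_comp_whiskerLeft_std]
      rfl)
  have h₀ : F.map (inlHom a ⟨0⟩) ≫ ι ⟨0⟩ = 0 := by
    have e : toStable F a ≫ ψ = F.map (std (b := a ⊗ a) (Nat.le_add_left _ _)) ≫ ι a :=
      toStable_desc F _ _ a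
    rw [hF, zero_comp] at e
    rw [← hι (Nat.zero_le a.card : (⟨0⟩ : Theta).card ≤ a.card), ← F.map_comp_assoc]
    exact (congrArg (F.map · ≫ ι a) (std_comp_whiskerLeft_std _ _)).trans e.symm
  have hφ : colim.map φ = 0 := by
    refine colimit.hom_ext fun k => ?_
    rw [comp_zero]
    refine (ι_colimMap φ k).trans ?_
    refine Eq.trans ?_ h₀
    rw [← hι (Nat.zero_le k : (⟨0⟩ : Theta).card ≤ (⟨k⟩ : Theta).card), ← F.map_comp_assoc]
    exact congrArg (F.map · ≫ ι ⟨k⟩) (std_comp_whiskerLeft_std _ _).symm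
  have : PreservesFiniteLimits (colim (J := ℕ) (C := A)) :=
    HasExactColimitsOfShape.preservesFiniteLimits
  have hepi : Epi (colim.map (kernel.ι φ)) :=
    (((ShortComplex.mk _ _ (kernel.condition φ)).exact_of_f_is_kernel
      (kernelIsKernel φ)).map colim).epi_f hφ
  -- `p` compares the colimit of the constant diagram with `F(a)`; that it is split by the inclusion
  -- of stage `0` is enough to conclude.
  let p : colimit ((Functor.const ℕ).obj (F.obj a)) ⟶ F.obj a :=
    colimit.desc _ { pt := F.obj a, ι := 𝟙 _ }
  have hp : ∀ k, colimit.ι ((Functor.const ℕ).obj (F.obj a)) k ≫ p = 𝟙 _ :=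
    fun k => colimit.ι_desc _ _
  have hk : ∀ k, (kernel.ι φ).app k ≫ h.app a = 0 := fun k => by
    let i := (iota A ⟨k⟩).app F
    have e : (kernel.ι φ).app k ≫ i.app a = 0 := by
      have e₁ : (kernel.ι φ).app k ≫ F.map (inlHom a ⟨k⟩) = 0 :=
        NatTrans.congr_app (kernel.condition φ) k
      change (kernel.ι φ).app k ≫ F.map (inrHom ⟨k⟩ a) = 0
      rw [← inlHom_braiding, F.map_comp, reassoc_of% e₁, zero_comp]
    let S := (ShortComplex.mk _ _ (kernel.condition i)).map ((evaluation Theta A).obj a)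
    have hS : S.Exact := ((ShortComplex.mk _ _ (kernel.condition i)).exact_of_f_is_kernel
      (kernelIsKernel i)).map _
    have : Mono S.f := inferInstanceAs (Mono ((kernel.ι i).app a))
    have e₂ : S.f ≫ h.app a = 0 := NatTrans.congr_app (hh ⟨k⟩) a
    have e₃ := hS.lift_f _ e
    exact (congrArg (· ≫ h.app a) e₃.symm).trans
      ((Category.assoc _ _ _).trans ((congrArg (_ ≫ ·) e₂).trans comp_zero))
  have : p ≫ h.app a = 0 := by
    rw [← cancel_epi (colim.map (kernel.ι φ)), comp_zero]
    refine colimit.hom_ext fun k => ?_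
    rw [comp_zero]
    have e := ι_colimMap (kernel.ι φ) k
    refine (reassoc_of% e) _ |>.trans ?_
    rw [reassoc_of% (hp k)]
    exact hk k
  have e := hp 0
  calc h.app a = (colimit.ι ((Functor.const ℕ).obj (F.obj a)) 0 ≫ p) ≫ h.app a := by
        rw [e]; exact (Category.id_comp _).symm
    _ = 0 := by rw [Category.assoc, this, comp_zero]

theorem isZero_stableValue_iff [IsGrothendieckAbelian.{w} A] (F : Theta ⥤ A) :
    IsZero ((stableValue A).obj F) ↔ stablyNull Theta A F := by
  refine ⟨fun h => stablyNull_of_toStable fun a => h.eq_of_tgt _ _, fun h => ?_⟩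
  rw [IsZero.iff_id_eq_zero]
  exact stableValue_hom_ext fun a => by rw [toStable_eq_zero.{w} h, zero_comp, zero_comp]

theorem isStablyExact_stableValue [IsGrothendieckAbelian.{w} A] :
    IsStablyExact (stableValue A) :=
  ⟨inferInstance, inferInstance, fun F => (isZero_stableValue_iff.{w} F).2⟩

end StableValue


/-! ### Injections which miss a point -/

namespace Theta

instance (a b : Theta) : Finite (a ⟶ b) := inferInstanceAs (Finite (Fin a.card ↪ Fin b.card))

@[simp] theorem inl_inj {a b : Theta} {i j : Fin a.card} : inl a b i = inl a b j ↔ i = j :=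
  (Fin.castAdd_injective _ _).eq_iff
@[simp] theorem inr_inj {a b : Theta} {i j : Fin b.card} : inr a b i = inr a b j ↔ i = j :=
  (Fin.natAdd_injective _ _).eq_iff
@[simp] theorem inl_ne_inr {a b : Theta} {i : Fin a.card} {j : Fin b.card} :
    inl a b i ≠ inr a b j := fun h => by
  have : (i : ℕ) = a.card + j := congrArg Fin.val h
  lia
@[simp] theorem inr_ne_inl {a b : Theta} {i : Fin a.card} {j : Fin b.card} :
    inr a b j ≠ inl a b i := inl_ne_inr.symm

theorem exists_comp_eq {s t z : Theta} (g : s ⟶ z) (e : t ⟶ z)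
    (h : ∀ i, ∃ j, fn e j = fn g i) : ∃ k : s ⟶ t, k ≫ e = g := by
  choose k hk using h
  refine ⟨ofEmb ⟨k, fun i j hij => fn_injective g ?_⟩, hom_ext fun i => hk i⟩
  rw [← hk, ← hk, hij]

theorem exists_forall_ne {s x : Theta} (f : s ⟶ x) (h : s.card < x.card) :
    ∃ j : Fin x.card, ∀ i, fn f i ≠ j := by
  by_contra! hf
  have := Fintype.card_le_of_surjective (fn f) hf
  simp at this
  lia

/-- The injections whose image is the complement of a point. -/
theorem exists_complement {y : Theta} (j : Fin y.card) :
    ∃ (s : Theta) (f : s ⟶ y), s.card < y.card ∧ (∀ i, fn f i ≠ j) ∧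
      ∀ k, k ≠ j → ∃ i, fn f i = k := by
  obtain ⟨_ | m⟩ := y
  · exact j.elim0
  · exact ⟨⟨m⟩, ofEmb (Fin.succAboveEmb j), Nat.lt_succ_self m, fun i => Fin.succAbove_ne j i,
      fun k hk => Fin.exists_succAbove_eq hk⟩

/-- An injection into `y ⊔ b` which misses a point of `y` factors through a smaller `s ⊔ b`. -/
theorem exists_factor {s y b : Theta} (g : s ⟶ y ⊗ b) {j : Fin y.card}
    (h : ∀ i, fn g i ≠ inl y b j) :
    ∃ (t : Theta) (f : t ⟶ y) (k : s ⟶ t ⊗ b), t.card < y.card ∧ k ≫ f ▷ b = g := by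
  obtain ⟨t, f, ht, -, hf⟩ := exists_complement j
  obtain ⟨k, hk⟩ := exists_comp_eq g (f ▷ b) fun i => by
    have := h i
    revert this
    generalize fn g i = z
    revert z
    refine sum_cases (fun k hk => ?_) fun k _ => ⟨inr _ _ k, by simp⟩
    obtain ⟨l, rfl⟩ := hf k fun e => hk (by rw [e])
    exact ⟨inl _ _ l, by simp⟩
  exact ⟨t, f, k, ht, hk⟩

end Theta

/-! ### Cross-effects -/

section CrossEffect

open Theta

variable {A : Type u} [Category.{v} A] [Abelian A]

/-- The injections into `x` of smaller sets. -/
abbrev FaceIndex (x : Theta) : Type := Σ s : Fin x.card, ((⟨s⟩ : Theta) ⟶ x)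

/-- The quotient of `H(x)` by the images of the `H(s)`, for the injections `s ⟶ x` which are not
bijective. -/
noncomputable def crossObj (H : Theta ⥤ A) (x : Theta) : A :=
  cokernel (Sigma.desc fun k : FaceIndex x => H.map k.2)

/-- The projection onto the quotient `crossObj`. -/
noncomputable def crossπ (H : Theta ⥤ A) (x : Theta) : H.obj x ⟶ crossObj H x := cokernel.π _

instance (H : Theta ⥤ A) (x : Theta) : Epi (crossπ H x) :=
  inferInstanceAs (Epi (cokernel.π _))

theorem map_crossπ (H : Theta ⥤ A) {s x : Theta} (f : s ⟶ x) (h : s.card < x.card) :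
    H.map f ≫ crossπ H x = 0 := by
  have e := Sigma.ι_desc (fun k : FaceIndex x => H.map k.2) ⟨⟨s.card, h⟩, f⟩
  refine (congrArg (· ≫ crossπ H x) e).symm.trans ?_
  rw [Category.assoc]
  exact (congrArg (_ ≫ ·) (cokernel.condition _)).trans comp_zero

/-- The morphism out of `crossObj` induced by a morphism which vanishes on the images of the smaller
sets. -/
noncomputable def crossDesc (H : Theta ⥤ A) {x : Theta} {W : A} (h : H.obj x ⟶ W)
    (hh : ∀ {s : Theta} (f : s ⟶ x), s.card < x.card → H.map f ≫ h = 0) : crossObj H x ⟶ W :=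
  cokernel.desc _ h (Sigma.hom_ext _ _ fun k => by
    rw [comp_zero, Sigma.ι_desc_assoc]
    exact hh k.2 k.1.2)

@[simp]
theorem crossπ_desc (H : Theta ⥤ A) {x : Theta} {W : A} (h : H.obj x ⟶ W)
    (hh : ∀ {s : Theta} (f : s ⟶ x), s.card < x.card → H.map f ≫ h = 0) :
    crossπ H x ≫ crossDesc H h hh = h :=
  cokernel.π_desc _ _ _

theorem crossObj_hom_ext {H : Theta ⥤ A} {x : Theta} {W : A} {f g : crossObj H x ⟶ W}
    (h : crossπ H x ≫ f = crossπ H x ≫ g) : f = g :=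
  (cancel_epi _).1 h

/-- The map of `crossObj` induced by a morphism of `Θ`. -/
noncomputable def crossMap (H : Theta ⥤ A) {x y : Theta} (f : x ⟶ y) :
    crossObj H x ⟶ crossObj H y :=
  crossDesc H (H.map f ≫ crossπ H y) fun g hg => by
    rw [← H.map_comp_assoc, map_crossπ _ _ (hg.trans_le (card_le f))]

@[simp]
theorem crossπ_crossMap (H : Theta ⥤ A) {x y : Theta} (f : x ⟶ y) :
    crossπ H x ≫ crossMap H f = H.map f ≫ crossπ H y :=
  cokernel.π_desc _ _ _

/-- The functor `x ↦ crossObj H x`. -/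
noncomputable def crossFunctor (H : Theta ⥤ A) : Theta ⥤ A where
  obj := crossObj H
  map f := crossMap H f
  map_id x := crossObj_hom_ext (by rw [crossπ_crossMap, H.map_id]; simp)
  map_comp f g := crossObj_hom_ext (by
    rw [crossπ_crossMap, ← Category.assoc, crossπ_crossMap, Category.assoc, crossπ_crossMap,
      H.map_comp, Category.assoc])

/-- The map of `crossObj` induced by a natural transformation. -/
noncomputable def crossApp {H K : Theta ⥤ A} (φ : H ⟶ K) (x : Theta) :
    crossObj H x ⟶ crossObj K x :=
  crossDesc H (φ.app x ≫ crossπ K x) fun g hg => by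
    rw [φ.naturality_assoc, map_crossπ _ _ hg, comp_zero]

@[simp]
theorem crossπ_crossApp {H K : Theta ⥤ A} (φ : H ⟶ K) (x : Theta) :
    crossπ H x ≫ crossApp φ x = φ.app x ≫ crossπ K x :=
  cokernel.π_desc _ _ _

/-- The natural transformation between the functors `crossFunctor`. -/
noncomputable def crossNatTrans {H K : Theta ⥤ A} (φ : H ⟶ K) :
    crossFunctor H ⟶ crossFunctor K where
  app := crossApp φ
  naturality x y f := crossObj_hom_ext (by
    change crossπ H x ≫ crossMap H f ≫ crossApp φ y = crossπ H x ≫ crossApp φ x ≫ crossMap K f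
    rw [← Category.assoc, crossπ_crossMap, Category.assoc, crossπ_crossApp,
      ← Category.assoc (crossπ H x), crossπ_crossApp, Category.assoc, crossπ_crossMap,
      φ.naturality_assoc])

variable (A) in
/-- The functor sending `H` to the functor `x ↦ crossObj H x`. -/
noncomputable def cross : (Theta ⥤ A) ⥤ (Theta ⥤ A) where
  obj := crossFunctor
  map := crossNatTrans
  map_id H := NatTrans.ext (funext fun x => crossObj_hom_ext (by
    change crossπ H x ≫ crossApp (𝟙 H) x = crossπ H x ≫ 𝟙 _
    rw [crossπ_crossApp, NatTrans.id_app]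
    simp))
  map_comp {H K J} φ ψ := NatTrans.ext (funext fun x => crossObj_hom_ext (by
    change crossπ H x ≫ crossApp (φ ≫ ψ) x = crossπ H x ≫ crossApp φ x ≫ crossApp ψ x
    rw [crossπ_crossApp, ← Category.assoc, crossπ_crossApp, Category.assoc, crossπ_crossApp,
      NatTrans.comp_app, Category.assoc]))

variable (A) in
/-- The functor sending `F` to the bifunctor `(b, x) ↦ F(x ⊔ b)`. -/
def shift : (Theta ⥤ A) ⥤ (Theta ⥤ Theta ⥤ A) where
  obj F := tensoringRight Theta ⋙ (Functor.whiskeringRight Theta Theta A).obj F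
  map φ := Functor.whiskerLeft _ ((Functor.whiskeringRight Theta Theta A).map φ)

variable (A) in
/-- The cross-effect functors: `(crossEffects A).obj F` sends `x` to the functor which sends `b` to
the quotient of `F(x ⊔ b)` by the images of the `F(s ⊔ b)`, for the non-bijective `s ⟶ x`. -/
noncomputable def crossEffects : (Theta ⥤ A) ⥤ (Theta ⥤ Theta ⥤ A) :=
  shift A ⋙ (Functor.whiskeringRight Theta _ _).obj (cross A) ⋙ flipFunctor Theta Theta A

/-- The projection of `F(x ⊔ b)` onto the cross-effect. -/
noncomputable def crossProj (F : Theta ⥤ A) (x b : Theta) :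
    F.obj (x ⊗ b) ⟶ (((crossEffects A).obj F).obj x).obj b :=
  crossπ (((shift A).obj F).obj b) x

instance (F : Theta ⥤ A) (x b : Theta) : Epi (crossProj F x b) :=
  inferInstanceAs (Epi (crossπ _ _))

theorem crossProj_map_left (F : Theta ⥤ A) {x y : Theta} (f : x ⟶ y) (b : Theta) :
    crossProj F x b ≫ (((crossEffects A).obj F).map f).app b =
      F.map (f ▷ b) ≫ crossProj F y b :=
  crossπ_crossMap (((shift A).obj F).obj b) f

theorem crossProj_map_right (F : Theta ⥤ A) (x : Theta) {b c : Theta} (f : b ⟶ c) :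
    crossProj F x b ≫ (((crossEffects A).obj F).obj x).map f =
      F.map (x ◁ f) ≫ crossProj F x c :=
  crossπ_crossApp (((shift A).obj F).map f) x

theorem crossProj_app {F G : Theta ⥤ A} (φ : F ⟶ G) (x b : Theta) :
    crossProj F x b ≫ (((crossEffects A).map φ).app x).app b = φ.app (x ⊗ b) ≫ crossProj G x b :=
  crossπ_crossApp (((shift A).map φ).app b) x

/-- The working form of the definition: the source need not be a disjoint union with `b`, since an
injection missing a point of `x` factors through the complement of that point. -/
theorem map_crossProj_eq_zero (F : Theta ⥤ A) {s x b : Theta} (g : s ⟶ x ⊗ b) {j : Fin x.card}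
    (h : ∀ i, fn g i ≠ inl x b j) : F.map g ≫ crossProj F x b = 0 := by
  obtain ⟨t, f, k, ht, rfl⟩ := exists_factor g h
  have e : F.map (f ▷ b) ≫ crossProj F x b = 0 := map_crossπ (((shift A).obj F).obj b) f ht
  rw [F.map_comp, Category.assoc, e, comp_zero]

/-- The morphism out of a cross-effect induced by a morphism which vanishes on the images of the
smaller sets. -/
noncomputable def crossProjDesc (F : Theta ⥤ A) {x b : Theta} {W : A} (h : F.obj (x ⊗ b) ⟶ W)
    (hh : ∀ {s : Theta} (f : s ⟶ x), s.card < x.card → F.map (f ▷ b) ≫ h = 0) :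
    (((crossEffects A).obj F).obj x).obj b ⟶ W :=
  crossDesc (((shift A).obj F).obj b) h hh

@[simp]
theorem crossProj_desc (F : Theta ⥤ A) {x b : Theta} {W : A} (h : F.obj (x ⊗ b) ⟶ W)
    (hh : ∀ {s : Theta} (f : s ⟶ x), s.card < x.card → F.map (f ▷ b) ≫ h = 0) :
    crossProj F x b ≫ crossProjDesc F h hh = h :=
  crossπ_desc _ _ _

end CrossEffect


namespace Theta

/-- A set with one element. -/
abbrev pt : Theta := ⟨1⟩

theorem isGenerator_pt : IsGenerator pt := by
  rintro P h₀ h ⟨k⟩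
  induction k with
  | zero => exact h₀
  | succ k ih => exact h _ ih

end Theta

/-! ### Adding one point to a cross-effect amounts to applying `δ_1` -/

section CrossEffectDifference

open Theta

variable {A : Type u} [Category.{v} A] [Abelian A]

theorem crossEffects_hom_ext {F : Theta ⥤ A} {x b : Theta} {W : A}
    {f g : (((crossEffects A).obj F).obj x).obj b ⟶ W}
    (h : crossProj F x b ≫ f = crossProj F x b ≫ g) : f = g :=
  (cancel_epi _).1 h

/-- The projection from the translate of a cross-effect to the next one. -/
noncomputable def crossStepApp (F : Theta ⥤ A) (y z b : Theta) :
    (((crossEffects A).obj F).obj y).obj (z ⊗ b) ⟶ (((crossEffects A).obj F).obj (y ⊗ z)).obj b :=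
  crossProjDesc F (F.map (α_ y z b).inv ≫ crossProj F (y ⊗ z) b) fun {s} f hf => by
    rw [← F.map_comp_assoc, associator_inv_naturality_left, F.map_comp_assoc]
    obtain ⟨j, hj⟩ := exists_forall_ne f hf
    rw [map_crossProj_eq_zero F ((f ▷ z) ▷ b) (j := inl y z j), comp_zero]
    refine sum_cases (sum_cases (fun i => ?_) fun i => ?_) fun i => ?_ <;>
      simp [-card_tensor, hj]

@[simp]
theorem crossProj_stepApp (F : Theta ⥤ A) (y z b : Theta) :
    crossProj F y (z ⊗ b) ≫ crossStepApp F y z b =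
      F.map (α_ y z b).inv ≫ crossProj F (y ⊗ z) b :=
  cokernel.π_desc _ _ _

instance (F : Theta ⥤ A) (y z b : Theta) : Epi (crossStepApp F y z b) := by
  have : Epi (crossProj F y (z ⊗ b) ≫ crossStepApp F y z b) := by
    rw [crossProj_stepApp]
    infer_instance
  exact epi_of_epi (crossProj F y (z ⊗ b)) _

/-- The projection from the translate of a cross-effect to the next one, as a natural
transformation. -/
noncomputable def crossStep (F : Theta ⥤ A) (y z : Theta) :
    (translation A z).obj (((crossEffects A).obj F).obj y) ⟶
      ((crossEffects A).obj F).obj (y ⊗ z) where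
  app b := crossStepApp F y z b
  naturality b c f := crossEffects_hom_ext (by
    change crossProj F y (z ⊗ b) ≫ (((crossEffects A).obj F).obj y).map (z ◁ f) ≫
      crossStepApp F y z c = crossProj F y (z ⊗ b) ≫ crossStepApp F y z b ≫
        (((crossEffects A).obj F).obj (y ⊗ z)).map f
    rw [← Category.assoc, crossProj_map_right, Category.assoc, crossProj_stepApp,
      ← Category.assoc (crossProj F y (z ⊗ b)), crossProj_stepApp, Category.assoc,
      crossProj_map_right, ← F.map_comp_assoc, ← F.map_comp_assoc,
      associator_inv_naturality_right])

/-- The image of `i_z` comes from the part of `y ⊔ z ⊔ b` which avoids `z`; it misses a point of `y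
⊔ z` as soon as `z` is nonempty. -/
theorem iota_crossStep (F : Theta ⥤ A) (y : Theta) {z : Theta} (hz : 0 < z.card) :
    (iota A z).app (((crossEffects A).obj F).obj y) ≫ crossStep F y z = 0 := by
  ext b
  refine crossEffects_hom_ext ?_
  change crossProj F y b ≫ (((crossEffects A).obj F).obj y).map (inrHom z b) ≫
    crossStepApp F y z b = crossProj F y b ≫ 0
  rw [← Category.assoc, crossProj_map_right, Category.assoc, crossProj_stepApp, comp_zero,
    ← F.map_comp_assoc, map_crossProj_eq_zero F _ (j := inr y z ⟨0, hz⟩)]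
  refine sum_cases (fun i => ?_) fun i => ?_ <;> simp [-card_tensor]

/-- A morphism out of the translate of a cross-effect which vanishes on the image of `i_1` kills
the morphisms into the next cross-effect which are not bijective. -/
theorem map_whiskerRight_comp_eq_zero (F : Theta ⥤ A) (y : Theta) {W : Theta ⥤ A}
    (h : (translation A pt).obj (((crossEffects A).obj F).obj y) ⟶ W)
    (hh : (iota A pt).app _ ≫ h = 0) (b : Theta) {s : Theta} (g : s ⟶ y ⊗ pt)
    (hg : s.card < (y ⊗ pt).card) :
    F.map (g ▷ b) ≫ F.map (α_ y pt b).hom ≫ crossProj F y (pt ⊗ b) ≫ h.app b = 0 := by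
  obtain ⟨j, hj⟩ := exists_forall_ne g hg
  revert j
  -- If the missed point lies in `y`, the cross-effect at `y` already kills the map. If it is the
  -- added point, `g` factors through `y`, so the map passes through the image of `i_1`, which `h`
  -- kills.
  refine sum_cases (fun j hj => ?_) fun j hj => ?_
  · have e : F.map (g ▷ b ≫ (α_ y pt b).hom) ≫ crossProj F y (pt ⊗ b) = 0 := by
      refine map_crossProj_eq_zero F _ (j := j) ?_
      refine sum_cases (fun i => ?_) fun i => ?_
      · rw [fn_comp, fn_whiskerRight_inl]
        have := hj i
        revert this
        generalize fn g i = k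
        revert k
        exact sum_cases (fun k => by simp [-card_tensor]) fun k => by simp [-card_tensor]
      · simp [-card_tensor]
    rw [← F.map_comp_assoc, ← Category.assoc, e, zero_comp]
  · obtain ⟨k, rfl⟩ := exists_comp_eq g (inlHom y pt) fun i => by
      have := hj i
      revert this
      generalize fn g i = k
      revert k
      refine sum_cases (fun k _ => ⟨k, rfl⟩) fun k hk => ?_
      exact absurd (congrArg _ (Subsingleton.elim k j)) hk
    have e₁ : (k ≫ inlHom y pt) ▷ b ≫ (α_ y pt b).hom = k ▷ b ≫ y ◁ inrHom pt b :=
      hom_ext <| sum_cases (by simp) (by simp)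
    have e₂ : (((crossEffects A).obj F).obj y).map (inrHom pt b) ≫ h.app b = 0 :=
      NatTrans.congr_app hh b
    rw [← F.map_comp_assoc, e₁, F.map_comp_assoc, ← Category.assoc (F.map (y ◁ _)),
      ← crossProj_map_right, Category.assoc, e₂, comp_zero, comp_zero]

/-- The morphism induced on the next cross-effect. -/
noncomputable def crossStepDescApp (F : Theta ⥤ A) (y : Theta) {W : Theta ⥤ A}
    (h : (translation A pt).obj (((crossEffects A).obj F).obj y) ⟶ W)
    (hh : (iota A pt).app _ ≫ h = 0) (b : Theta) :
    (((crossEffects A).obj F).obj (y ⊗ pt)).obj b ⟶ W.obj b :=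
  crossProjDesc F (F.map (α_ y pt b).hom ≫ crossProj F y (pt ⊗ b) ≫ h.app b)
    (map_whiskerRight_comp_eq_zero F y h hh b)

theorem crossStepApp_desc (F : Theta ⥤ A) (y : Theta) {W : Theta ⥤ A}
    (h : (translation A pt).obj (((crossEffects A).obj F).obj y) ⟶ W)
    (hh : (iota A pt).app _ ≫ h = 0) (b : Theta) :
    crossStepApp F y pt b ≫ crossStepDescApp F y h hh b = h.app b :=
  crossEffects_hom_ext (by
    have e : crossProj F (y ⊗ pt) b ≫ crossStepDescApp F y h hh b =
      F.map (α_ y pt b).hom ≫ crossProj F y (pt ⊗ b) ≫ h.app b := cokernel.π_desc _ _ _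
    rw [← Category.assoc, crossProj_stepApp, Category.assoc, e, ← F.map_comp_assoc,
      Iso.inv_hom_id, F.map_id, Category.id_comp])

/-- The next cross-effect is the difference functor of a cross-effect. -/
noncomputable def isColimitCrossStep (F : Theta ⥤ A) (y : Theta) :
    IsColimit (CokernelCofork.ofπ (crossStep F y pt) (iota_crossStep F y Nat.one_pos)) :=
  CokernelCofork.IsColimit.ofπ _ _
    (fun h hh =>
      { app := crossStepDescApp F y h hh
        naturality := fun b c f => by
          rw [← cancel_epi (crossStepApp F y pt b)]
          have e : crossStepApp F y pt b ≫ (((crossEffects A).obj F).obj (y ⊗ pt)).map f =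
            ((translation A pt).obj (((crossEffects A).obj F).obj y)).map f ≫
              crossStepApp F y pt c := ((crossStep F y pt).naturality f).symm
          rw [← Category.assoc, e, Category.assoc, crossStepApp_desc, ← Category.assoc,
            crossStepApp_desc, h.naturality] })
    (fun h hh => NatTrans.ext (funext fun b => crossStepApp_desc F y h hh b))
    (fun h hh m hm => NatTrans.ext (funext fun b => by
      rw [← cancel_epi (crossStepApp F y pt b), crossStepApp_desc]
      exact NatTrans.congr_app hm b))

end CrossEffectDifference


/-! ### Cross-effects as iterated differences, and the stable cross-effect -/

section CrossEffectIterate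

open Theta

variable {A : Type u} [Category.{v} A] [Abelian A]

theorem crossStep_naturality {F G : Theta ⥤ A} (φ : F ⟶ G) (y z : Theta) :
    (translation A z).map (((crossEffects A).map φ).app y) ≫ crossStep G y z =
      crossStep F y z ≫ ((crossEffects A).map φ).app (y ⊗ z) :=
  NatTrans.ext (funext fun b => crossEffects_hom_ext (by
    change crossProj F y (z ⊗ b) ≫ (((crossEffects A).map φ).app y).app (z ⊗ b) ≫
      crossStepApp G y z b = crossProj F y (z ⊗ b) ≫ crossStepApp F y z b ≫
        (((crossEffects A).map φ).app (y ⊗ z)).app b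
    rw [← Category.assoc, crossProj_app, Category.assoc, crossProj_stepApp,
      ← Category.assoc (crossProj F y (z ⊗ b)), crossProj_stepApp, Category.assoc,
      crossProj_app, φ.naturality_assoc]))

variable (A) in
/-- The cross-effect at `x`. -/
noncomputable abbrev crossEffectAt (x : Theta) : (Theta ⥤ A) ⥤ (Theta ⥤ A) :=
  crossEffects A ⋙ (evaluation Theta (Theta ⥤ A)).obj x

/-- The next cross-effect is the difference functor of a cross-effect. -/
noncomputable def crossStepIso (F : Theta ⥤ A) (y : Theta) :
    ((crossEffects A).obj F).obj (y ⊗ pt) ≅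
      (difference A pt).obj (((crossEffects A).obj F).obj y) :=
  (isColimitCrossStep F y).coconePointUniqueUpToIso (colimit.isColimit _)

theorem crossStep_comp_iso (F : Theta ⥤ A) (y : Theta) :
    crossStep F y pt ≫ (crossStepIso F y).hom =
      (translationToDifference pt).app (((crossEffects A).obj F).obj y) :=
  (isColimitCrossStep F y).comp_coconePointUniqueUpToIso_hom _ WalkingParallelPair.one

theorem crossStepIso_naturality {F G : Theta ⥤ A} (φ : F ⟶ G) (y : Theta) :
    ((crossEffects A).map φ).app (y ⊗ pt) ≫ (crossStepIso G y).hom =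
      (crossStepIso F y).hom ≫ (difference A pt).map (((crossEffects A).map φ).app y) := by
  refine Cofork.IsColimit.hom_ext (isColimitCrossStep F y) ?_
  change crossStep F y pt ≫ _ = crossStep F y pt ≫ _
  rw [← Category.assoc, ← crossStep_naturality, Category.assoc, crossStep_comp_iso,
    ← Category.assoc, crossStep_comp_iso, NatTrans.naturality]

variable (A) in
/-- The next cross-effect functor is the composite of a cross-effect functor with the difference
functor. -/
noncomputable def crossEffectStep (y : Theta) :
    crossEffectAt A (y ⊗ pt) ≅ crossEffectAt A y ⋙ difference A pt :=
  NatIso.ofComponents (fun F => crossStepIso F y) (fun φ => crossStepIso_naturality φ y)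

/-- The values of the cross-effect at the empty set. -/
noncomputable def crossEffectZeroApp (F : Theta ⥤ A) (b : Theta) :
    F.obj b ≅ (((crossEffects A).obj F).obj ⟨0⟩).obj b where
  hom := F.map (λ_ b).inv ≫ crossProj F ⟨0⟩ b
  inv := crossProjDesc F (F.map (λ_ b).hom) fun f hf => absurd hf (Nat.not_lt_zero _)
  hom_inv_id := by
    rw [Category.assoc, crossProj_desc]
    exact (F.map_comp _ _).symm.trans ((congrArg F.map (λ_ b).inv_hom_id).trans (F.map_id _))
  inv_hom_id := crossEffects_hom_ext (by
    rw [← Category.assoc, crossProj_desc, Category.comp_id]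
    refine (Category.assoc _ _ _).symm.trans ?_
    rw [← F.map_comp]
    refine (congrArg (F.map · ≫ crossProj F ⟨0⟩ b) (λ_ b).hom_inv_id).trans ?_
    exact (congrArg (· ≫ crossProj F ⟨0⟩ b) (F.map_id _)).trans (Category.id_comp _))

variable (A) in
/-- The cross-effect at the empty set is the identity functor. -/
noncomputable def crossEffectZero : 𝟭 _ ≅ crossEffectAt A ⟨0⟩ :=
  NatIso.ofComponents
    (fun F => NatIso.ofComponents (crossEffectZeroApp F) fun {b c} f => by
      change F.map f ≫ F.map (λ_ c).inv ≫ crossProj F ⟨0⟩ c =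
        (F.map (λ_ b).inv ≫ crossProj F ⟨0⟩ b) ≫ (((crossEffects A).obj F).obj ⟨0⟩).map f
      rw [Category.assoc, crossProj_map_right]
      have h : f ≫ (λ_ c).inv = (λ_ b).inv ≫ (⟨0⟩ : Theta) ◁ f := leftUnitor_inv_naturality f
      have h' := congrArg (F.map · ≫ crossProj F ⟨0⟩ c) h
      simp only [F.map_comp, Category.assoc] at h'
      exact h')
    (fun {F G} φ => NatTrans.ext (funext fun b => by
      change φ.app b ≫ G.map (λ_ b).inv ≫ crossProj G ⟨0⟩ b =
        (F.map (λ_ b).inv ≫ crossProj F ⟨0⟩ b) ≫ (((crossEffects A).map φ).app ⟨0⟩).app b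
      rw [Category.assoc, crossProj_app]
      exact (φ.naturality_assoc (λ_ b).inv (crossProj G ⟨0⟩ b)).symm))

variable (A) in
/-- The iterates of the difference functor commute with it. -/
noncomputable def iterDifferenceComm {M : Type} [SmallCategory M] [MonoidalCategory M]
    [UnitInitial M] (g : M) : ∀ d : ℕ, iterDifference A g (d + 1) ≅
      iterDifference A g d ⋙ difference A g
  | 0 => Functor.rightUnitor _ ≪≫ (Functor.leftUnitor _).symm
  | d + 1 => Functor.isoWhiskerLeft (difference A g) (iterDifferenceComm g d) ≪≫
      (Functor.associator _ _ _).symm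

variable (A) in
/-- The cross-effects are the iterates of the difference functor. -/
noncomputable def crossEffectIso : ∀ d : ℕ, crossEffectAt A ⟨d⟩ ≅ iterDifference A pt d
  | 0 => (crossEffectZero A).symm
  | d + 1 => crossEffectStep A ⟨d⟩ ≪≫
      Functor.isoWhiskerRight (crossEffectIso d) (difference A pt) ≪≫
      (iterDifferenceComm A pt d).symm

/-- The symmetric group as a category of automorphisms in `Θ`. -/
def permFunctor (n : ℕ) : SingleObj (Equiv.Perm (Fin n)) ⥤ Theta where
  obj _ := ⟨n⟩
  map σ := ofEmb (Equiv.toEmbedding σ)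

variable [HasColimitsOfShape ℕ A]

variable (A) in
/-- The stable value of the `n`-th cross-effect, with the action of the symmetric group. -/
noncomputable def stableCrossEffect (n : ℕ) :
    (Theta ⥤ A) ⥤ (SingleObj (Equiv.Perm (Fin n)) ⥤ A) :=
  crossEffects A ⋙ (Functor.whiskeringRight Theta _ _).obj (stableValue A) ⋙
    (Functor.whiskeringLeft _ _ A).obj (permFunctor n)

variable (A) in
/-- The underlying functor of `stableCrossEffect`. -/
noncomputable def stableCrossEffectIso (n : ℕ) (s : SingleObj (Equiv.Perm (Fin n))) :
    stableCrossEffect A n ⋙ (evaluation _ A).obj s ≅ iterDifference A pt n ⋙ stableValue A :=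
  Functor.isoWhiskerRight (crossEffectIso A n) (stableValue A)

variable [HasExactColimitsOfShape ℕ A] [IsGrothendieckAbelian.{w} A]

/-- Exactness can be checked after forgetting the action of the symmetric group, where the functor
is the stable value of an iterated difference. -/
theorem exact_stableCrossEffect (n : ℕ) :
    PreservesFiniteLimits (stableCrossEffect A n) ∧
      PreservesFiniteColimits (stableCrossEffect A n) := by
  have h : IsStablyExact (iterDifference A pt n ⋙ stableValue A) :=
    isStablyExact_iterDifference isStablyExact_stableValue.{w} pt n
  have := h.preservesFiniteLimits
  have := h.preservesFiniteColimits
  exact ⟨preservesFiniteLimits_of_evaluation _ fun s =>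
      preservesFiniteLimits_of_natIso (stableCrossEffectIso A n s).symm,
    preservesFiniteColimits_of_evaluation _ fun s =>
      preservesFiniteColimits_of_natIso (stableCrossEffectIso A n s).symm⟩

/-- Here `polynomial n` means degree at most `n - 1`, so the kernel of the stable cross-effect is
precisely what the quotient category divides out. -/
theorem isZero_stableCrossEffect_iff (n : ℕ) (F : Theta ⥤ A) :
    IsZero ((stableCrossEffect A n).obj F) ↔
      St.polynomial.{w} Theta A n ((St.proj.{w} Theta A).obj F) := by
  rw [St.polynomial_proj_iff.{w} isGenerator_pt, ← isZero_stableValue_iff.{w},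
    Functor.isZero_iff]
  have h := fun s => ((stableCrossEffectIso A n s).app F).isZero_iff
  exact ⟨fun h' => (h _).1 (h' (SingleObj.star _)), fun h' s => (h s).2 h'⟩

omit [HasColimitsOfShape ℕ A] [HasExactColimitsOfShape ℕ A] in
theorem polynomial_iff_crossEffect (n : ℕ) (F : Theta ⥤ A) :
    St.polynomial.{w} Theta A n ((St.proj.{w} Theta A).obj F) ↔
      stablyNull Theta A ((crossEffectAt A ⟨n⟩).obj F) := by
  rw [St.polynomial_proj_iff.{w} isGenerator_pt]
  exact (stablyNull Theta A).prop_iff_of_iso ((crossEffectIso A n).app F).symm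

omit [HasColimitsOfShape ℕ A] [HasExactColimitsOfShape ℕ A] in
/-- The difference functors of the `n`-th cross-effect of a functor which is polynomial of degree at
most `n` are stably null. -/
theorem stablyNull_difference_crossEffect (n : ℕ) {F : Theta ⥤ A}
    (hF : St.polynomial.{w} Theta A (n + 1) ((St.proj.{w} Theta A).obj F)) (x : Theta) :
    stablyNull Theta A ((difference A x).obj ((crossEffectAt A ⟨n⟩).obj F)) := by
  refine stablyNull_iterDifference_difference.{w} isGenerator_pt 0 ?_ x
  refine (stablyNull Theta A).prop_of_iso ((crossEffectStep A ⟨n⟩).app F) ?_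
  exact (polynomial_iff_crossEffect.{w} (n + 1) F).1 hF

end CrossEffectIterate


/-! ### Morphisms of `Θ̃` as partial injections -/

namespace Tilde

open Theta

/-- The relation underlying a morphism of `Θ̃`, seen as a partial injection. -/
def Hits {a b : Tilde Theta} (u : a ⟶ b) (i : Fin a.of.card) (y : Fin b.of.card) : Prop :=
  Quot.lift (fun p : Rep a.of b.of => fn p.hom i = inl b.of p.t y) (by
    rintro ⟨t, f⟩ ⟨t', f'⟩ ⟨(g : t ⟶ t'), (h : f ≫ b.of ◁ g = f')⟩
    subst h
    change (fn f i = _) = (fn (b.of ◁ g) (fn f i) = _)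
    generalize fn f i = k
    revert k
    refine sum_cases (fun k => ?_) fun k => ?_ <;> simp [-card_tensor]) u

theorem hits_mk {a b : Tilde Theta} {t : Theta} {f : a.of ⟶ b.of ⊗ t} {i : Fin a.of.card}
    {y : Fin b.of.card} : Hits (mk t f : a ⟶ b) i y ↔ fn f i = inl b.of t y := Iff.rfl

/-- Points sent into the complement `t` are those where `u` is undefined, and they stay in the
complement under composition. -/
theorem hits_comp {a b c : Tilde Theta} {u : a ⟶ b} {v : b ⟶ c} {i : Fin a.of.card}
    {z : Fin c.of.card} : Hits (u ≫ v) i z ↔ ∃ y, Hits u i y ∧ Hits v y z := by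
  obtain ⟨t, f, rfl⟩ := mk_surj u
  obtain ⟨s, g, rfl⟩ := mk_surj v
  rw [mk_comp]
  simp only [hits_mk]
  change fn (α_ c.of s t).hom (fn (g ▷ t) (fn f i)) = _ ↔ _
  generalize fn f i = k
  revert k
  refine sum_cases (fun k => ?_) fun k => ?_
  · rw [fn_whiskerRight_inl]
    simp only [inl_inj, exists_eq_left']
    generalize fn g k = l
    revert l
    refine sum_cases (fun l => ?_) fun l => ?_ <;> simp [-card_tensor]
  · simp [-card_tensor]

theorem hits_eta {a b : Theta} {f : a ⟶ b} {i : Fin a.card} {y : Fin b.card} :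
    Hits ((eta Theta).map f) i y ↔ fn f i = y := by
  have h : f ≫ (ρ_ b).inv = f ≫ inlHom b (𝟙_ Theta) := by
    rw [← cancel_mono (ρ_ b).hom]
    exact hom_ext fun i => by simp
  change fn (f ≫ (ρ_ b).inv) i = inl b (𝟙_ Theta) y ↔ _
  rw [h]
  exact inl_inj

theorem Hits.left_unique {a b : Tilde Theta} {u : a ⟶ b} {i i' : Fin a.of.card}
    {y : Fin b.of.card} (h : Hits u i y) (h' : Hits u i' y) : i = i' := by
  obtain ⟨t, f, rfl⟩ := mk_surj u
  exact fn_injective f ((hits_mk.1 h).trans (hits_mk.1 h').symm)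

/-- An everywhere defined morphism never meets its complement `t`, so its representative comes from
the empty complement along `∅ ⟶ t`. -/
theorem eq_eta_of_hits {a b : Theta} {u : (⟨a⟩ : Tilde Theta) ⟶ ⟨b⟩} {k : a ⟶ b}
    (h : ∀ i, Hits u i (fn k i)) : u = (eta Theta).map k := by
  obtain ⟨t, f, rfl⟩ := mk_surj u
  refine (mk_eq (a := ⟨a⟩) (b := ⟨b⟩) _ (fromUnit t) _ (Theta.hom_ext fun i => ?_)).symm
  have e := hits_mk.1 (h i)
  have e' : fn (ρ_ b).inv (fn k i) = inl b (𝟙_ Theta) (fn k i) :=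
    fn_injective (ρ_ b).hom (by rw [← fn_comp, Iso.inv_hom_id, fn_rightUnitor, fn_id])
  rw [fn_comp, fn_comp, e', fn_whiskerLeft_inl]
  exact e.symm

/-- A partial injection hits each point at most once. This makes the preimage of a subset under a
morphism of `Θ̃` unambiguous, with its labelling. -/
theorem eta_comp_unique {a b c : Theta} {v : (⟨b⟩ : Tilde Theta) ⟶ ⟨c⟩} {j j' : a ⟶ b} {k : a ⟶ c}
    (h : (eta Theta).map j ≫ v = (eta Theta).map k)
    (h' : (eta Theta).map j' ≫ v = (eta Theta).map k) : j = j' := by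
  refine Theta.hom_ext fun i => ?_
  have key : ∀ {j : a ⟶ b}, (eta Theta).map j ≫ v = (eta Theta).map k →
      Hits v (fn j i) (fn k i) := fun {j} h => by
    obtain ⟨y, h₁, h₂⟩ := hits_comp.1 (h ▸ hits_eta.2 rfl : Hits ((eta Theta).map j ≫ v) i (fn k i))
    rw [hits_eta.1 h₁]
    exact h₂
  exact (key h).left_unique (key h')

theorem eta_injective {a b : Theta} {j j' : a ⟶ b}
    (h : (eta Theta).map j = (eta Theta).map j') : j = j' :=
  eta_comp_unique (v := 𝟙 _) (Category.comp_id _) ((Category.comp_id _).trans h.symm)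

/-- If a composite of partial injections is everywhere defined, so is its first factor. The
functoriality of the induced functor rests on this. -/
theorem exists_eq_eta {a b c : Theta} {u : (⟨a⟩ : Tilde Theta) ⟶ ⟨b⟩}
    {v : (⟨b⟩ : Tilde Theta) ⟶ ⟨c⟩} {k : a ⟶ c} (h : u ≫ v = (eta Theta).map k) :
    ∃ j, u = (eta Theta).map j := by
  have h' : ∀ i, ∃ y, Hits u i y ∧ Hits v y (fn k i) := fun i =>
    hits_comp.1 (h ▸ hits_eta.2 rfl : Hits (u ≫ v) i (fn k i))
  choose y h₁ h₂ using h'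
  exact ⟨ofEmb ⟨y, fun i i' e => (h₁ i).left_unique (e ▸ h₁ i')⟩, eq_eta_of_hits h₁⟩

end Tilde

/-! ### Sums of copies of a representation indexed by subsets -/

section InducedObject

open Theta

/-- The automorphism of an object of `Θ` given by a permutation. -/
def perm {n : ℕ} (σ : Equiv.Perm (Fin n)) : (⟨n⟩ : Theta) ⟶ ⟨n⟩ := ofEmb σ.toEmbedding

theorem perm_mul {n : ℕ} (σ τ : Equiv.Perm (Fin n)) : perm (σ * τ) = perm τ ≫ perm σ := rfl

theorem perm_one {n : ℕ} : perm (1 : Equiv.Perm (Fin n)) = 𝟙 _ := rfl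

theorem perm_inv_comp {n : ℕ} (σ : Equiv.Perm (Fin n)) : perm σ⁻¹ ≫ perm σ = 𝟙 _ := by
  rw [← perm_mul, mul_inv_cancel, perm_one]

theorem exists_eq_perm {n : ℕ} (f : (⟨n⟩ : Theta) ⟶ ⟨n⟩) : ∃ σ, f = perm σ :=
  ⟨Equiv.ofBijective (fn f) (Finite.injective_iff_bijective.1 (fn_injective f)),
    hom_ext fun _ => rfl⟩

theorem perm_comp_inj {n : ℕ} {a : Theta} {j : (⟨n⟩ : Theta) ⟶ a} {σ τ : Equiv.Perm (Fin n)}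
    (h : perm σ ≫ j = perm τ ≫ j) : σ = τ :=
  Equiv.ext fun i => fn_injective j (congrArg (fn · i) h)

/-- Injections into `a` up to permutation of the source. -/
def injSetoid (n : ℕ) (a : Theta) : Setoid ((⟨n⟩ : Theta) ⟶ a) where
  r j j' := ∃ σ, perm σ ≫ j = j'
  iseqv :=
    { refl := fun j => ⟨1, rfl⟩
      symm := by
        rintro j _ ⟨σ, rfl⟩
        exact ⟨σ⁻¹, by rw [← Category.assoc, perm_inv_comp, Category.id_comp]⟩
      trans := by
        rintro j _ _ ⟨σ, rfl⟩ ⟨τ, rfl⟩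
        exact ⟨σ * τ, by rw [perm_mul, Category.assoc]⟩ }

/-- The subsets with `n` elements of `a`. -/
abbrev Subsets (n : ℕ) (a : Theta) : Type := Quotient (injSetoid n a)

variable {A : Type u} [Category.{v} A] {n : ℕ}

/-- The action of a permutation on a representation. -/
abbrev act (N : SingleObj (Equiv.Perm (Fin n)) ⥤ A) (σ : Equiv.Perm (Fin n)) :
    N.obj (SingleObj.star _) ⟶ N.obj (SingleObj.star _) :=
  N.map (X := SingleObj.star _) (Y := SingleObj.star _) σ

theorem act_mul (N : SingleObj (Equiv.Perm (Fin n)) ⥤ A) (σ τ : Equiv.Perm (Fin n)) :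
    act N (σ * τ) = act N τ ≫ act N σ :=
  N.map_comp (X := SingleObj.star _) (Y := SingleObj.star _) (Z := SingleObj.star _) τ σ

theorem act_one (N : SingleObj (Equiv.Perm (Fin n)) ⥤ A) : act N 1 = 𝟙 _ :=
  N.map_id (SingleObj.star _)

theorem act_inv_comp (N : SingleObj (Equiv.Perm (Fin n)) ⥤ A) (σ : Equiv.Perm (Fin n)) :
    act N σ⁻¹ ≫ act N σ = 𝟙 _ := by
  rw [← act_mul, mul_inv_cancel, act_one]

theorem act_comp_inv (N : SingleObj (Equiv.Perm (Fin n)) ⥤ A) (σ : Equiv.Perm (Fin n)) :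
    act N σ ≫ act N σ⁻¹ = 𝟙 _ := by
  rw [← act_mul, inv_mul_cancel, act_one]

variable [Abelian A]

instance (n : ℕ) (a : Theta) (X : A) : HasBiproduct fun _ : Subsets n a => X :=
  have := Abelian.hasFiniteBiproducts (C := A)
  inferInstance

/-- The direct sum of copies of a representation `N` of the symmetric group, indexed by the subsets
with `n` elements of `a`. -/
noncomputable abbrev indObj (N : SingleObj (Equiv.Perm (Fin n)) ⥤ A) (a : Theta) : A :=
  ⨁ fun _ : Subsets n a => N.obj (SingleObj.star _)

variable (N : SingleObj (Equiv.Perm (Fin n)) ⥤ A) {a : Theta}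

theorem exists_perm_out (j : (⟨n⟩ : Theta) ⟶ a) :
    ∃ σ, perm σ ≫ (Quotient.mk (injSetoid n a) j).out = j :=
  Quotient.mk_out (s := injSetoid n a) j

/-- The projection indexed by an injection. -/
noncomputable def indπ (j : (⟨n⟩ : Theta) ⟶ a) : indObj N a ⟶ N.obj (SingleObj.star _) :=
  biproduct.π _ (Quotient.mk (injSetoid n a) j) ≫ act N (exists_perm_out j).choose⁻¹

/-- The inclusion indexed by an injection. -/
noncomputable def indι (j : (⟨n⟩ : Theta) ⟶ a) : N.obj (SingleObj.star _) ⟶ indObj N a :=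
  act N (exists_perm_out j).choose ≫ biproduct.ι (fun _ : Subsets n a => N.obj (SingleObj.star _))
    (Quotient.mk (injSetoid n a) j)

theorem indπ_eq (q : Subsets n a) (σ : Equiv.Perm (Fin n)) :
    indπ N (perm σ ≫ q.out) = biproduct.π _ q ≫ act N σ⁻¹ := by
  have e : Quotient.mk (injSetoid n a) (perm σ ≫ q.out) = q :=
    (Quotient.sound (s := injSetoid n a) ⟨σ, rfl⟩).symm.trans q.out_eq
  have h := (exists_perm_out (perm σ ≫ q.out)).choose_spec
  unfold indπ
  -- The chosen permutation depends on the class, so it is generalized before the class is replaced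
  -- by `q`. It is then forced to be `σ`, since permutations act freely on injections.
  generalize (exists_perm_out (perm σ ≫ q.out)).choose = τ at h ⊢
  revert h
  rw [e]
  intro h
  rw [perm_comp_inj h]

theorem indι_eq (q : Subsets n a) (σ : Equiv.Perm (Fin n)) :
    indι N (perm σ ≫ q.out) = act N σ ≫
    biproduct.ι (fun _ : Subsets n a => N.obj (SingleObj.star _)) q := by
  have e : Quotient.mk (injSetoid n a) (perm σ ≫ q.out) = q :=
    (Quotient.sound (s := injSetoid n a) ⟨σ, rfl⟩).symm.trans q.out_eq
  have h := (exists_perm_out (perm σ ≫ q.out)).choose_spec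
  unfold indι
  generalize (exists_perm_out (perm σ ≫ q.out)).choose = τ at h ⊢
  revert h
  rw [e]
  intro h
  rw [perm_comp_inj h]

/-- Equivariance allows coordinates indexed by all injections, so that later arguments need no
representative for each subset. -/
theorem indπ_perm (σ : Equiv.Perm (Fin n)) (j : (⟨n⟩ : Theta) ⟶ a) :
    indπ N (perm σ ≫ j) = indπ N j ≫ act N σ⁻¹ := by
  obtain ⟨τ, hτ⟩ := exists_perm_out j
  generalize Quotient.mk (injSetoid n a) j = q at hτ
  rw [← hτ, ← Category.assoc, ← perm_mul, indπ_eq, indπ_eq, mul_inv_rev, act_mul, Category.assoc]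

theorem indι_perm (σ : Equiv.Perm (Fin n)) (j : (⟨n⟩ : Theta) ⟶ a) :
    indι N (perm σ ≫ j) = act N σ ≫ indι N j := by
  obtain ⟨τ, hτ⟩ := exists_perm_out j
  generalize Quotient.mk (injSetoid n a) j = q at hτ
  rw [← hτ, ← Category.assoc, ← perm_mul, indι_eq, indι_eq, act_mul, Category.assoc]

theorem indι_π (j : (⟨n⟩ : Theta) ⟶ a) : indι N j ≫ indπ N j = 𝟙 _ := by
  rw [indι, indπ, Category.assoc, biproduct.ι_π_self_assoc, act_comp_inv]

theorem indι_π_perm (σ : Equiv.Perm (Fin n)) (j : (⟨n⟩ : Theta) ⟶ a) :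
    indι N j ≫ indπ N (perm σ ≫ j) = act N σ⁻¹ := by
  rw [indπ_perm, ← Category.assoc, indι_π, Category.id_comp]

theorem indι_π_ne {j k : (⟨n⟩ : Theta) ⟶ a} (h : ¬ ∃ σ, perm σ ≫ j = k) :
    indι N j ≫ indπ N k = 0 := by
  have e : Quotient.mk (injSetoid n a) j ≠ Quotient.mk (injSetoid n a) k := fun e =>
    h (Quotient.exact (s := injSetoid n a) e)
  rw [indι, indπ, Category.assoc, biproduct.ι_π_ne_assoc _ e, zero_comp, comp_zero]

variable {N}

theorem ind_hom_ext {X : A} {f g : X ⟶ indObj N a} (h : ∀ j, f ≫ indπ N j = g ≫ indπ N j) :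
    f = g := by
  refine biproduct.hom_ext _ _ fun q => ?_
  have := h (perm 1 ≫ q.out)
  rwa [indπ_eq, inv_one, act_one, Category.comp_id] at this

theorem ind_hom_ext' {X : A} {f g : indObj N a ⟶ X} (h : ∀ j, indι N j ≫ f = indι N j ≫ g) :
    f = g := by
  refine biproduct.hom_ext' _ _ fun q => ?_
  have := h (perm 1 ≫ q.out)
  rwa [indι_eq, act_one, Category.id_comp] at this

/-- The morphism given by an equivariant family. -/
noncomputable def indLift {X : A} (f : ((⟨n⟩ : Theta) ⟶ a) → (X ⟶ N.obj (SingleObj.star _)))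
    (_ : ∀ σ j, f (perm σ ≫ j) = f j ≫ act N σ⁻¹) : X ⟶ indObj N a :=
  biproduct.lift fun q => f q.out

theorem indLift_π {X : A} (f : ((⟨n⟩ : Theta) ⟶ a) → (X ⟶ N.obj (SingleObj.star _)))
    (hf : ∀ σ j, f (perm σ ≫ j) = f j ≫ act N σ⁻¹) (j) : indLift f hf ≫ indπ N j = f j := by
  obtain ⟨τ, hτ⟩ := exists_perm_out j
  generalize Quotient.mk (injSetoid n a) j = q at hτ
  rw [← hτ, indπ_eq, hf, indLift, biproduct.lift_π_assoc]

end InducedObject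


/-! ### The induced functor on `Θ̃` and its degree -/

section InducedFunctor

open Theta

variable {A : Type u} [Category.{v} A] [Abelian A] {n : ℕ}

/-- The projection indexed by the preimage of an injection under a morphism of `Θ̃`, if it exists. -/
noncomputable def indPre (N : SingleObj (Equiv.Perm (Fin n)) ⥤ A) {a b : Theta}
    (u : (⟨a⟩ : Tilde Theta) ⟶ ⟨b⟩) (k : (⟨n⟩ : Theta) ⟶ b) :
    indObj N a ⟶ N.obj (SingleObj.star _) :=
  open Classical in
  if h : ∃ j, (Tilde.eta Theta).map j ≫ u = (Tilde.eta Theta).map k then indπ N h.choose else 0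

variable {N : SingleObj (Equiv.Perm (Fin n)) ⥤ A} {a b c : Theta}

theorem indPre_eq {u : (⟨a⟩ : Tilde Theta) ⟶ ⟨b⟩} {j : (⟨n⟩ : Theta) ⟶ a} {k : (⟨n⟩ : Theta) ⟶ b}
    (h : (Tilde.eta Theta).map j ≫ u = (Tilde.eta Theta).map k) : indPre N u k = indπ N j := by
  have h' : ∃ j, (Tilde.eta Theta).map j ≫ u = (Tilde.eta Theta).map k := ⟨j, h⟩
  rw [indPre, dif_pos h', Tilde.eta_comp_unique h'.choose_spec h]

theorem indPre_eq_zero {u : (⟨a⟩ : Tilde Theta) ⟶ ⟨b⟩} {k : (⟨n⟩ : Theta) ⟶ b}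
    (h : ¬ ∃ j, (Tilde.eta Theta).map j ≫ u = (Tilde.eta Theta).map k) : indPre N u k = 0 := by
  rw [indPre, dif_neg h]

theorem eta_perm_comp {u : (⟨a⟩ : Tilde Theta) ⟶ ⟨b⟩} {j : (⟨n⟩ : Theta) ⟶ a}
    {k : (⟨n⟩ : Theta) ⟶ b} (h : (Tilde.eta Theta).map j ≫ u = (Tilde.eta Theta).map k)
    (σ : Equiv.Perm (Fin n)) :
    (Tilde.eta Theta).map (perm σ ≫ j) ≫ u = (Tilde.eta Theta).map (perm σ ≫ k) := by
  rw [Functor.map_comp, Functor.map_comp, ← h]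
  exact Category.assoc _ _ _

theorem indPre_perm (u : (⟨a⟩ : Tilde Theta) ⟶ ⟨b⟩) (σ : Equiv.Perm (Fin n))
    (k : (⟨n⟩ : Theta) ⟶ b) : indPre N u (perm σ ≫ k) = indPre N u k ≫ act N σ⁻¹ := by
  by_cases h : ∃ j, (Tilde.eta Theta).map j ≫ u = (Tilde.eta Theta).map k
  · obtain ⟨j, hj⟩ := h
    rw [indPre_eq hj, indPre_eq (eta_perm_comp hj σ), indπ_perm]
  · rw [indPre_eq_zero h, zero_comp, indPre_eq_zero]
    rintro ⟨j, hj⟩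
    refine h ⟨perm σ⁻¹ ≫ j, (eta_perm_comp hj σ⁻¹).trans ?_⟩
    rw [← Category.assoc, perm_inv_comp, Category.id_comp]

variable (N) in
/-- The map of direct sums induced by a morphism of `Θ̃`. -/
noncomputable def indMap (u : (⟨a⟩ : Tilde Theta) ⟶ ⟨b⟩) : indObj N a ⟶ indObj N b :=
  indLift (indPre N u) (indPre_perm u)

theorem indMap_π (u : (⟨a⟩ : Tilde Theta) ⟶ ⟨b⟩) (k : (⟨n⟩ : Theta) ⟶ b) :
    indMap N u ≫ indπ N k = indPre N u k :=
  indLift_π _ _ k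

theorem indMap_id : indMap N (𝟙 (⟨a⟩ : Tilde Theta)) = 𝟙 _ :=
  ind_hom_ext fun j => by
    rw [indMap_π, Category.id_comp]
    exact indPre_eq (Category.comp_id _)

/-- Coordinate by coordinate: `k` has a preimage under the composite exactly when it has one under
`v` which in turn has one under `u`. -/
theorem indMap_comp (u : (⟨a⟩ : Tilde Theta) ⟶ ⟨b⟩) (v : (⟨b⟩ : Tilde Theta) ⟶ ⟨c⟩) :
    indMap N (u ≫ v) = indMap N u ≫ indMap N v := by
  refine ind_hom_ext fun k => ?_
  rw [Category.assoc, indMap_π, indMap_π]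
  by_cases h : ∃ j, (Tilde.eta Theta).map j ≫ v = (Tilde.eta Theta).map k
  · obtain ⟨j, hj⟩ := h
    rw [indPre_eq hj, indMap_π]
    by_cases h' : ∃ i, (Tilde.eta Theta).map i ≫ u = (Tilde.eta Theta).map j
    · obtain ⟨i, hi⟩ := h'
      rw [indPre_eq hi]
      refine indPre_eq ((Category.assoc _ _ _).symm.trans ?_)
      exact (congrArg (· ≫ v) hi).trans hj
    · rw [indPre_eq_zero h', indPre_eq_zero]
      rintro ⟨i, hi⟩
      have hi' := (Category.assoc _ _ _).trans hi
      -- The composite of `i` with `u` is everywhere defined because following it by `v` gives `k`;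
      -- it must therefore be the preimage `j`, contradicting `h'`.
      obtain ⟨j', hj'⟩ := Tilde.exists_eq_eta hi'
      obtain rfl : j' = j := Tilde.eta_comp_unique ((congrArg (· ≫ v) hj').symm.trans hi') hj
      exact h' ⟨i, hj'⟩
  · rw [indPre_eq_zero h, comp_zero, indPre_eq_zero]
    rintro ⟨i, hi⟩
    have hi' := (Category.assoc _ _ _).trans hi
    obtain ⟨j', hj'⟩ := Tilde.exists_eq_eta hi'
    exact h ⟨j', (congrArg (· ≫ v) hj').symm.trans hi'⟩

/-- The map of direct sums induced by a morphism of representations. -/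
noncomputable def indApp {N N' : SingleObj (Equiv.Perm (Fin n)) ⥤ A} (φ : N ⟶ N') (a : Theta) :
    indObj N a ⟶ indObj N' a :=
  indLift (fun j => indπ N j ≫ φ.app _) fun σ j => by
    rw [indπ_perm, Category.assoc, Category.assoc]
    exact congrArg (_ ≫ ·) (φ.naturality _)

theorem indApp_π {N N' : SingleObj (Equiv.Perm (Fin n)) ⥤ A} (φ : N ⟶ N')
    (j : (⟨n⟩ : Theta) ⟶ a) : indApp φ a ≫ indπ N' j = indπ N j ≫ φ.app _ :=
  indLift_π _ _ j

theorem indApp_pre {N N' : SingleObj (Equiv.Perm (Fin n)) ⥤ A} (φ : N ⟶ N')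
    (u : (⟨a⟩ : Tilde Theta) ⟶ ⟨b⟩) (k : (⟨n⟩ : Theta) ⟶ b) :
    indApp φ a ≫ indPre N' u k = indPre N u k ≫ φ.app _ := by
  by_cases h : ∃ j, (Tilde.eta Theta).map j ≫ u = (Tilde.eta Theta).map k
  · obtain ⟨j, hj⟩ := h
    rw [indPre_eq hj, indPre_eq hj, indApp_π]
  · rw [indPre_eq_zero h, indPre_eq_zero h, zero_comp, comp_zero]

variable (A n) in
/-- The functor sending a representation `N` of the symmetric group to the functor on `Θ̃` whose value
at `a` is the direct sum of copies of `N` indexed by the subsets with `n` elements of `a`. -/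
noncomputable def indFunctor : (SingleObj (Equiv.Perm (Fin n)) ⥤ A) ⥤ (Tilde Theta ⥤ A) where
  obj N :=
    { obj := fun a => indObj N a.of
      map := fun u => indMap N u
      map_id := fun _ => indMap_id
      map_comp := fun u v => indMap_comp u v }
  map φ :=
    { app := fun a => indApp φ a.of
      naturality := fun a b u => ind_hom_ext fun k => by
        rw [Category.assoc, Category.assoc, indApp_π]
        refine ((Category.assoc _ _ _).symm.trans (congrArg (· ≫ φ.app _) (indMap_π u k))).trans ?_
        exact ((congrArg (_ ≫ ·) (indMap_π u k)).trans (indApp_pre φ u k)).symm }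
  map_id N := by
    refine NatTrans.ext (funext fun a => ?_)
    change indApp (𝟙 N) a.of = 𝟙 (indObj N a.of)
    refine ind_hom_ext fun k => (indApp_π _ k).trans ?_
    exact (Category.comp_id _).trans (Category.id_comp _).symm
  map_comp φ ψ := by
    refine NatTrans.ext (funext fun a => ?_)
    change indApp (φ ≫ ψ) a.of = indApp φ a.of ≫ indApp ψ a.of
    refine ind_hom_ext fun k => (indApp_π _ k).trans ?_
    refine ((Category.assoc _ _ _).symm.trans ?_).trans (Category.assoc _ _ _).symm
    refine (congrArg (· ≫ ψ.app _) (indApp_π φ k)).symm.trans ?_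
    exact (Category.assoc _ _ _).trans (congrArg (_ ≫ ·) (indApp_π ψ k)).symm

variable (N) in
/-- The restriction to `Θ` of the functor attached to a representation. -/
noncomputable abbrev indTheta : Theta ⥤ A := Tilde.eta Theta ⋙ (indFunctor A n).obj N

/-- The inclusion of the summand indexed by an injection. -/
noncomputable def thetaι (j : (⟨n⟩ : Theta) ⟶ a) :
    N.obj (SingleObj.star _) ⟶ (indTheta N).obj a := indι N j

/-- The projection onto the summand indexed by an injection. -/
noncomputable def thetaπ (j : (⟨n⟩ : Theta) ⟶ a) :
    (indTheta N).obj a ⟶ N.obj (SingleObj.star _) := indπ N j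

theorem thetaπ_perm (σ : Equiv.Perm (Fin n)) (j : (⟨n⟩ : Theta) ⟶ a) :
    thetaπ (N := N) (perm σ ≫ j) = thetaπ j ≫ act N σ⁻¹ := indπ_perm N σ j

theorem thetaι_perm (σ : Equiv.Perm (Fin n)) (j : (⟨n⟩ : Theta) ⟶ a) :
    thetaι (N := N) (perm σ ≫ j) = act N σ ≫ thetaι j := indι_perm N σ j

theorem thetaι_π (j : (⟨n⟩ : Theta) ⟶ a) : thetaι j ≫ thetaπ j = 𝟙 (N.obj (SingleObj.star _)) :=
  indι_π N j

theorem thetaι_π_perm (σ : Equiv.Perm (Fin n)) (j : (⟨n⟩ : Theta) ⟶ a) :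
    thetaι j ≫ thetaπ (perm σ ≫ j) = act N σ⁻¹ := indι_π_perm N σ j

theorem thetaι_π_ne {j k : (⟨n⟩ : Theta) ⟶ a} (h : ¬ ∃ σ, perm σ ≫ j = k) :
    thetaι j ≫ thetaπ (N := N) k = 0 := indι_π_ne N h

theorem theta_hom_ext {X : A} {f g : X ⟶ (indTheta N).obj a}
    (h : ∀ j, f ≫ thetaπ j = g ≫ thetaπ j) : f = g := ind_hom_ext h

theorem theta_hom_ext' {X : A} {f g : (indTheta N).obj a ⟶ X}
    (h : ∀ j, thetaι j ≫ f = thetaι j ≫ g) : f = g := ind_hom_ext' h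

theorem map_thetaπ (f : a ⟶ b) (j : (⟨n⟩ : Theta) ⟶ a) :
    (indTheta N).map f ≫ thetaπ (j ≫ f) = thetaπ j :=
  (indMap_π _ _).trans (indPre_eq (((Tilde.eta Theta).map_comp _ _).symm))

theorem map_thetaπ_eq_zero (f : a ⟶ b) {k : (⟨n⟩ : Theta) ⟶ b} (h : ∀ j, j ≫ f ≠ k) :
    (indTheta N).map f ≫ thetaπ k = 0 :=
  (indMap_π _ _).trans (indPre_eq_zero fun ⟨j, hj⟩ =>
    h j (Tilde.eta_injective (((Tilde.eta Theta).map_comp _ _).trans hj)))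

theorem thetaι_map (f : a ⟶ b) (j : (⟨n⟩ : Theta) ⟶ a) :
    thetaι j ≫ (indTheta N).map f = thetaι (j ≫ f) := by
  refine theta_hom_ext fun k => ?_
  rw [Category.assoc]
  by_cases h : ∃ i, i ≫ f = k
  · obtain ⟨i, rfl⟩ := h
    rw [map_thetaπ]
    by_cases h' : ∃ σ, perm σ ≫ j = i
    · obtain ⟨σ, rfl⟩ := h'
      rw [thetaι_π_perm, Category.assoc, thetaι_π_perm]
    · rw [thetaι_π_ne h', thetaι_π_ne]
      rintro ⟨σ, hσ⟩
      refine h' ⟨σ, hom_ext fun l => fn_injective f ?_⟩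
      exact congrArg (fn · l) ((Category.assoc _ _ _).trans hσ)
  · rw [map_thetaπ_eq_zero f fun i hi => h ⟨i, hi⟩, comp_zero, thetaι_π_ne]
    rintro ⟨σ, hσ⟩
    exact h ⟨perm σ ≫ j, (Category.assoc _ _ _).trans hσ⟩

/-- The summand indexed by `j` is the image under `j` of a summand of the value at `n`, so it dies
in the cross-effect when `j` misses a point of `x`. -/
theorem thetaι_crossProj_eq_zero {x : Theta} {j : (⟨n⟩ : Theta) ⟶ x ⊗ b} {i : Fin x.card}
    (hi : ∀ l, fn j l ≠ inl x b i) : thetaι j ≫ crossProj (indTheta N) x b = 0 := by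
  have e := thetaι_map (N := N) j (𝟙 _)
  rw [Category.id_comp] at e
  rw [← e, Category.assoc, map_crossProj_eq_zero _ _ hi, comp_zero]

/-- By pigeonhole, an `n`-element subset cannot contain all `n + 1` marked points, so every summand
dies and this cross-effect is actually zero. -/
theorem stablyNull_crossEffect_indTheta :
    stablyNull Theta A ((crossEffectAt A ⟨n + 1⟩).obj (indTheta N)) := by
  refine stablyNull_of_isZero ((Functor.isZero_iff _).2 fun b => ?_)
  have h : crossProj (indTheta N) ⟨n + 1⟩ b = 0 := theta_hom_ext' fun j => by
    have hj : ∃ i : Fin (n + 1), ∀ l, fn j l ≠ inl ⟨n + 1⟩ b i := by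
      by_contra! h
      choose l hl using h
      have : Function.Injective l := fun i i' e =>
        inl_inj.1 ((hl i).symm.trans ((congrArg (fn j) e).trans (hl i')))
      simpa using Fintype.card_le_of_injective _ this
    obtain ⟨i, hi⟩ := hj
    rw [thetaι_crossProj_eq_zero hi, comp_zero]
  rw [IsZero.iff_id_eq_zero]
  exact crossEffects_hom_ext (by rw [h, zero_comp, zero_comp])

theorem polynomial_indTheta [IsGrothendieckAbelian.{w} A] :
    St.polynomial.{w} Theta A (n + 1) ((St.proj.{w} Theta A).obj (indTheta N)) :=
  (polynomial_iff_crossEffect.{w} _ _).2 stablyNull_crossEffect_indTheta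

end InducedFunctor


/-! ### The stable cross-effect recovers the representation -/

section StableCrossEffectOfInduced

open Theta

variable {A : Type u} [Category.{v} A] [Abelian A] {n : ℕ}

/-- The map from the cross-effect of the functor attached to a representation to the
representation. -/
noncomputable def crossTheta (N : SingleObj (Equiv.Perm (Fin n)) ⥤ A) (b : Theta) :
    (((crossEffects A).obj (indTheta N)).obj ⟨n⟩).obj b ⟶ N.obj (SingleObj.star _) :=
  crossProjDesc (indTheta N) (thetaπ (inlHom ⟨n⟩ b)) fun {s} f hf => by
    refine map_thetaπ_eq_zero _ fun j hj => ?_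
    obtain ⟨i, hi⟩ := exists_forall_ne f hf
    have h : fn (f ▷ b) (fn j i) = inl ⟨n⟩ b i := congrArg (fn · i) hj
    revert h
    generalize fn j i = k
    revert k
    refine sum_cases (fun k => ?_) fun k => ?_
    · rw [fn_whiskerRight_inl, inl_inj]
      exact hi k
    · rw [fn_whiskerRight_inr]
      exact inr_ne_inl

theorem crossProj_theta (N : SingleObj (Equiv.Perm (Fin n)) ⥤ A) (b : Theta) :
    crossProj (indTheta N) ⟨n⟩ b ≫ crossTheta N b = thetaπ (inlHom ⟨n⟩ b) :=
  cokernel.π_desc _ _ _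

theorem inlHom_whiskerLeft (a : Theta) {b c : Theta} (f : b ⟶ c) :
    inlHom a b ≫ a ◁ f = inlHom a c :=
  hom_ext fun i => by simp

theorem map_crossTheta (N : SingleObj (Equiv.Perm (Fin n)) ⥤ A) {b c : Theta} (f : b ⟶ c) :
    (((crossEffects A).obj (indTheta N)).obj ⟨n⟩).map f ≫ crossTheta N c = crossTheta N b :=
  crossEffects_hom_ext (by
    rw [← Category.assoc, crossProj_map_right, Category.assoc, crossProj_theta, crossProj_theta,
      ← inlHom_whiskerLeft ⟨n⟩ f, map_thetaπ])

theorem crossTheta_perm (N : SingleObj (Equiv.Perm (Fin n)) ⥤ A) (σ : Equiv.Perm (Fin n))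
    (b : Theta) : (((crossEffects A).obj (indTheta N)).map (perm σ)).app b ≫ crossTheta N b =
      crossTheta N b ≫ act N σ :=
  crossEffects_hom_ext (by
    have e : inlHom ⟨n⟩ b = (perm σ⁻¹ ≫ inlHom ⟨n⟩ b) ≫ perm σ ▷ b := by
      rw [Category.assoc, whiskerRight_inlHom, ← Category.assoc, perm_inv_comp, Category.id_comp]
    rw [← Category.assoc, crossProj_map_left, Category.assoc, crossProj_theta,
      ← Category.assoc, crossProj_theta]
    conv_lhs => rw [e]
    rw [map_thetaπ, thetaπ_perm, inv_inv])

theorem crossTheta_naturality {N N' : SingleObj (Equiv.Perm (Fin n)) ⥤ A} (φ : N ⟶ N')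
    (b : Theta) :
    (((crossEffects A).map (Functor.whiskerLeft (Tilde.eta Theta)
      ((indFunctor A n).map φ))).app ⟨n⟩).app b ≫ crossTheta N' b =
      crossTheta N b ≫ φ.app _ :=
  crossEffects_hom_ext (by
    rw [← Category.assoc, crossProj_app, Category.assoc, crossProj_theta,
      ← Category.assoc, crossProj_theta]
    exact indApp_π φ _)

/-- Only the summand of the subset `n` of `n ⊔ b` survives in the cross-effect: any other
`n`-element subset misses a point of `n`. So `crossTheta` is already invertible before
stabilization. -/
theorem thetaπ_ι_crossProj (N : SingleObj (Equiv.Perm (Fin n)) ⥤ A) (b : Theta) :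
    thetaπ (inlHom ⟨n⟩ b) ≫ thetaι (inlHom ⟨n⟩ b) ≫ crossProj (indTheta N) ⟨n⟩ b =
      crossProj (indTheta N) ⟨n⟩ b :=
  theta_hom_ext' fun j => by
    by_cases h : ∀ i, ∃ l, fn j l = inl ⟨n⟩ b i
    · obtain ⟨k, hk⟩ := exists_comp_eq (inlHom ⟨n⟩ b) j h
      obtain ⟨σ, rfl⟩ := exists_eq_perm k
      rw [← hk, thetaι_perm, reassoc_of% (thetaι_π_perm (N := N) σ j), ← Category.assoc (act N σ⁻¹),
        ← Category.assoc (act N σ⁻¹), act_inv_comp, Category.id_comp]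
    · push Not at h
      obtain ⟨i, hi⟩ := h
      rw [thetaι_crossProj_eq_zero hi, reassoc_of% (thetaι_π_ne (N := N) (j := j) (k := inlHom ⟨n⟩ b) _),
        zero_comp]
      rintro ⟨σ, hσ⟩
      exact hi _ (congrArg (fn · i) hσ)

variable [HasColimitsOfShape ℕ A]

/-- The stable cross-effect of the functor attached to a representation is the representation. -/
noncomputable def stableCrossTheta (N : SingleObj (Equiv.Perm (Fin n)) ⥤ A) :
    (stableValue A).obj (((crossEffects A).obj (indTheta N)).obj ⟨n⟩) ≅
      N.obj (SingleObj.star _) where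
  hom := stableValueDesc _ (crossTheta N) fun h => map_crossTheta N (std h)
  -- Since the cross-effect does not change with `b`, the inverse can be taken at the empty set.
  inv := thetaι (inlHom ⟨n⟩ ⟨0⟩) ≫ crossProj (indTheta N) ⟨n⟩ ⟨0⟩ ≫
    toStable (((crossEffects A).obj (indTheta N)).obj ⟨n⟩) ⟨0⟩
  hom_inv_id := stableValue_hom_ext fun b => crossEffects_hom_ext (by
    have h : (⟨0⟩ : Theta).card ≤ b.card := Nat.zero_le _
    rw [← Category.assoc (toStable _ b), toStable_desc, ← Category.assoc, crossProj_theta,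
      Category.comp_id, ← map_std_toStable _ h, ← Category.assoc (crossProj _ _ ⟨0⟩), crossProj_map_right,
      Category.assoc, ← Category.assoc (thetaι _), thetaι_map, inlHom_whiskerLeft,
      ← Category.assoc (thetaι _), ← Category.assoc, thetaπ_ι_crossProj])
  inv_hom_id := by
    rw [Category.assoc, Category.assoc, toStable_desc, crossProj_theta, thetaι_π]

theorem toStable_stableCrossTheta (N : SingleObj (Equiv.Perm (Fin n)) ⥤ A) (b : Theta) :
    toStable (((crossEffects A).obj (indTheta N)).obj ⟨n⟩) b ≫ (stableCrossTheta N).hom =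
      crossTheta N b :=
  toStable_desc _ _ (fun h => map_crossTheta N (std h)) b

variable (A n) in
/-- The stable cross-effect is a retraction of the functor attaching a functor on `Θ` to a
representation. -/
noncomputable def stableCrossEffectInd :
    (indFunctor A n ⋙ (Functor.whiskeringLeft _ _ A).obj (Tilde.eta Theta)) ⋙
      stableCrossEffect A n ≅ 𝟭 _ :=
  NatIso.ofComponents
    (fun N => NatIso.ofComponents (fun _ => stableCrossTheta N) fun σ => by
      change (stableValue A).map (((crossEffects A).obj (indTheta N)).map (perm σ)) ≫
        (stableCrossTheta N).hom = (stableCrossTheta N).hom ≫ act N σ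
      refine stableValue_hom_ext fun b => ?_
      rw [← Category.assoc, ← toStable_naturality, Category.assoc, toStable_stableCrossTheta,
        ← Category.assoc, toStable_stableCrossTheta, crossTheta_perm])
    (fun {N N'} φ => by
      refine NatTrans.ext (funext fun s => ?_)
      change (stableValue A).map (((crossEffects A).map (Functor.whiskerLeft (Tilde.eta Theta)
        ((indFunctor A n).map φ))).app ⟨n⟩) ≫ (stableCrossTheta N').hom =
          (stableCrossTheta N).hom ≫ φ.app _
      refine stableValue_hom_ext fun b => ?_
      rw [← Category.assoc, ← toStable_naturality, Category.assoc, toStable_stableCrossTheta,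
        ← Category.assoc, toStable_stableCrossTheta, crossTheta_naturality])

end StableCrossEffectOfInduced

/-! ### Collapsing a set along an embedded copy of `n` -/

namespace Theta

variable {n : ℕ}

open Classical in
/-- The map `S ⟶ n ⊔ S` which is the inverse of `j` on the image of `j` and the inclusion of `S`
elsewhere. -/
noncomputable def collapse {n S : Theta} (j : n ⟶ S) : S ⟶ n ⊗ S :=
  ofEmb
    { toFun := fun k => if h : ∃ i, fn j i = k then inl n S h.choose else inr n S k
      inj' := fun k l e => by
        dsimp only at e
        split_ifs at e with h h' h'
        · rw [← h.choose_spec, inl_inj.1 e, h'.choose_spec]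
        · exact absurd e inl_ne_inr
        · exact absurd e inr_ne_inl
        · exact inr_inj.1 e }

theorem fn_collapse {n S : Theta} (j : n ⟶ S) (i : Fin n.card) :
    fn (collapse j) (fn j i) = inl n S i := by
  have h : ∃ l, fn j l = fn j i := ⟨i, rfl⟩
  exact (dif_pos h).trans (congrArg _ (fn_injective j h.choose_spec))

theorem fn_collapse_of_ne {n S : Theta} {j : n ⟶ S} {k : Fin S.card} (h : ∀ i, fn j i ≠ k) :
    fn (collapse j) k = inr n S k :=
  dif_neg fun ⟨i, hi⟩ => h i hi

theorem hom_ext_of_collapse {n S X : Theta} (j : n ⟶ S) {f g : S ⟶ X}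
    (h₁ : ∀ i, fn f (fn j i) = fn g (fn j i))
    (h₂ : ∀ k, (∀ i, fn j i ≠ k) → fn f k = fn g k) : f = g :=
  hom_ext fun k => by
    by_cases h : ∃ i, fn j i = k
    · obtain ⟨i, rfl⟩ := h
      exact h₁ i
    · exact h₂ k fun i hi => h ⟨i, hi⟩

theorem collapse_perm {S : Theta} (σ : Equiv.Perm (Fin n)) (j : (⟨n⟩ : Theta) ⟶ S) :
    collapse (perm σ ≫ j) = collapse j ≫ perm σ⁻¹ ▷ S := by
  refine hom_ext_of_collapse (perm σ ≫ j) (fun i => ?_) fun k hk => ?_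
  · rw [fn_collapse, fn_comp, fn_comp, fn_collapse, fn_whiskerRight_inl]
    exact congrArg _ (σ.symm_apply_apply i).symm
  · have h : ∀ i, fn j i ≠ k := fun i hi =>
      hk (σ.symm i) ((congrArg (fn j) (σ.apply_symm_apply i)).trans hi)
    rw [fn_collapse_of_ne hk, fn_comp, fn_collapse_of_ne h, fn_whiskerRight_inr]

theorem comp_collapse {n S T : Theta} (j : n ⟶ S) (f : S ⟶ T) :
    f ≫ collapse (j ≫ f) = collapse j ≫ n ◁ f := by
  refine hom_ext_of_collapse j (fun i => ?_) fun k hk => ?_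
  · rw [fn_comp, fn_comp, fn_collapse, fn_whiskerLeft_inl]
    exact fn_collapse (j ≫ f) i
  · rw [fn_comp, fn_comp, fn_collapse_of_ne hk, fn_whiskerLeft_inr]
    exact fn_collapse_of_ne fun i hi => hk i (fn_injective f hi)

/-- Along the standard copy of `n`, collapsing only adds unused points to the second summand, and a
stable value does not see this in degree at most `n`. -/
theorem collapse_inlHom (n S : Theta) : collapse (inlHom n S) = n ◁ inrHom n S := by
  refine hom_ext_of_collapse (inlHom n S) (fun i => ?_) ?_
  · rw [fn_collapse, fn_inlHom, fn_whiskerLeft_inl]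
  · refine sum_cases (fun i hi => absurd rfl (hi i)) fun k hk => ?_
    rw [fn_collapse_of_ne hk, fn_whiskerLeft_inr, fn_inrHom]

/-- If `k` does not lift through `f`, then `f` misses some `k(i)`, the only point which collapses to
the point `i` of `n`. -/
theorem exists_comp_collapse_ne {n S T : Theta} (f : S ⟶ T) {k : n ⟶ T} (h : ∀ j, j ≫ f ≠ k) :
    ∃ i, ∀ l, fn (f ≫ collapse k) l ≠ inl n T i := by
  by_contra! h'
  obtain ⟨j, hj⟩ := exists_comp_eq k f fun i => by
    obtain ⟨l, hl⟩ := h' i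
    exact ⟨l, fn_injective (collapse k) (hl.trans (fn_collapse k i).symm)⟩
  exact h j hj

end Theta

/-! ### The comparison map from a functor to its induced functor -/

section Coefficients

open Theta

variable {A : Type u} [Category.{v} A] [Abelian A] {n : ℕ} [HasColimitsOfShape ℕ A]

variable (n) in
/-- The map from a value of `F` to its stable cross-effect given by an injection. -/
noncomputable def coeff (F : Theta ⥤ A) {S : Theta} (j : (⟨n⟩ : Theta) ⟶ S) :
    F.obj S ⟶ (stableValue A).obj (((crossEffects A).obj F).obj ⟨n⟩) :=
  F.map (collapse j) ≫ crossProj F ⟨n⟩ S ≫ toStable (((crossEffects A).obj F).obj ⟨n⟩) S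

theorem coeff_perm (F : Theta ⥤ A) {S : Theta} (σ : Equiv.Perm (Fin n)) (j : (⟨n⟩ : Theta) ⟶ S) :
    coeff n F (perm σ ≫ j) =
      coeff n F j ≫ (stableValue A).map (((crossEffects A).obj F).map (perm σ⁻¹)) := by
  rw [coeff, coeff, Category.assoc, Category.assoc, ← toStable_naturality,
    ← Category.assoc (crossProj F ⟨n⟩ S), crossProj_map_left, collapse_perm, F.map_comp,
    Category.assoc, Category.assoc]

variable [IsGrothendieckAbelian.{w} A]

/-- Collapsing commutes with `f`, which leaves the effect of `f` on the cross-effect. The stable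
value ignores it for an arbitrary injection only thanks to `hF`: this is where the bound on the
degree enters. -/
theorem map_coeff {F : Theta ⥤ A}
    (hF : ∀ x, stablyNull Theta A ((difference A x).obj ((crossEffectAt A ⟨n⟩).obj F)))
    {S T : Theta} (f : S ⟶ T) (j : (⟨n⟩ : Theta) ⟶ S) :
    F.map f ≫ coeff n F (j ≫ f) = coeff n F j := by
  have e : (((crossEffects A).obj F).obj ⟨n⟩).map f ≫
      toStable (((crossEffects A).obj F).obj ⟨n⟩) T = toStable _ S := map_toStable.{w} hF f
  rw [coeff, coeff, ← Category.assoc, ← F.map_comp, comp_collapse, F.map_comp, Category.assoc,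
    ← Category.assoc (F.map (_ ◁ f)), ← crossProj_map_right, Category.assoc, e]

-- This matches the vanishing coordinates of the induced functor: the composite of `f` with the
-- collapse along `k` misses a point of `n`.
omit [IsGrothendieckAbelian.{w} A] in
theorem map_coeff_eq_zero (F : Theta ⥤ A) {S T : Theta} (f : S ⟶ T) {k : (⟨n⟩ : Theta) ⟶ T}
    (h : ∀ j, j ≫ f ≠ k) : F.map f ≫ coeff n F k = 0 := by
  obtain ⟨i, hi⟩ := exists_comp_collapse_ne f h
  rw [coeff, ← Category.assoc, ← F.map_comp, ← Category.assoc, map_crossProj_eq_zero F _ hi,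
    zero_comp]

omit [IsGrothendieckAbelian.{w} A] in
theorem coeff_naturality {F G : Theta ⥤ A} (φ : F ⟶ G) {S : Theta} (j : (⟨n⟩ : Theta) ⟶ S) :
    φ.app S ≫ coeff n G j = coeff n F j ≫
      (stableValue A).map (((crossEffects A).map φ).app ⟨n⟩) := by
  rw [coeff, coeff, Category.assoc, Category.assoc, ← toStable_naturality,
    ← Category.assoc (crossProj F ⟨n⟩ S), crossProj_app, ← Category.assoc,
    ← φ.naturality, Category.assoc, Category.assoc]

variable (n) in
/-- The map `coeff`, as a map to the underlying object of a representation. -/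
noncomputable def coeffRep (F : Theta ⥤ A) {S : Theta} (j : (⟨n⟩ : Theta) ⟶ S) :
    F.obj S ⟶ ((stableCrossEffect A n).obj F).obj (SingleObj.star _) := coeff n F j

omit [IsGrothendieckAbelian.{w} A] in
theorem coeffRep_perm (F : Theta ⥤ A) {S : Theta} (σ : Equiv.Perm (Fin n))
    (j : (⟨n⟩ : Theta) ⟶ S) :
    coeffRep n F (perm σ ≫ j) = coeffRep n F j ≫ act ((stableCrossEffect A n).obj F) σ⁻¹ :=
  coeff_perm F σ j

theorem map_coeffRep {F : Theta ⥤ A}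
    (hF : ∀ x, stablyNull Theta A ((difference A x).obj ((crossEffectAt A ⟨n⟩).obj F)))
    {S T : Theta} (f : S ⟶ T) (j : (⟨n⟩ : Theta) ⟶ S) :
    F.map f ≫ coeffRep n F (j ≫ f) = coeffRep n F j := map_coeff.{w} hF f j

omit [IsGrothendieckAbelian.{w} A] in
theorem map_coeffRep_eq_zero (F : Theta ⥤ A) {S T : Theta} (f : S ⟶ T) {k : (⟨n⟩ : Theta) ⟶ T}
    (h : ∀ j, j ≫ f ≠ k) : F.map f ≫ coeffRep n F k = 0 := map_coeff_eq_zero F f h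

omit [IsGrothendieckAbelian.{w} A] in
theorem coeffRep_naturality {F G : Theta ⥤ A} (φ : F ⟶ G) {S : Theta} (j : (⟨n⟩ : Theta) ⟶ S) :
    φ.app S ≫ coeffRep n G j = coeffRep n F j ≫ ((stableCrossEffect A n).map φ).app _ :=
  coeff_naturality φ j

omit [IsGrothendieckAbelian.{w} A] in
/-- The map from a functor to the functor attached to its stable cross-effect, at an object. -/
noncomputable def coeffsApp (F : Theta ⥤ A) (S : Theta) :
    F.obj S ⟶ (indTheta ((stableCrossEffect A n).obj F)).obj S :=
  indLift (coeffRep n F) (coeffRep_perm F)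

omit [IsGrothendieckAbelian.{w} A] in
theorem coeffsApp_π (F : Theta ⥤ A) {S : Theta} (j : (⟨n⟩ : Theta) ⟶ S) :
    coeffsApp F S ≫ thetaπ j = coeffRep n F j :=
  indLift_π _ (coeffRep_perm F) j

/-- The map from a functor to the functor attached to its stable cross-effect, if the difference
functors of the cross-effect are stably null. -/
noncomputable def coeffs {F : Theta ⥤ A}
    (hF : ∀ x, stablyNull Theta A ((difference A x).obj ((crossEffectAt A ⟨n⟩).obj F))) :
    F ⟶ indTheta ((stableCrossEffect A n).obj F) where
  app S := coeffsApp F S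
  naturality S T f := theta_hom_ext fun k => by
    rw [Category.assoc, coeffsApp_π, Category.assoc]
    by_cases h : ∃ j, j ≫ f = k
    · obtain ⟨j, rfl⟩ := h
      rw [map_coeffRep.{w} hF, map_thetaπ, coeffsApp_π]
    · rw [map_coeffRep_eq_zero F f fun j hj => h ⟨j, hj⟩, map_thetaπ_eq_zero f fun j hj => h ⟨j, hj⟩,
        comp_zero]

omit [IsGrothendieckAbelian.{w} A] in
theorem coeffsApp_naturality {F G : Theta ⥤ A} (φ : F ⟶ G) (S : Theta) :
    φ.app S ≫ coeffsApp (n := n) G S = coeffsApp F S ≫ (Functor.whiskerLeft (Tilde.eta Theta)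
      ((indFunctor A n).map ((stableCrossEffect A n).map φ))).app S :=
  theta_hom_ext fun j => by
    have e : (Functor.whiskerLeft (Tilde.eta Theta) ((indFunctor A n).map
        ((stableCrossEffect A n).map φ))).app S ≫ thetaπ j = thetaπ j ≫
          ((stableCrossEffect A n).map φ).app _ := indApp_π ((stableCrossEffect A n).map φ) j
    rw [Category.assoc, coeffsApp_π, coeffRep_naturality, Category.assoc, e, ← Category.assoc,
      coeffsApp_π]

/-- After `crossTheta` only the coefficient at the standard copy of `n` remains. Its collapse is
induced by an inclusion into the second summand, which `map_toStable` absorbs, so what is left is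
the canonical map to the stable value. -/
theorem coeffs_stableCrossEffect {F : Theta ⥤ A}
    (hF : ∀ x, stablyNull Theta A ((difference A x).obj ((crossEffectAt A ⟨n⟩).obj F))) :
    (stableCrossEffect A n).map (coeffs.{w} hF) ≫
      (stableCrossEffectInd A n).hom.app ((stableCrossEffect A n).obj F) = 𝟙 _ := by
  refine NatTrans.ext (funext fun s => ?_)
  change (stableValue A).map (((crossEffects A).map (coeffs.{w} hF)).app ⟨n⟩) ≫
    (stableCrossTheta ((stableCrossEffect A n).obj F)).hom = 𝟙 _
  refine stableValue_hom_ext fun b => crossEffects_hom_ext ?_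
  have e : (((crossEffects A).obj F).obj ⟨n⟩).map (inrHom ⟨n⟩ b) ≫
      toStable (((crossEffects A).obj F).obj ⟨n⟩) _ = toStable _ b := map_toStable.{w} hF _
  have e' : (coeffs.{w} hF).app (⟨n⟩ ⊗ b) ≫ thetaπ (inlHom ⟨n⟩ b) = coeff n F (inlHom ⟨n⟩ b) :=
    coeffsApp_π F _
  rw [← Category.assoc (toStable _ b), ← toStable_naturality, Category.assoc,
    toStable_stableCrossTheta, ← Category.assoc, crossProj_app, Category.assoc, crossProj_theta,
    e', coeff, collapse_inlHom, ← Category.assoc, ← crossProj_map_right, Category.assoc, e]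
  exact congrArg (_ ≫ ·) (Category.comp_id _).symm

end Coefficients


/-! ### Restriction from `M̃` to `M` -/

section RestrictionFromTilde

variable {M : Type} [SmallCategory M] [MonoidalCategory M] [SymmetricCategory M]
variable (A : Type u) [Category.{v} A]

/-- The restriction of functors along `M ⥤ M̃`. -/
abbrev restrict : (Tilde M ⥤ A) ⥤ (M ⥤ A) :=
  (Functor.whiskeringLeft M (Tilde M) A).obj (Tilde.eta M)

variable {A}

/-- Restriction commutes with translations. -/
def translationRestrict (x : M) (F : Tilde M ⥤ A) :
    (restrict A).obj ((translation A (⟨x⟩ : Tilde M)).obj F) ≅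
      (translation A x).obj ((restrict A).obj F) :=
  NatIso.ofComponents (fun m => Iso.refl (F.obj ⟨x ⊗ m⟩)) fun {m m'} f => by
    refine (Category.comp_id _).trans (Eq.trans ?_ (Category.id_comp _).symm)
    exact congrArg F.map (Tilde.eta_whiskerLeft ⟨x⟩ f)

variable [Abelian A] [UnitInitial M]

theorem eta_unitTo (x m : M) :
    (unitTo (⟨x⟩ : Tilde M)).app ⟨m⟩ = (Tilde.eta M).map ((unitTo x).app m) := by
  have h : fromUnit (⟨x⟩ : Tilde M) = (Tilde.eta M).map (fromUnit x) := fromUnit_unique _ _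
  have h' : (λ_ (⟨m⟩ : Tilde M)).inv = (Tilde.eta M).map (λ_ m).inv := rfl
  change (λ_ (⟨m⟩ : Tilde M)).inv ≫ fromUnit (⟨x⟩ : Tilde M) ▷ (⟨m⟩ : Tilde M) = _
  rw [h, h']
  refine (congrArg ((Tilde.eta M).map (λ_ m).inv ≫ ·)
    (Tilde.eta_whiskerRight (fromUnit x) (⟨m⟩ : Tilde M))).trans ?_
  exact ((Tilde.eta M).map_comp _ _).symm

omit [Abelian A] in
theorem restrict_iota (x : M) (F : Tilde M ⥤ A) :
    (restrict A).map ((iota A (⟨x⟩ : Tilde M)).app F) ≫ (translationRestrict x F).hom =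
      (iota A x).app ((restrict A).obj F) := by
  ext m
  refine (Category.comp_id _).trans ?_
  exact congrArg F.map (eta_unitTo x m)

/-- Restriction commutes with the difference functors. -/
noncomputable def differenceRestrict (x : M) (F : Tilde M ⥤ A) :
    (restrict A).obj ((difference A (⟨x⟩ : Tilde M)).obj F) ≅
      (difference A x).obj ((restrict A).obj F) :=
  PreservesCokernel.iso (restrict A) ((iota A (⟨x⟩ : Tilde M)).app F) ≪≫
    cokernel.mapIso ((restrict A).map ((iota A (⟨x⟩ : Tilde M)).app F))
      ((iota A x).app ((restrict A).obj F)) (Iso.refl _) (translationRestrict x F)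
      ((restrict_iota x F).trans (Category.id_comp _).symm)

theorem nonempty_iterDifferenceRestrict (g : M) (d : ℕ) (F : Tilde M ⥤ A) :
    Nonempty ((restrict A).obj ((iterDifference A (⟨g⟩ : Tilde M) d).obj F) ≅
      (iterDifference A g d).obj ((restrict A).obj F)) := by
  induction d generalizing F with
  | zero => exact ⟨Iso.refl _⟩
  | succ d ih =>
    obtain ⟨e⟩ := ih ((difference A (⟨g⟩ : Tilde M)).obj F)
    exact ⟨e ≪≫ (iterDifference A g d).mapIso (differenceRestrict g F)⟩

-- In `Tilde M` every `x` maps to the unit, with all of `x` as complement, and this splits `0 ⟶ x`.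
omit [Abelian A] in
theorem isSplitMono_unitTo_tilde (x m : Tilde M) : IsSplitMono ((unitTo x).app m) := by
  let r : x ⟶ 𝟙_ (Tilde M) := Tilde.mk (b := ⟨𝟙_ M⟩) x.of (λ_ x.of).inv
  refine ⟨⟨⟨r ▷ m ≫ (λ_ m).hom, ?_⟩⟩⟩
  have h : fromUnit x ≫ r = 𝟙 _ := fromUnit_unique _ _
  change ((λ_ m).inv ≫ fromUnit x ▷ m) ≫ r ▷ m ≫ (λ_ m).hom = 𝟙 m
  rw [Category.assoc, ← comp_whiskerRight_assoc, h, id_whiskerRight, Category.id_comp,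
    Iso.inv_hom_id]

/-- All the maps `i_x` are monomorphisms, so the kernels `κ_x(F)` vanish: over `Tilde M` the stable
category divides out only zero functors. -/
theorem isZero_of_stablyNull_tilde {F : Tilde M ⥤ A} (hF : stablyNull (Tilde M) A F) :
    IsZero F := by
  refine isZero_of_stablyNull (fun x => ?_) hF
  have : ∀ m, Mono (((iota A x).app F).app m) := fun m => by
    have := isSplitMono_unitTo_tilde x m
    exact inferInstanceAs (Mono (F.map ((unitTo x).app m)))
  exact NatTrans.mono_of_mono_app _

theorem isZero_of_stablyNull_restrict {F : Tilde M ⥤ A}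
    (hF : stablyNull M A ((restrict A).obj F)) : IsZero F := by
  have h : IsZero ((restrict A).obj F) := isZero_of_stablyNull (fun x => by
    have : ∀ m, Mono (((iota A x).app ((restrict A).obj F)).app m) := fun m => by
      have := isSplitMono_unitTo_tilde (⟨x⟩ : Tilde M) ⟨m⟩
      have h : Mono (F.map ((unitTo (⟨x⟩ : Tilde M)).app ⟨m⟩)) := inferInstance
      rw [congrArg F.map (eta_unitTo x m)] at h
      exact h
    exact NatTrans.mono_of_mono_app _) hF
  exact (Functor.isZero_iff F).2 fun a => (Functor.isZero_iff _).1 h a.of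

theorem stablyNull_restrict_iff (F : Tilde M ⥤ A) :
    stablyNull M A ((restrict A).obj F) ↔ stablyNull (Tilde M) A F :=
  ⟨fun h => stablyNull_of_isZero (isZero_of_stablyNull_restrict h), fun h =>
    stablyNull_of_isZero ((restrict A).map_isZero (isZero_of_stablyNull_tilde h))⟩

omit [UnitInitial M] in
theorem IsGenerator.tilde {g : M} (hg : IsGenerator g) :
    IsGenerator (⟨g⟩ : Tilde M) :=
  fun P h₀ h ⟨x⟩ => hg (fun x => P ⟨x⟩) h₀ (fun x hx => h ⟨x⟩ hx) x

/-- Both degrees are read off from iterated differences along the same generator, and these commute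
with restriction. -/
theorem polynomial_restrict_iff [IsGrothendieckAbelian.{w} A] {g : M} (hg : IsGenerator g) (d : ℕ)
    (F : Tilde M ⥤ A) :
    St.polynomial.{w} M A d ((St.proj.{w} M A).obj ((restrict A).obj F)) ↔
      St.polynomial.{w} (Tilde M) A d ((St.proj.{w} (Tilde M) A).obj F) := by
  rw [St.polynomial_proj_iff.{w} hg, St.polynomial_proj_iff.{w} hg.tilde,
    ← stablyNull_restrict_iff]
  obtain ⟨e⟩ := nonempty_iterDifferenceRestrict g d F
  exact ((stablyNull M A).prop_iff_of_iso e).symm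

end RestrictionFromTilde

/-! ### Retractions in `Θ̃` -/

namespace Tilde

open Theta

/-- The morphism of `Θ̃` which is a retraction of the inclusion of `b` in `b ⊔ t`. -/
def retract (b t : Theta) : (⟨b ⊗ t⟩ : Tilde Theta) ⟶ ⟨b⟩ := mk t (𝟙 (b ⊗ t))

theorem eta_comp_retract {a b t : Theta} (f : a ⟶ b ⊗ t) :
    (eta Theta).map f ≫ retract b t = mk (a := ⟨a⟩) (b := ⟨b⟩) t f :=
  (eta_comp_mk (c := ⟨b⟩) f (𝟙 (b ⊗ t))).trans (congrArg (mk t) (Category.comp_id f))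

theorem retract_comp_eta {b c : Theta} (t : Theta) (f : b ⟶ c) :
    retract b t ≫ (eta Theta).map f = mk (a := ⟨b ⊗ t⟩) (b := ⟨c⟩) t (f ▷ t) :=
  (mk_comp_eta (a := ⟨b ⊗ t⟩) (𝟙 (b ⊗ t)) f).trans (congrArg (mk t) (Category.id_comp (f ▷ t)))

theorem eta_map_eq_mk {a b : Theta} (t : Theta) (f : a ⟶ b) :
    (eta Theta).map f = mk (a := ⟨a⟩) (b := ⟨b⟩) t (f ≫ inlHom b t) :=
  (eq_eta_of_hits fun i => hits_mk.2 (by rw [fn_comp, fn_inlHom])).symm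

theorem eta_inlHom_retract (b t : Theta) :
    (eta Theta).map (inlHom b t) ≫ retract b t = 𝟙 (⟨b⟩ : Tilde Theta) := by
  rw [eta_comp_retract, ← Category.id_comp (inlHom b t), ← eta_map_eq_mk]
  exact (eta Theta).map_id b

theorem whiskerLeft_retract (a b t : Theta) :
    whiskerLeft (C := Tilde Theta) ⟨a⟩ (retract b t) =
      mk (a := ⟨a ⊗ b ⊗ t⟩) (b := ⟨a ⊗ b⟩) t (α_ a b t).inv := by
  have e : ∀ (a : Theta) i, fn (ρ_ a).inv i = inl a (𝟙_ Theta) i := fun a i =>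
    fn_injective (ρ_ a).hom (by rw [← fn_comp, Iso.inv_hom_id, fn_rightUnitor, fn_id])
  refine mk_eq (a := ⟨a ⊗ b ⊗ t⟩) (b := ⟨a ⊗ b⟩)
    (((ρ_ a).inv ⊗ₘ 𝟙 (b ⊗ t)) ≫ tensorμ a (𝟙_ Theta) b t) (λ_ t).hom _ (Theta.hom_ext ?_)
  refine sum_cases (fun i => ?_) (sum_cases (fun i => ?_) fun i => ?_) <;>
    simp [tensorμ, e, -card_tensor, -Category.assoc]

/-- Discarding `t` commutes with collapsing along `j` because the image of `j` lies in `b`. -/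
theorem retract_comp_collapse {n b : Theta} (t : Theta) (j : n ⟶ b) :
    retract b t ≫ (eta Theta).map (collapse j) =
      (eta Theta).map (collapse (j ≫ inlHom b t)) ≫
        whiskerLeft (C := Tilde Theta) ⟨n⟩ (retract b t) := by
  rw [retract_comp_eta, whiskerLeft_retract]
  refine Eq.trans ?_ (eta_comp_mk (c := ⟨n ⊗ b⟩) (collapse (j ≫ inlHom b t)) (α_ n b t).inv).symm
  refine congrArg (mk t) (hom_ext_of_collapse (j ≫ inlHom b t) (fun i => ?_) ?_)
  · rw [fn_comp (collapse _), fn_collapse, fn_comp, fn_inlHom]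
    rw [fn_whiskerRight_inl, fn_collapse, fn_assocInv_inl]
  · refine sum_cases (fun k hk => ?_) fun k hk => ?_
    · have h : ∀ i, fn j i ≠ k := fun i hi => hk i (by rw [fn_comp, hi, fn_inlHom])
      rw [fn_whiskerRight_inl, fn_collapse_of_ne h, fn_comp, fn_collapse_of_ne hk,
        fn_assocInv_inr_inl]
    · rw [fn_whiskerRight_inr, fn_comp, fn_collapse_of_ne hk, fn_assocInv_inr_inr]

end Tilde


/-! ### Naturality of the comparison map over `Θ̃` -/

section CoefficientsTilde

open Theta

variable {A : Type u} [Category.{v} A]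

/-- The map induced by the retraction of `b ⊔ t` onto `b`. -/
def mapRetract (F : Tilde Theta ⥤ A) (b t : Theta) :
    ((restrict A).obj F).obj (b ⊗ t) ⟶ ((restrict A).obj F).obj b :=
  F.map (Tilde.retract b t)

/-- The map induced by the retraction of `a ⊔ b ⊔ t` onto `a ⊔ b`. -/
def mapWhiskerRetract (F : Tilde Theta ⥤ A) (a b t : Theta) :
    ((restrict A).obj F).obj (a ⊗ b ⊗ t) ⟶ ((restrict A).obj F).obj (a ⊗ b) :=
  F.map (whiskerLeft (C := Tilde Theta) ⟨a⟩ (Tilde.retract b t))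

theorem map_whiskerRight_retract (F : Tilde Theta ⥤ A) {s a : Theta} (f : s ⟶ a) (b t : Theta) :
    ((restrict A).obj F).map (f ▷ (b ⊗ t)) ≫ mapWhiskerRetract F a b t =
      mapWhiskerRetract F s b t ≫ ((restrict A).obj F).map (f ▷ b) := by
  have e := whisker_exchange (C := Tilde Theta) ((Tilde.eta Theta).map f) (Tilde.retract b t)
  refine (F.map_comp _ _).symm.trans (Eq.trans ?_ (F.map_comp _ _))
  refine congrArg F.map ?_
  refine (congrArg (· ≫ whiskerLeft (C := Tilde Theta) ⟨a⟩ (Tilde.retract b t))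
    (Tilde.eta_whiskerRight f ⟨b ⊗ t⟩)).symm.trans (e.symm.trans ?_)
  exact congrArg (whiskerLeft (C := Tilde Theta) ⟨s⟩ (Tilde.retract b t) ≫ ·)
    (Tilde.eta_whiskerRight f ⟨b⟩)

theorem map_inlHom_retract (F : Tilde Theta ⥤ A) (a b t : Theta) :
    ((restrict A).obj F).map (a ◁ inlHom b t) ≫ mapWhiskerRetract F a b t = 𝟙 _ := by
  refine (F.map_comp _ _).symm.trans (Eq.trans ?_ (F.map_id _))
  refine congrArg F.map ?_
  refine (congrArg (· ≫ whiskerLeft (C := Tilde Theta) ⟨a⟩ (Tilde.retract b t))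
    (Tilde.eta_whiskerLeft ⟨a⟩ (inlHom b t))).symm.trans ?_
  refine (whiskerLeft_comp (C := Tilde Theta) ⟨a⟩ _ _).symm.trans ?_
  exact (congrArg (whiskerLeft (C := Tilde Theta) ⟨a⟩) (Tilde.eta_inlHom_retract b t)).trans
    (whiskerLeft_id (C := Tilde Theta) ⟨a⟩ ⟨b⟩)

theorem mapRetract_collapse (F : Tilde Theta ⥤ A) {a b : Theta} (t : Theta) (j : a ⟶ b) :
    mapRetract F b t ≫ ((restrict A).obj F).map (collapse j) =
      ((restrict A).obj F).map (collapse (j ≫ inlHom b t)) ≫ mapWhiskerRetract F a b t :=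
  (F.map_comp _ _).symm.trans
    ((congrArg F.map (Tilde.retract_comp_collapse t j)).trans (F.map_comp _ _))

variable [Abelian A]

/-- The map of cross-effects induced by the retraction of `b ⊔ t` onto `b`. -/
noncomputable def crossRetract (F : Tilde Theta ⥤ A) (a b t : Theta) :
    (((crossEffects A).obj ((restrict A).obj F)).obj a).obj (b ⊗ t) ⟶
      (((crossEffects A).obj ((restrict A).obj F)).obj a).obj b :=
  crossProjDesc ((restrict A).obj F)
    (mapWhiskerRetract F a b t ≫ crossProj ((restrict A).obj F) a b) fun {s} f hf => by
      obtain ⟨i, hi⟩ := exists_forall_ne f hf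
      rw [← Category.assoc, map_whiskerRight_retract, Category.assoc,
        map_crossProj_eq_zero _ (f ▷ b) (j := i), comp_zero]
      exact sum_cases (fun k => by simpa [-card_tensor] using hi k) fun k => by
        simp [-card_tensor]

theorem crossProj_retract (F : Tilde Theta ⥤ A) (a b t : Theta) :
    crossProj ((restrict A).obj F) a (b ⊗ t) ≫ crossRetract F a b t =
      mapWhiskerRetract F a b t ≫ crossProj ((restrict A).obj F) a b :=
  cokernel.π_desc _ _ _

theorem map_inlHom_crossRetract (F : Tilde Theta ⥤ A) (a b t : Theta) :
    (((crossEffects A).obj ((restrict A).obj F)).obj a).map (inlHom b t) ≫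
      crossRetract F a b t = 𝟙 _ :=
  crossEffects_hom_ext (by
    rw [← Category.assoc, crossProj_map_right, Category.assoc, crossProj_retract,
      ← Category.assoc, map_inlHom_retract, Category.id_comp, Category.comp_id])

/-- If `δ_t(G)` is zero then `G` sends the inclusions `b ⟶ b ⊔ t` to epimorphisms. -/
theorem epi_map_inlHom {G : Theta ⥤ A} {t : Theta} (h : IsZero ((difference A t).obj G))
    (b : Theta) : Epi (G.map (inlHom b t)) := by
  have : Epi ((iota A t).app G) := Preadditive.epi_of_isZero_cokernel _ h
  have : Epi (G.map (inrHom t b)) := inferInstanceAs (Epi (((iota A t).app G).app b))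
  rw [← inrHom_braiding, G.map_comp]
  infer_instance

/-- Cross-effects are iterated differences, so this functor is itself restricted from `Θ̃`, where
stable nullity forces vanishing. -/
theorem isZero_difference_crossEffect [IsGrothendieckAbelian.{w} A] {F : Tilde Theta ⥤ A} {n : ℕ} {t : Theta}
    (hF : stablyNull Theta A
      ((difference A t).obj ((crossEffectAt A ⟨n⟩).obj ((restrict A).obj F)))) :
    IsZero ((difference A t).obj ((crossEffectAt A ⟨n⟩).obj ((restrict A).obj F))) := by
  obtain ⟨e⟩ := nonempty_iterDifferenceRestrict pt n F
  let i := (difference A t).mapIso ((crossEffectIso A n).app ((restrict A).obj F) ≪≫ e.symm) ≪≫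
    (differenceRestrict t _).symm
  have h := isZero_of_stablyNull_restrict ((stablyNull Theta A).prop_of_iso i hF)
  exact ((restrict A).map_isZero h).of_iso i

variable [HasColimitsOfShape ℕ A]

/-- The inclusion of `b` into `b ⊔ t` induces an epimorphism on the cross-effect, as `δ_t` vanishes
there; after precomposition with it, both sides are the canonical map to the stable value. -/
theorem crossRetract_toStable [IsGrothendieckAbelian.{w} A] {F : Tilde Theta ⥤ A} {n : ℕ} (hF : ∀ t, stablyNull Theta A
      ((difference A t).obj ((crossEffectAt A ⟨n⟩).obj ((restrict A).obj F)))) (b t : Theta) :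
    crossRetract F ⟨n⟩ b t ≫ toStable (((crossEffects A).obj ((restrict A).obj F)).obj ⟨n⟩) b =
      toStable (((crossEffects A).obj ((restrict A).obj F)).obj ⟨n⟩) (b ⊗ t) := by
  have : Epi ((((crossEffects A).obj ((restrict A).obj F)).obj ⟨n⟩).map (inlHom b t)) :=
    epi_map_inlHom (isZero_difference_crossEffect.{w} (hF t)) b
  have e : (((crossEffects A).obj ((restrict A).obj F)).obj ⟨n⟩).map (inlHom b t) ≫
      toStable (((crossEffects A).obj ((restrict A).obj F)).obj ⟨n⟩) (b ⊗ t) = toStable _ b :=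
    map_std_toStable _ _
  rw [← cancel_epi ((((crossEffects A).obj ((restrict A).obj F)).obj ⟨n⟩).map (inlHom b t)),
    ← Category.assoc, map_inlHom_crossRetract, Category.id_comp, e]

theorem mapRetract_coeffRep [IsGrothendieckAbelian.{w} A] {F : Tilde Theta ⥤ A} {n : ℕ} (hF : ∀ t, stablyNull Theta A
      ((difference A t).obj ((crossEffectAt A ⟨n⟩).obj ((restrict A).obj F)))) {b : Theta}
    (t : Theta) (j : (⟨n⟩ : Theta) ⟶ b) :
    mapRetract F b t ≫ coeffRep n ((restrict A).obj F) j =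
      coeffRep n ((restrict A).obj F) (j ≫ inlHom b t) := by
  change mapRetract F b t ≫ coeff n ((restrict A).obj F) j =
    coeff n ((restrict A).obj F) (j ≫ inlHom b t)
  rw [coeff, coeff, ← Category.assoc, mapRetract_collapse, Category.assoc,
    ← Category.assoc (mapWhiskerRetract F ⟨n⟩ b t), ← crossProj_retract, Category.assoc,
    crossRetract_toStable.{w} hF]

omit [HasColimitsOfShape ℕ A] in
theorem mapRetract_thetaπ {n : ℕ} (N : SingleObj (Equiv.Perm (Fin n)) ⥤ A) {b : Theta}
    (t : Theta) (j : (⟨n⟩ : Theta) ⟶ b) :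
    mapRetract ((indFunctor A n).obj N) b t ≫ thetaπ j = thetaπ (j ≫ inlHom b t) :=
  (indMap_π _ _).trans (indPre_eq ((Tilde.eta_comp_retract _).trans
    (Tilde.eta_map_eq_mk t j).symm))

theorem mapRetract_coeffsApp [IsGrothendieckAbelian.{w} A] {F : Tilde Theta ⥤ A} {n : ℕ} (hF : ∀ t, stablyNull Theta A
      ((difference A t).obj ((crossEffectAt A ⟨n⟩).obj ((restrict A).obj F)))) (b t : Theta) :
    mapRetract F b t ≫ coeffsApp (n := n) ((restrict A).obj F) b =
      coeffsApp ((restrict A).obj F) (b ⊗ t) ≫ mapRetract ((indFunctor A n).obj _) b t :=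
  theta_hom_ext fun j => by
    rw [Category.assoc, coeffsApp_π, Category.assoc, mapRetract_thetaπ, coeffsApp_π,
      mapRetract_coeffRep.{w} hF]

variable [IsGrothendieckAbelian.{w} A]

/-- The map from a functor on `Θ̃` to the functor attached to its stable cross-effect. -/
noncomputable def coeffsTilde {F : Tilde Theta ⥤ A} {n : ℕ} (hF : ∀ t, stablyNull Theta A
      ((difference A t).obj ((crossEffectAt A ⟨n⟩).obj ((restrict A).obj F)))) :
    F ⟶ (indFunctor A n).obj ((stableCrossEffect A n).obj ((restrict A).obj F)) where
  app S := coeffsApp ((restrict A).obj F) S.of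
  naturality := by
    rintro ⟨a⟩ ⟨b⟩ u
    obtain ⟨t, f, rfl⟩ := Tilde.mk_surj u
    have h := (coeffs.{w} hF).naturality f
    have h' := mapRetract_coeffsApp.{w} hF b t
    -- Every morphism of `Θ̃` is an injection followed by a retraction, so naturality splits into
    -- `h` and `h'`.
    have e : ∀ H : Tilde Theta ⥤ A, H.map (Tilde.mk (a := ⟨a⟩) (b := ⟨b⟩) t f) =
        ((restrict A).obj H).map f ≫ mapRetract H b t := fun H =>
      (congrArg H.map (Tilde.eta_comp_retract f).symm).trans (H.map_comp _ _)
    refine (congrArg (· ≫ coeffsApp ((restrict A).obj F) b) (e F)).trans ?_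
    refine Eq.trans ?_ (congrArg (coeffsApp ((restrict A).obj F) a ≫ ·) (e _)).symm
    refine (Category.assoc _ _ _).trans ((congrArg (_ ≫ ·) h').trans ?_)
    refine (Category.assoc _ _ _).symm.trans ((congrArg (· ≫ mapRetract _ b t) h).trans ?_)
    exact Category.assoc _ _ _

theorem coeffsTilde_naturality {F G : Tilde Theta ⥤ A} (f : F ⟶ G) {n : ℕ}
    (hF : ∀ t, stablyNull Theta A
      ((difference A t).obj ((crossEffectAt A ⟨n⟩).obj ((restrict A).obj F))))
    (hG : ∀ t, stablyNull Theta A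
      ((difference A t).obj ((crossEffectAt A ⟨n⟩).obj ((restrict A).obj G)))) :
    f ≫ coeffsTilde.{w} hG = coeffsTilde.{w} hF ≫
      (indFunctor A n).map ((stableCrossEffect A n).map ((restrict A).map f)) :=
  NatTrans.ext (funext fun S => coeffsApp_naturality ((restrict A).map f) S.of)

theorem coeffsTilde_stableCrossEffect {F : Tilde Theta ⥤ A} {n : ℕ}
    (hF : ∀ t, stablyNull Theta A
      ((difference A t).obj ((crossEffectAt A ⟨n⟩).obj ((restrict A).obj F)))) :
    (stableCrossEffect A n).map ((restrict A).map (coeffsTilde.{w} hF)) ≫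
      (stableCrossEffectInd A n).hom.app
        ((stableCrossEffect A n).obj ((restrict A).obj F)) = 𝟙 _ :=
  coeffs_stableCrossEffect.{w} hF

end CoefficientsTilde

/-! ### The two equivalences -/

section Main

open Theta

variable {A : Type u} [Category.{v} A] [Abelian A] [IsGrothendieckAbelian.{w} A]

theorem exactColimits_nat : ∃ _ : HasColimitsOfShape ℕ A, HasExactColimitsOfShape ℕ A := by
  have : HasFilteredColimitsOfSize.{0, 0} A := hasFilteredColimitsOfSize_of_univLE.{0, 0, w, w}
  have : AB5OfSize.{0, 0} A := AB5OfSize_of_univLE.{0, 0, w, w} A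
  exact ⟨HasFilteredColimitsOfSize.HasColimitsOfShape _, AB5OfSize.ofShape _⟩

/-- This only converts integer degrees to the shifted natural index; for `n = 0` the subcategory
divided out consists of the zero objects. -/
theorem nonempty_polQuotient_equivalence {M : Type} [SmallCategory M] [MonoidalCategory M]
    [UnitInitial M] [SymmetricCategory M] {B : Type*} [Category B] [Abelian B] (n : ℕ)
    (h : Nonempty ((isoModIn (St.polynomial.{w} M A (n + 1))
      (St.polynomial.{w} M A n)).Localization ≌ B)) :
    Nonempty (PolQuotient.{w} M A n ≌ B) := by
  have h₁ : ((n : ℤ) + 1).toNat = n + 1 := by lia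
  have h₂ : ((n : ℤ) - 1 + 1).toNat = n := by lia
  have : isoModPol.{w} M A n = isoModIn (Pol.{w} M A n) (Pol.{w} M A (n - 1)) := rfl
  unfold PolQuotient
  rw [this]
  unfold Pol
  rw [h₁, h₂]
  exact h

theorem nonempty_polQuotient_theta (n : ℕ) :
    Nonempty (PolQuotient.{w} Theta A n ≌ (SingleObj (Equiv.Perm (Fin n)) ⥤ A)) := by
  obtain ⟨_, _⟩ := exactColimits_nat.{w} (A := A)
  obtain ⟨_, _⟩ := exact_stableCrossEffect.{w} (A := A) n
  refine nonempty_polQuotient_equivalence.{w} n (nonempty_subquotient_equivalence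
    (stablyNull Theta A) (St.proj.{w} Theta A)
    (fun X hX => St.polynomial_of_isZero.{w} isGenerator_pt n hX)
    (stableCrossEffect A n) (isZero_stableCrossEffect_iff.{w} n)
    (indFunctor A n ⋙ restrict A) (fun N => polynomial_indTheta.{w})
    (stableCrossEffectInd A n)
    (fun F hF => coeffs.{w} (stablyNull_difference_crossEffect.{w} n hF))
    (fun {F G} f hF hG => NatTrans.ext (funext fun S => coeffsApp_naturality f S))
    (fun F hF => coeffs_stableCrossEffect.{w} _))

/-- The exact functor is the one used for `Θ`, preceded by restriction. Its section needs no
restriction, since the induced functor lives on `Θ̃` from the start. -/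
theorem nonempty_polQuotient_tilde (n : ℕ) :
    Nonempty (PolQuotient.{w} (Tilde Theta) A n ≌ (SingleObj (Equiv.Perm (Fin n)) ⥤ A)) := by
  obtain ⟨_, _⟩ := exactColimits_nat.{w} (A := A)
  obtain ⟨_, _⟩ := exact_stableCrossEffect.{w} (A := A) n
  have : PreservesFiniteLimits (restrict A ⋙ stableCrossEffect A n) :=
    comp_preservesFiniteLimits _ _
  have : PreservesFiniteColimits (restrict A ⋙ stableCrossEffect A n) :=
    comp_preservesFiniteColimits _ _
  have hpol := fun d => polynomial_restrict_iff.{w} (A := A) isGenerator_pt d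
  refine nonempty_polQuotient_equivalence.{w} n (nonempty_subquotient_equivalence
    (stablyNull (Tilde Theta) A) (St.proj.{w} (Tilde Theta) A)
    (fun X hX => St.polynomial_of_isZero.{w} isGenerator_pt.tilde n hX)
    (restrict A ⋙ stableCrossEffect A n)
    (fun F => (isZero_stableCrossEffect_iff.{w} n _).trans (hpol n F))
    (indFunctor A n) (fun N => (hpol (n + 1) _).1 polynomial_indTheta.{w})
    (stableCrossEffectInd A n)
    (fun F hF => coeffsTilde.{w}
      (stablyNull_difference_crossEffect.{w} n ((hpol (n + 1) F).2 hF)))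
    (fun f hF hG => coeffsTilde_naturality.{w} f _ _)
    (fun F hF => coeffsTilde_stableCrossEffect.{w} _))

end Main

theorem mainTheorem7 (A : Type u) [Category.{v} A] [Abelian A] [IsGrothendieckAbelian.{w} A]
    (n : ℕ) :
    Nonempty (PolQuotient.{w} Theta A n ≌ PolQuotient.{w} (Tilde Theta) A n) ∧
      Nonempty (PolQuotient.{w} (Tilde Theta) A n ≌ (SingleObj (Equiv.Perm (Fin n)) ⥤ A)) := by
  obtain ⟨e⟩ := nonempty_polQuotient_theta.{w} (A := A) n
  obtain ⟨e'⟩ := nonempty_polQuotient_tilde.{w} (A := A) n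
  exact ⟨⟨e.trans e'.symm⟩, ⟨e'⟩⟩
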